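/- **Model.** Let $L\ge 1$, and let $\mathbf W_i=(W_{i1},\dots,W_{iL})$, $i\ge 1$, be i.i.d. random vectors in $\mathbb R_+^L=[0,\infty)^L$, distributed as $\mathbf W=(W_1,\dots,W_L)$. For each layer $l$ let $g_l:\mathbb R_+\to\mathbb R_+$ be Borel measurable. For $N\ge 1$ put $T_l(N)=\sum_{i=1}^N W_{il}$. The $L$-layer multilayer inhomogeneous random graph (MIRG) on $N$ nodes is an array $(A_{ijl})_{i,j\le N,\ l\le L}$ of $\mathbb N_0$-valued random variables with $A_{ijl}=A_{jil}$ such that, conditionally on $\mathbf W_1,\dots,\mathbf W_N$, the variables $A_{ijl}$ ($1\le i\le j\le N$, $1\le l\le L$) are independent with $$A_{ijl}\sim\operatorname{Poisson}\Big(g_l\Big(\frac{W_{il}W_{jl}}{T_l(N)}\Big)\Big)$$ (with $0/0:=0$). The degree of node $i$ in layer $l$ is $D_{il}(N)=\sum_{j=1}^N A_{ijl}$. **Assumptions.** Let $\alpha>0$ and let $s,m$ be layers. 1. $\mathbf W$ is multivariate regularly varying with index $\alpha$ on $\mathbb R_+^L\setminus\{\mathbf 0\}$: there are a function $b$ that is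 regularly varying at infinity with index $1/\alpha$ and a nonzero Borel measure $\nu$ on $\mathbb R_+^L\setminus\{\mathbf 0\}$, finite on sets bounded away from $\mathbf 0$, such that $t\,\mathbb E f(\mathbf W/b(t))\to\int f\,d\nu$ as $t\to\infty$ for every bounded continuous $f\ge 0$ on $\mathbb R_+^L\setminus\{\mathbf 0\}$ whose support is bounded away from $\mathbf 0$. Moreover $\nu(\{x: x_l>0\})>0$ for $l=s,m$, i.e. $W_s$ and $W_m$ have regularly varying tails of index $\alpha$ on the common scale $b$. 2. For $l=s,m$: $g_l(x)/x\to1$ as $x\downarrow0$, and $g_l(x)\le C_l x$ for all $x\ge0$ and some constant $C_l<\infty$; if $\mathbb E W_l=\infty$ (possible only for $\alpha\le1$), also $g_l(x)/x\to1$ as $x\to\infty$. (For example, $g_l(x)=x$ is allowed for every $\alpha>0$.) 3. $(t_N)$ is an intermediate sequence: $t_N$ are integers with $t_N\to\infty$ and $t_N/N\to0$. 4. The upper tail dependence coefficient of the weights exists: $$\lambda_U^{s,m}=\lim_{q\to1^-}\mathbb P\big(W_m>F_m^{-1}(q)\,\big|\,W_s>F_s^{-1}(q)\big),$$ where $F_l$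 is the distribution function of $W_l$ and $F^{-1}(p)=\inf\{x:F(x)\ge p\}$. **Conclusion.** Let $\hat G_{l,N}(x)=\frac1N\sum_{i=1}^N\mathbf 1\{D_{il}(N)\le x\}$, let $\hat u_{l,N}=\hat G_{l,N}^{-1}(1-t_N/N)$, and $$\hat\lambda^{s,m}_{D(N)}=\frac{\sum_{i=1}^N\mathbf 1\{D_{is}(N)>\hat u_{s,N},\ D_{im}(N)>\hat u_{m,N}\}}{\sum_{i=1}^N\mathbf 1\{D_{is}(N)>\hat u_{s,N}\}}$$ (with $0/0:=0$). Then $\hat\lambda^{s,m}_{D(N)}\to\lambda_U^{s,m}$ in probability as $N\to\infty$. -/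

import Mathlib

open MeasureTheory ProbabilityTheory Filter Topology
open scoped NNReal ENNReal BoundedContinuousFunction

namespace MIRG

/-- The closed cone `ℝ₊ᴸ = [0,∞)ᴸ`. -/
abbrev Cone (L : ℕ) : Type := Fin L → ℝ≥0

/-- The class `𝕄(ℝ₊ᴸ ∖ {0})`: Borel measures on `ℝ₊ᴸ ∖ {0}` (encoded as measures on `ℝ₊ᴸ`
giving no mass to the origin) that are finite on sets bounded away from the origin. -/
structure IsMMeasure {L : ℕ} (ν : Measure (Cone L)) : Prop where
  null_zero : ν {0} = 0
  finite_away : ∀ ε : ℝ, 0 < ε → ν {x | ε ≤ dist x 0} < ∞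

/-- `𝕄`-convergence on `ℝ₊ᴸ ∖ {0}`: convergence of integrals of all bounded continuous
non-negative functions whose support is bounded away from the origin (such a function on
`ℝ₊ᴸ ∖ {0}` is the same thing as a continuous function on `ℝ₊ᴸ` vanishing near the origin). -/
def MTendsto {ι : Type*} {L : ℕ} (m : ι → Measure (Cone L)) (l : Filter ι)
    (ν : Measure (Cone L)) : Prop :=
  ∀ f : Cone L →ᵇ ℝ≥0, (∃ ε : ℝ, 0 < ε ∧ ∀ x, dist x 0 < ε → f x = 0) →
    Tendsto (fun i => ∫⁻ x, (f x : ℝ≥0∞) ∂(m i)) l (𝓝 (∫⁻ x, (f x : ℝ≥0∞) ∂ν))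

/-- `b ∈ RV_ρ`: `b` is regularly varying at infinity with index `ρ`. -/
structure RegularlyVarying (b : ℝ≥0 → ℝ≥0) (ρ : ℝ) : Prop where
  measurable : Measurable b
  eventually_pos : ∀ᶠ t in atTop, 0 < b t
  tendsto_ratio : ∀ c : ℝ≥0, 0 < c → Tendsto (fun t => b (c * t) / b t) atTop (𝓝 (c ^ ρ))

/-- `P ∈ MRV(α, b, ν, ℝ₊ᴸ ∖ {0})`: `t · P(Z / b(t) ∈ ·) → ν` in `𝕄(ℝ₊ᴸ ∖ {0})`, where `Z ∼ P`,
`b ∈ RV_{1/α}`, and the limit measure `ν` is not the zero measure. -/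
structure MRV {L : ℕ} (P : Measure (Cone L)) (α : ℝ) (b : ℝ≥0 → ℝ≥0)
    (ν : Measure (Cone L)) : Prop where
  index_pos : 0 < α
  scaling : RegularlyVarying b (1 / α)
  limit_mem : IsMMeasure ν
  limit_ne_zero : ν ≠ 0
  tendsto : MTendsto (fun t : ℝ≥0 => t • P.map (fun z => (b t)⁻¹ • z)) atTop ν

/-- Connection functions `g` with `g(x) ∼ x` as `x ↓ 0` and at most linear growth. -/
structure IsConnectionFunction (g : ℝ≥0 → ℝ≥0) : Prop where
  measurable : Measurable g
  linear_bound : ∃ C : ℝ≥0, ∀ x, g x ≤ C * x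
  tendsto_zero : Tendsto (fun x => g x / x) (𝓝[>] 0) (𝓝 1)

section Model

variable {Ω : Type*} {L : ℕ}

/-- `T_l(N) = ∑_{i ≤ N} W_{il}`; nodes are numbered from `0`. -/
def totalWeight (W : ℕ → Ω → Cone L) (N : ℕ) (l : Fin L) (ω : Ω) : ℝ≥0 :=
  ∑ i : Fin N, W i ω l

/-- The conditional mean `g_l(W_{il} W_{jl} / T_l(N))` of the number of edges between `i` and `j`
in layer `l`. -/
noncomputable def edgeRate (g : Fin L → ℝ≥0 → ℝ≥0) (W : ℕ → Ω → Cone L) (N : ℕ)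
    (i j : Fin N) (l : Fin L) (ω : Ω) : ℝ≥0 :=
  g l (W i ω l * W j ω l / totalWeight W N l ω)

/-- The multilayer inhomogeneous random graphs on `N = 0, 1, 2, …` nodes with connection
functions `g`: the weight vectors `W i` are i.i.d., each adjacency tensor
`A N = (A_{ijl})` is symmetric in `i, j`, and, conditionally on `W_{[N]}`, the entries
`A_{ijl}`, `i ≤ j`, `l ∈ [L]`, are independent with
`A_{ijl} ∼ Poisson(g_l(W_{il} W_{jl} / T_l(N)))`. -/
structure IsMIRG [MeasurableSpace Ω] (μ : Measure Ω) (g : Fin L → ℝ≥0 → ℝ≥0)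
    (W : ℕ → Ω → Cone L) (A : (N : ℕ) → Fin N → Fin N → Fin L → Ω → ℕ) : Prop where
  measurable_connection : ∀ l, Measurable (g l)
  measurable_weight : ∀ i, Measurable (W i)
  measurable_adj : ∀ N i j l, Measurable (A N i j l)
  indep : iIndepFun W μ
  identDistrib : ∀ i, IdentDistrib (W i) (W 0) μ μ
  symm : ∀ N i j l ω, A N i j l ω = A N j i l ω
  cond_law : ∀ (N : ℕ) (k : Fin N → Fin N → Fin L → ℕ) (B : Set (Fin N → Cone L)),
    MeasurableSet B →
      μ ({ω | (fun i : Fin N => W i ω) ∈ B} ∩ {ω | ∀ i j l, i ≤ j → A N i j l ω = k i j l}) =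
        ∫⁻ ω in {ω | (fun i : Fin N => W i ω) ∈ B},
          ∏ i, ∏ j ∈ Finset.Ici i, ∏ l, poissonMeasure (edgeRate g W N i j l ω) {k i j l} ∂μ

/-- `D_{il}(N) = ∑_j A_{ijl}`. -/
def degree (A : (N : ℕ) → Fin N → Fin N → Fin L → Ω → ℕ) (N : ℕ) (i : Fin N) (l : Fin L)
    (ω : Ω) : ℕ :=
  ∑ j, A N i j l ω

/-- The generalized inverse `F⁻¹(p) = inf {x : F(x) ≥ p}`. -/
noncomputable def genInv (F : ℝ → ℝ) (p : ℝ) : ℝ :=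
  sInf {x | p ≤ F x}

/-- The empirical distribution function of the degrees in layer `l`. -/
noncomputable def empiricalCDF (A : (N : ℕ) → Fin N → Fin N → Fin L → Ω → ℕ) (N : ℕ)
    (l : Fin L) (ω : Ω) (x : ℝ) : ℝ :=
  (Finset.univ.filter fun i : Fin N => (degree A N i l ω : ℝ) ≤ x).card / (N : ℝ)

/-- The empirical `(1 - t_N / N)`-quantile of the degrees in layer `l`. -/
noncomputable def empiricalQuantile (A : (N : ℕ) → Fin N → Fin N → Fin L → Ω → ℕ) (t : ℕ → ℕ)
    (N : ℕ) (l : Fin L) (ω : Ω) : ℝ :=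
  genInv (empiricalCDF A N l ω) (1 - (t N : ℝ) / (N : ℝ))

/-- The empirical upper tail dependence estimator between layers `s` and `m`. -/
noncomputable def utdEstimator (A : (N : ℕ) → Fin N → Fin N → Fin L → Ω → ℕ) (t : ℕ → ℕ)
    (s m : Fin L) (N : ℕ) (ω : Ω) : ℝ :=
  ((Finset.univ.filter fun i : Fin N =>
      empiricalQuantile A t N s ω < (degree A N i s ω : ℝ) ∧
        empiricalQuantile A t N m ω < (degree A N i m ω : ℝ)).card : ℝ) /
    ((Finset.univ.filter fun i : Fin N =>
      empiricalQuantile A t N s ω < (degree A N i s ω : ℝ)).card : ℝ)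

end Model

/-- The quantile `F_l⁻¹(q)` of the `l`-th marginal of a distribution `P` on `ℝ₊ᴸ`. -/
noncomputable def marginalQuantile {L : ℕ} (P : Measure (Cone L)) (l : Fin L) (q : ℝ) : ℝ :=
  genInv (cdf (P.map fun w => (w l : ℝ))) q

/-- The upper tail dependence at level `q` between layers `s` and `m`:
`λ(q) = P(W_m > F_m⁻¹(q) | W_s > F_s⁻¹(q))`. -/
noncomputable def utd {L : ℕ} (P : Measure (Cone L)) (s m : Fin L) (q : ℝ) : ℝ :=
  (cond P {w | marginalQuantile P s q < (w s : ℝ)}).real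
    {w | marginalQuantile P m q < (w m : ℝ)}

/-- `lam` is the upper tail dependence coefficient `λ_U = lim_{q ↑ 1} λ(q)`. -/
def IsUTDCoefficient {L : ℕ} (P : Measure (Cone L)) (s m : Fin L) (lam : ℝ) : Prop :=
  Tendsto (utd P s m) (𝓝[<] 1) (𝓝 lam)

/-- An intermediate sequence of integers: `t_N → ∞` and `t_N / N → 0`
(so that `0 < t_N < N` for all large `N`). -/
structure IsIntermediate (t : ℕ → ℕ) : Prop where
  tendsto_atTop : Tendsto t atTop atTop
  tendsto_ratio : Tendsto (fun N => (t N : ℝ) / (N : ℝ)) atTop (𝓝 0)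

end MIRG

/-! Put `a_N = B(N / t_N)`, the scale of the `t_N` largest weights. In either layer the mean degree
of a node given all weights is `Λ_i = ∑_j g(W_i W_j / T)`. For `g(x) = x` this equals `W_i`, and
Poisson fluctuations at height `a_N` are of smaller order than `a_N`. So the nodes whose degree
exceeds `x a_N` should be those whose weight exceeds `x a_N`, up to `o(t_N)` exceptions. The
estimator then behaves like a ratio of counts of i.i.d. weight vectors in rare sets, which a second
moment bound controls. Its limit is identified by rewriting `λ_U` at the thresholds `θ_s a_N`, `θ_m
a_N`.

Degrees are compared with weights in two steps. From `Λ` to the degree (`IsMIRG.chernoff`,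
`IsMIRG.whp_chernoff`): given the weights a degree has Poisson exponential moments, so a deviation
by a constant factor at height `x a_N` has probability at most `exp(-κ a_N)`. The expected number of
such nodes is `o(t_N)` because `n exp(-κ B(n)) → 0`.

From the weight to `Λ` (`IsMIRG.whp_meanDegree`): for `W_i` of order `a_N`, the function `g` is
close to the identity at `W_i W_j / T` unless `W_j` lies in a window at the scale `τ_N / a_N`, where
`τ_N` is the order of `T`. It suffices that the window carries a negligible share of the total
weight. With finite mean the window is a half-line moving to infinity. With infinite mean it is an
interval between two multiples of `τ_N / a_N`, the assumption on `g` at infinity deals with the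
weights beyond it, and `α ≤ 1` spreads the truncated mean over so many dyadic scales that the scale
`τ_N / a_N = o(τ_N)` contributes little.

`IsMIRG.whp_mismatch` combines these steps. `IsMIRG.whp_quantile_mismatch` replaces `x a_N` by the
empirical quantile, which lies near `θ a_N`. Each layer is treated separately and the two lists of
exceptional nodes are added, so no joint estimate of degrees in different layers is required.
Regular variation is used through monotonicity and comparison of `F(2y)` with `F(y)`, in place of
Karamata's theorems. -/

namespace MIRG

/-! ### Regularly varying tails -/

/-- A nonnegative function that contracts by a factor `q < 1` under doubling of its argument
tends to zero. -/
theorem tendsto_zero_of_doubling {φ : ℝ → ℝ} {q Y M : ℝ} (hq0 : 0 ≤ q) (hq : q < 1) (hY : 0 < Y)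
    (h0 : ∀ y, Y ≤ y → 0 ≤ φ y) (hM : ∀ y, Y ≤ y → y ≤ 2 * Y → φ y ≤ M)
    (hφ : ∀ y, Y ≤ y → φ (2 * y) ≤ q * φ y) : Tendsto φ atTop (𝓝 0) := by
  have hM0 : 0 ≤ M := (h0 Y le_rfl).trans (hM Y le_rfl (by linarith))
  have key : ∀ k : ℕ, ∀ y, 2 ^ k * Y ≤ y → φ y ≤ q ^ k * M := by
    -- Induction over the dyadic shells `[2^j Y, 2^(j+1) Y]`: halving the argument moves down one
    -- shell and gains a factor `q`. The bound is claimed for all `k ≤ j` so that it also serves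
    -- points beyond shell `k`.
    have step : ∀ j : ℕ, ∀ k : ℕ, k ≤ j → ∀ y, 2 ^ j * Y ≤ y → y ≤ 2 ^ (j + 1) * Y →
        φ y ≤ q ^ k * M := by
      intro j
      induction j with
      | zero =>
        intro k hk y h1 h2
        obtain rfl : k = 0 := by omega
        simpa using hM y (by simpa using h1) (by simpa using h2)
      | succ j ih =>
        intro k hk y h1 h2
        have hy : 2 ^ j * Y ≤ y / 2 := by rw [pow_succ] at h1; linarith
        have hy2 : y / 2 ≤ 2 ^ (j + 1) * Y := by rw [pow_succ (2 : ℝ) (j + 1)] at h2; linarith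
        have hYy : Y ≤ y / 2 := le_trans (by nlinarith [one_le_pow₀ (n := j) (one_le_two (α := ℝ))]) hy
        have h3 := hφ (y / 2) hYy
        rw [mul_div_cancel₀ y two_ne_zero] at h3
        rcases Nat.eq_zero_or_pos k with rfl | hkp
        · have := ih 0 (Nat.zero_le _) (y / 2) hy hy2
          have h5 : q * φ (y / 2) ≤ 1 * φ (y / 2) :=
            mul_le_mul_of_nonneg_right hq.le (h0 _ hYy)
          simp only [pow_zero, one_mul] at *
          linarith
        · obtain ⟨k', rfl⟩ : ∃ k', k = k' + 1 := ⟨k - 1, by omega⟩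
          have := ih k' (by omega) (y / 2) hy hy2
          calc φ y ≤ q * φ (y / 2) := h3
            _ ≤ q * (q ^ k' * M) := by gcongr
            _ = q ^ (k' + 1) * M := by ring
    intro k y hy
    have hyY : 1 ≤ y / Y := by
      rw [le_div_iff₀ hY, one_mul]
      exact le_trans (by nlinarith [one_le_pow₀ (n := k) (one_le_two (α := ℝ))]) hy
    obtain ⟨j, hj1, hj2⟩ := exists_nat_pow_near hyY (one_lt_two)
    rw [le_div_iff₀ hY] at hj1
    rw [div_lt_iff₀ hY] at hj2
    refine step j k ?_ y hj1 hj2.le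
    have : (2 : ℝ) ^ k < 2 ^ (j + 1) := by
      have := hy.trans_lt hj2
      exact lt_of_mul_lt_mul_right this hY.le
    have := (pow_lt_pow_iff_right₀ (one_lt_two (α := ℝ))).1 this
    omega
  rw [Metric.tendsto_atTop]
  intro ε hε
  have hlim : Tendsto (fun k : ℕ => q ^ k * M) atTop (𝓝 (0 * M)) :=
    (tendsto_pow_atTop_nhds_zero_of_lt_one hq0 hq).mul_const M
  rw [zero_mul] at hlim
  obtain ⟨k, hk⟩ := (hlim.eventually (gt_mem_nhds hε)).exists
  refine ⟨2 ^ k * Y, fun y hy => ?_⟩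
  have hYy : Y ≤ y := le_trans (by nlinarith [one_le_pow₀ (n := k) (one_le_two (α := ℝ))]) hy
  rw [Real.dist_eq, sub_zero, abs_of_nonneg (h0 y hYy)]
  exact (key k y hy).trans_lt hk

/-- `F` is the tail function of a nonnegative random variable with `n F(x B(n)) → c x^{-α}`. -/
structure RegTail (F B : ℝ → ℝ) (c α : ℝ) : Prop where
  anti : Antitone F
  nonneg : ∀ x, 0 ≤ F x
  le_one : ∀ x, F x ≤ 1
  c_pos : 0 < c
  index_pos : 0 < α
  scale : Tendsto B atTop atTop
  tail : ∀ x : ℝ, 0 < x → Tendsto (fun n => n * F (x * B n)) atTop (𝓝 (c * x ^ (-α)))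

namespace RegTail

variable {F B : ℝ → ℝ} {c α : ℝ} {ι : Type*} {l : Filter ι}

theorem pos (h : RegTail F B c α) (y : ℝ) : 0 < F y := by
  have h1 := h.tail 1 one_pos
  simp only [one_mul, Real.one_rpow, mul_one] at h1
  obtain ⟨n, hn, hB, hn0⟩ := ((h1.eventually (lt_mem_nhds h.c_pos)).and
    ((h.scale.eventually_ge_atTop y).and (eventually_gt_atTop 0))).exists
  exact (pos_of_mul_pos_right hn hn0.le).trans_le (h.anti hB)

theorem tendsto_zero (h : RegTail F B c α) : Tendsto F atTop (𝓝 0) := by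
  have h1 := h.tail 1 one_pos
  simp only [one_mul, Real.one_rpow, mul_one] at h1
  have h2 : Tendsto (fun n => (n * F (B n)) / n) atTop (𝓝 0) := h1.div_atTop tendsto_id
  rw [Metric.tendsto_atTop]
  intro ε hε
  obtain ⟨n, hn, hn0⟩ := ((h2.eventually (gt_mem_nhds hε)).and (eventually_gt_atTop 0)).exists
  refine ⟨B n, fun y hy => ?_⟩
  rw [Real.dist_eq, sub_zero, abs_of_nonneg (h.nonneg y)]
  rw [mul_div_cancel_left₀ _ hn0.ne'] at hn
  exact (h.anti hy).trans_lt hn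

theorem continuousAt_limit {x : ℝ} (hx : 0 < x) :
    ContinuousAt (fun x : ℝ => c * x ^ (-α)) x :=
  continuousAt_const.mul (Real.continuousAt_rpow_const _ _ (Or.inl hx.ne'))

/-- Monotonicity of `F` squeezes a moving threshold between fixed multiples of `B(n)`, and the limit
is continuous in the multiple, so no uniform convergence theorem is needed. -/
theorem tendsto_of_ratio (h : RegTail F B c α) {n y : ι → ℝ} {x : ℝ} (hn : Tendsto n l atTop)
    (hx : 0 < x) (hy : Tendsto (fun i => y i / B (n i)) l (𝓝 x)) :
    Tendsto (fun i => n i * F (y i)) l (𝓝 (c * x ^ (-α))) := by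
  have hB : ∀ᶠ i in l, 0 < B (n i) := (h.scale.comp hn).eventually_gt_atTop 0
  have hn0 : ∀ᶠ i in l, 0 < n i := hn.eventually_gt_atTop 0
  have hc := continuousAt_limit (c := c) (α := α) hx
  rw [tendsto_order]
  constructor
  · intro e he
    have : ∀ᶠ z in 𝓝[>] x, e < c * z ^ (-α) :=
      (hc.eventually (lt_mem_nhds he)).filter_mono nhdsWithin_le_nhds
    obtain ⟨z, hz, hzx⟩ := (this.and self_mem_nhdsWithin).exists
    have hzx : x < z := hzx
    filter_upwards [((h.tail z (hx.trans hzx)).comp hn).eventually (lt_mem_nhds hz), hB, hn0,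
      hy.eventually (gt_mem_nhds hzx)] with i h1 h2 h3 h4
    rw [div_lt_iff₀ h2] at h4
    exact h1.trans_le (mul_le_mul_of_nonneg_left (h.anti h4.le) h3.le)
  · intro e he
    have : ∀ᶠ z in 𝓝[<] x, c * z ^ (-α) < e :=
      (hc.eventually (gt_mem_nhds he)).filter_mono nhdsWithin_le_nhds
    have h0 : ∀ᶠ z in 𝓝[<] x, 0 < z := (lt_mem_nhds hx).filter_mono nhdsWithin_le_nhds
    obtain ⟨z, ⟨hz, hz0⟩, hzx⟩ := ((this.and h0).and self_mem_nhdsWithin).exists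
    have hzx : z < x := hzx
    filter_upwards [((h.tail z hz0).comp hn).eventually (gt_mem_nhds hz), hB, hn0,
      hy.eventually (lt_mem_nhds hzx)] with i h1 h2 h3 h4
    rw [lt_div_iff₀ h2] at h4
    exact (mul_le_mul_of_nonneg_left (h.anti h4.le) h3.le).trans_lt h1

/-- The threshold constant: the `(1 - 1/n)`-quantile is asymptotic to `θ B(n)`. -/
noncomputable def thr (c α : ℝ) : ℝ := c ^ (1 / α)

theorem thr_pos (h : RegTail F B c α) : 0 < thr c α := Real.rpow_pos_of_pos h.c_pos _

theorem limit_mul_thr (h : RegTail F B c α) {x : ℝ} (hx : 0 < x) :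
    c * (x * thr c α) ^ (-α) = x ^ (-α) := by
  rw [Real.mul_rpow hx.le h.thr_pos.le, thr, ← Real.rpow_mul h.c_pos.le]
  have : 1 / α * -α = -1 := by have := h.index_pos.ne'; field_simp
  rw [this, Real.rpow_neg_one]
  have := h.c_pos.ne'
  field_simp

/-- The two hypotheses say that `y` is a generalized `(1 - 1/n)`-quantile, allowing for atoms. A
threshold `x θ B(n)` has `n F → x^(-α)`, which is above `1` for `x < 1` and below `1` for `x > 1`,
so `y` is trapped near `θ B(n)`. -/
theorem ratio_of_inversion (h : RegTail F B c α) {n y : ι → ℝ} (hn : Tendsto n l atTop)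
    (h1 : ∀ᶠ i in l, n i * F (y i) ≤ 1) (h2 : ∀ᶠ i in l, ∀ z < y i, 1 ≤ n i * F z) :
    Tendsto (fun i => y i / B (n i)) l (𝓝 (thr c α)) := by
  have hB : ∀ᶠ i in l, 0 < B (n i) := (h.scale.comp hn).eventually_gt_atTop 0
  have hn0 : ∀ᶠ i in l, 0 < n i := hn.eventually_gt_atTop 0
  have hθ := h.thr_pos
  have gen : ∀ x : ℝ, 0 < x → Tendsto (fun i => n i * F (x * thr c α * B (n i))) l (𝓝 (x ^ (-α))) := by
    intro x hx
    have := (h.tail (x * thr c α) (mul_pos hx hθ)).comp hn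
    rwa [h.limit_mul_thr hx] at this
  have lower : ∀ e, 0 < e → e < thr c α → ∀ᶠ i in l, e < y i / B (n i) := by
    intro e he0 he
    have hx : 0 < e / thr c α := div_pos he0 hθ
    have hx1 : 1 < (e / thr c α) ^ (-α) :=
      Real.one_lt_rpow_of_pos_of_lt_one_of_neg hx ((div_lt_one hθ).2 he) (by linarith [h.index_pos])
    have h3 := (gen _ hx).eventually (lt_mem_nhds hx1)
    rw [div_mul_cancel₀ _ hθ.ne'] at h3
    filter_upwards [h1, h3, hB, hn0] with i i1 i3 i4 i5
    rw [lt_div_iff₀ i4]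
    by_contra hcon
    push Not at hcon
    have := mul_le_mul_of_nonneg_left (h.anti hcon) i5.le
    linarith
  rw [tendsto_order]
  constructor
  · intro e he
    have he' : max e (thr c α / 2) < thr c α := max_lt he (by linarith)
    filter_upwards [lower _ (lt_max_of_lt_right (by linarith)) he'] with i hi
    exact (le_max_left _ _).trans_lt hi
  · intro e he
    obtain ⟨e', he1, he2⟩ := exists_between he
    have hx : 1 < e' / thr c α := (one_lt_div hθ).2 he1
    have hx1 : (e' / thr c α) ^ (-α) < 1 :=
      Real.rpow_lt_one_of_one_lt_of_neg hx (by linarith [h.index_pos])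
    have h3 := (gen _ (one_pos.trans hx)).eventually (gt_mem_nhds hx1)
    rw [div_mul_cancel₀ _ hθ.ne'] at h3
    filter_upwards [h2, h3, hB] with i i2 i3 i4
    rw [div_lt_iff₀ i4]
    by_contra hcon
    push Not at hcon
    have hlt : e' * B (n i) < y i := (mul_lt_mul_of_pos_right he2 i4).trans_le hcon
    linarith [i2 _ hlt]

/-- Every `y` is a quantile at its own level `n = 1 / F(y)`, hence `y ~ θ B(n)`. The tail limit at
`2y` is then regular variation of `F` itself, at the ratio `2`. -/
theorem tendsto_ratio_two (h : RegTail F B c α) :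
    Tendsto (fun y => F (2 * y) / F y) atTop (𝓝 ((2 : ℝ) ^ (-α))) := by
  have hn : Tendsto (fun y => (F y)⁻¹) atTop atTop :=
    tendsto_inv_nhdsGT_zero.comp
      (tendsto_nhdsWithin_of_tendsto_nhds_of_eventually_within _ h.tendsto_zero
        (Eventually.of_forall fun y => h.pos y))
  have h1 : Tendsto (fun y => y / B ((F y)⁻¹)) atTop (𝓝 (thr c α)) := by
    refine h.ratio_of_inversion hn (Eventually.of_forall fun y => ?_)
      (Eventually.of_forall fun y z hz => ?_)
    · rw [inv_mul_cancel₀ (h.pos y).ne']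
    · rw [inv_mul_eq_div, one_le_div (h.pos y)]
      exact h.anti hz.le
  have h2 : Tendsto (fun y => 2 * y / B ((F y)⁻¹)) atTop (𝓝 (2 * thr c α)) := by
    simpa only [mul_div_assoc] using h1.const_mul 2
  have h3 := h.tendsto_of_ratio hn (mul_pos two_pos h.thr_pos) h2
  rw [h.limit_mul_thr two_pos] at h3
  simpa only [inv_mul_eq_div] using h3

theorem exists_ratio_le (h : RegTail F B c α) {q : ℝ} (hq : (2 : ℝ) ^ (-α) < q) :
    ∃ Y, 0 < Y ∧ ∀ y, Y ≤ y → F (2 * y) ≤ q * F y := by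
  obtain ⟨Y, hY⟩ := eventually_atTop.1 (h.tendsto_ratio_two.eventually (gt_mem_nhds hq))
  refine ⟨max Y 1, by positivity, fun y hy => ?_⟩
  have := hY y ((le_max_left _ _).trans hy)
  rw [div_lt_iff₀ (h.pos y)] at this
  exact this.le

theorem exists_le_ratio (h : RegTail F B c α) {q : ℝ} (hq : q < (2 : ℝ) ^ (-α)) :
    ∃ Y, 0 < Y ∧ ∀ y, Y ≤ y → q * F y ≤ F (2 * y) := by
  obtain ⟨Y, hY⟩ := eventually_atTop.1 (h.tendsto_ratio_two.eventually (lt_mem_nhds hq))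
  refine ⟨max Y 1, by positivity, fun y hy => ?_⟩
  have := hY y ((le_max_left _ _).trans hy)
  rw [lt_div_iff₀ (h.pos y)] at this
  exact this.le

theorem two_rpow_neg_lt_one (h : RegTail F B c α) : (2 : ℝ) ^ (-α) < 1 :=
  Real.rpow_lt_one_of_one_lt_of_neg one_lt_two (by linarith [h.index_pos])

/-- When `y` doubles, `F` loses at most a fixed factor `ρ`, while the exponential is squared and
thus gains the factor `exp(-κ y)`, eventually below `ρ / 2`. The quotient contracts by `1/2`. -/
theorem tendsto_exp_div (h : RegTail F B c α) {κ : ℝ} (hκ : 0 < κ) :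
    Tendsto (fun y => Real.exp (-κ * y) / F y) atTop (𝓝 0) := by
  set ρ : ℝ := (2 : ℝ) ^ (-α) / 2 with hρ
  have hρ0 : 0 < ρ := by positivity
  obtain ⟨Y, hY, hF⟩ := h.exists_le_ratio (q := ρ) (half_lt_self (by positivity))
  have hexp : Tendsto (fun y : ℝ => Real.exp (-κ * y)) atTop (𝓝 0) :=
    Real.tendsto_exp_atBot.comp (tendsto_id.const_mul_atTop_of_neg (neg_lt_zero.2 hκ))
  obtain ⟨Y', hY'⟩ := eventually_atTop.1
    (hexp.eventually (gt_mem_nhds (show (0 : ℝ) < ρ / 2 by positivity)))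
  set Z := max Y Y' with hZ
  have hZ0 : 0 < Z := lt_max_of_lt_left hY
  refine tendsto_zero_of_doubling (q := 1 / 2) (Y := Z) (M := 1 / F (2 * Z)) (by norm_num)
    (by norm_num) hZ0 (fun y _ => div_nonneg (Real.exp_pos _).le (h.nonneg y)) ?_ ?_
  · intro y h1 h2
    have : Real.exp (-κ * y) ≤ 1 := Real.exp_le_one_iff.2 (by nlinarith)
    have := h.pos (2 * Z)
    gcongr
    exact h.anti h2
  · intro y hy
    have h1 := hF y ((le_max_left _ _).trans hy)
    have h2 := hY' y ((le_max_right _ _).trans hy)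
    have hp := h.pos y
    have e : Real.exp (-κ * (2 * y)) = Real.exp (-κ * y) * Real.exp (-κ * y) := by
      rw [← Real.exp_add]; ring_nf
    rw [e, div_le_iff₀ (h.pos _)]
    have h3 : 1 / 2 * (Real.exp (-κ * y) / F y) * (ρ * F y) = Real.exp (-κ * y) * (ρ / 2) := by
      field_simp
    calc _ ≤ Real.exp (-κ * y) * (ρ / 2) := by gcongr
      _ = 1 / 2 * (Real.exp (-κ * y) / F y) * (ρ * F y) := h3.symm
      _ ≤ _ := by gcongr

/-- `B` grows faster than any multiple of the logarithm. -/
theorem tendsto_mul_exp (h : RegTail F B c α) {κ : ℝ} (hκ : 0 < κ) :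
    Tendsto (fun n => n * Real.exp (-κ * B n)) atTop (𝓝 0) := by
  have h1 := h.tail 1 one_pos
  simp only [one_mul, Real.one_rpow, mul_one] at h1
  have h2 := h1.mul ((h.tendsto_exp_div hκ).comp h.scale)
  rw [mul_zero] at h2
  refine h2.congr fun n => ?_
  have := (h.pos (B n)).ne'
  simp only [Function.comp_apply]
  field_simp

/-! ### Truncated means -/

/-- The truncated mean `E[X ∧ y] = ∫₀^y P(X > u) du` in terms of the tail function. -/
noncomputable def tmean (F : ℝ → ℝ) (y : ℝ) : ℝ := ∫ u in (0 : ℝ)..y, F u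

theorem intble (h : RegTail F B c α) (x y : ℝ) : IntervalIntegrable F volume x y :=
  h.anti.intervalIntegrable

theorem tmean_sub (h : RegTail F B c α) (x y : ℝ) :
    tmean F y - tmean F x = ∫ u in x..y, F u :=
  intervalIntegral.integral_interval_sub_left (h.intble _ _) (h.intble _ _)

theorem integral_le (h : RegTail F B c α) {x y : ℝ} (hxy : x ≤ y) :
    ∫ u in x..y, F u ≤ (y - x) * F x := by
  calc ∫ u in x..y, F u ≤ ∫ _ in x..y, F x :=
        intervalIntegral.integral_mono_on hxy (h.intble _ _) (by simp) fun u hu => h.anti hu.1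
    _ = _ := by simp

theorem le_integral (h : RegTail F B c α) {x y : ℝ} (hxy : x ≤ y) :
    (y - x) * F y ≤ ∫ u in x..y, F u := by
  calc (y - x) * F y = ∫ _ in x..y, F y := by simp
    _ ≤ ∫ u in x..y, F u :=
        intervalIntegral.integral_mono_on hxy (by simp) (h.intble _ _) fun u hu => h.anti hu.2

theorem tmean_mono (h : RegTail F B c α) : Monotone (tmean F) := fun x y hxy => by
  have := h.le_integral hxy
  rw [← h.tmean_sub] at this
  nlinarith [h.nonneg y]

theorem tmean_pos (h : RegTail F B c α) {y : ℝ} (hy : 0 < y) : 0 < tmean F y := by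
  have := h.le_integral hy.le
  have := h.pos y
  unfold tmean
  nlinarith

theorem tmean_nonneg (h : RegTail F B c α) {y : ℝ} (hy : 0 ≤ y) : 0 ≤ tmean F y := by
  have := h.le_integral hy
  have := h.pos y
  unfold tmean
  nlinarith

theorem tmean_continuous (h : RegTail F B c α) : Continuous (tmean F) :=
  intervalIntegral.continuous_primitive (fun x y => h.intble x y) 0

/-- Substituting `u ↦ 2u` gives `∫_{2Y}^{2y} F = 2 ∫_Y^y F(2u) du ≤ 2q ∫_Y^y F`. The part below `2Y`
costs at most `2Y` since `F ≤ 1`. -/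
theorem tmean_two_mul_le (h : RegTail F B c α) {q : ℝ} (hq : (2 : ℝ) ^ (-α) < q) :
    ∃ Y, 0 < Y ∧ ∀ y, Y ≤ y → tmean F (2 * y) ≤ 2 * Y + 2 * q * tmean F y := by
  have hq0 : 0 < q := lt_trans (by positivity) hq
  obtain ⟨Y, hY, hF⟩ := h.exists_ratio_le hq
  refine ⟨Y, hY, fun y hy => ?_⟩
  have e1 : tmean F (2 * Y) ≤ 2 * Y := by
    have := h.integral_le (x := 0) (y := 2 * Y) (by linarith)
    have := h.le_one 0
    unfold tmean
    nlinarith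
  have e2 : tmean F (2 * y) - tmean F (2 * Y) = 2 * ∫ u in Y..y, F (2 * u) := by
    rw [h.tmean_sub, intervalIntegral.integral_comp_mul_left _ two_ne_zero]
    simp
  have i2 : Antitone fun u => F (2 * u) := fun u v huv => h.anti (by linarith)
  have e3 : ∫ u in Y..y, F (2 * u) ≤ ∫ u in Y..y, q * F u :=
    intervalIntegral.integral_mono_on hy i2.intervalIntegrable ((h.intble _ _).const_mul q)
      fun u hu => hF u hu.1
  rw [intervalIntegral.integral_const_mul, ← h.tmean_sub] at e3
  nlinarith [h.tmean_nonneg hY.le]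

theorem tmean_tendsto_atTop_or (h : RegTail F B c α) :
    Tendsto (tmean F) atTop atTop ∨ ∃ M, 0 < M ∧ Tendsto (tmean F) atTop (𝓝 M) := by
  rcases tendsto_atTop_of_monotone h.tmean_mono with h1 | ⟨M, hM⟩
  · exact Or.inl h1
  · exact Or.inr ⟨M, (h.tmean_pos one_pos).trans_le (h.tmean_mono.ge_of_tendsto hM 1), hM⟩

/-- The factor `r < 2` makes the truncated mean grow strictly slower than linearly, with geometric
gain over dyadic scales. If the mean is infinite, `2Y + 2q m ≤ (1 + q) m` for a large truncated mean
`m`. If it is finite, any factor above `1` works eventually. -/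
theorem tmean_doubling (h : RegTail F B c α) :
    ∃ r Y, 1 ≤ r ∧ r < 2 ∧ 0 < Y ∧ ∀ y, Y ≤ y → tmean F (2 * y) ≤ r * tmean F y := by
  rcases h.tmean_tendsto_atTop_or with h1 | ⟨M, hM0, hM⟩
  · obtain ⟨q, hq1, hq2⟩ := exists_between h.two_rpow_neg_lt_one
    have hq0 : 0 < q := lt_trans (by positivity) hq1
    obtain ⟨Y, hY, hF⟩ := h.tmean_two_mul_le hq1
    obtain ⟨Z, hZ⟩ := eventually_atTop.1 (h1.eventually_ge_atTop (2 * Y / (1 - q)))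
    refine ⟨1 + q, max Y Z, by linarith, by linarith, lt_max_of_lt_left hY, fun y hy => ?_⟩
    have h2 := hF y ((le_max_left _ _).trans hy)
    have h3 := hZ y ((le_max_right _ _).trans hy)
    rw [div_le_iff₀ (by linarith)] at h3
    linarith
  · obtain ⟨Z, hZ⟩ := eventually_atTop.1
      (hM.eventually (lt_mem_nhds (show M / (3 / 2) < M from div_lt_self hM0 (by norm_num))))
    refine ⟨3 / 2, max 1 Z, by norm_num, by norm_num, lt_max_of_lt_left one_pos, fun y hy => ?_⟩
    have h2 := hZ y ((le_max_right _ _).trans hy)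
    rw [div_lt_iff₀ (by norm_num)] at h2
    linarith [h.tmean_mono.ge_of_tendsto hM (2 * y)]

theorem tmean_pow_doubling {r Y : ℝ} (hr : 0 ≤ r) (hY : 0 < Y)
    (hd : ∀ y, Y ≤ y → tmean F (2 * y) ≤ r * tmean F y) (k : ℕ) {y : ℝ} (hy : Y ≤ y) :
    tmean F (2 ^ k * y) ≤ r ^ k * tmean F y := by
  induction k with
  | zero => simp
  | succ k ih =>
    have h1 : Y ≤ 2 ^ k * y := hy.trans (by nlinarith [one_le_pow₀ (n := k) (one_le_two (α := ℝ))])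
    calc tmean F (2 ^ (k + 1) * y) = tmean F (2 * (2 ^ k * y)) := by ring_nf
      _ ≤ r * tmean F (2 ^ k * y) := hd _ h1
      _ ≤ r * (r ^ k * tmean F y) := by gcongr
      _ = _ := by ring

theorem tmean_div_tendsto_zero (h : RegTail F B c α) :
    Tendsto (fun y => tmean F y / y) atTop (𝓝 0) := by
  obtain ⟨r, Y, hr1, hr2, hY, hd⟩ := h.tmean_doubling
  refine tendsto_zero_of_doubling (q := r / 2) (Y := Y) (M := tmean F (2 * Y) / Y) (by linarith)
    (by linarith) hY (fun y hy => div_nonneg (h.tmean_nonneg (by linarith)) (by linarith)) ?_ ?_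
  · intro y h1 h2
    have := h.tmean_nonneg (y := 2 * Y) (by linarith)
    gcongr
    exact h.tmean_mono h2
  · intro y hy
    have hy0 : 0 < y := hY.trans_le hy
    rw [div_le_iff₀ (by positivity)]
    calc _ ≤ r * tmean F y := hd y hy
      _ = _ := by field_simp

/-- For `α > 1` one may take `2q < 1` in `tmean_two_mul_le`. Then `m(y) ≤ m(2y) ≤ 2Y + 2q m(y)`
bounds the truncated mean. -/
theorem index_le_one (h : RegTail F B c α) (hm : Tendsto (tmean F) atTop atTop) : α ≤ 1 := by
  by_contra! hα
  have h2 : (2 : ℝ) ^ (-α) < 1 / 2 := by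
    calc (2 : ℝ) ^ (-α) < 2 ^ (-1 : ℝ) := Real.rpow_lt_rpow_of_exponent_lt one_lt_two (by linarith)
      _ = 1 / 2 := by rw [Real.rpow_neg_one]; norm_num
  obtain ⟨q, hq1, hq2⟩ := exists_between h2
  obtain ⟨Y, hY, hF⟩ := h.tmean_two_mul_le hq1
  obtain ⟨y, hy, hyY⟩ :=
    ((hm.eventually_gt_atTop (2 * Y / (1 - 2 * q))).and (eventually_ge_atTop Y)).exists
  have h3 := hF y hyY
  have h4 := h.tmean_mono (show y ≤ 2 * y by linarith)
  rw [div_lt_iff₀ (by linarith)] at hy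
  linarith

/-- If the mean is infinite, the mass at a scale `y` is negligible with respect to the truncated
mean at much larger scales. -/
theorem mul_tail_le (h : RegTail F B c α) (hm : Tendsto (tmean F) atTop atTop) {ε : ℝ}
    (hε : 0 < ε) :
    ∃ K Y, 0 < K ∧ 0 < Y ∧ ∀ τ y, Y ≤ τ → 0 ≤ y → K * y ≤ τ → y * F y ≤ ε * tmean F τ := by
  have hα := h.index_le_one hm
  -- Each of `k` dyadic blocks above `y` will contribute at least `y F(y) / 4` to the truncated
  -- mean, so `k > 8 / ε` suffices, with `K = 2^k`.
  obtain ⟨k, hk⟩ := exists_nat_gt (8 / ε)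
  have hk0 : (0 : ℝ) < k := lt_trans (by positivity) hk
  have hp : (1 : ℝ) / 2 ≤ 2 ^ (-α) := by
    calc (1 : ℝ) / 2 = 2 ^ (-1 : ℝ) := by rw [Real.rpow_neg_one]; norm_num
      _ ≤ _ := Real.rpow_le_rpow_of_exponent_le one_le_two (by linarith)
  -- a ratio `q` slightly below `1/2` with `(2q)^k ≥ 1/2`
  obtain ⟨d, hd0, hd1, hd⟩ : ∃ d : ℝ, 0 < d ∧ d < 1 ∧ (1 / 2 : ℝ) ≤ d ^ k := by
    have hc : Tendsto (fun d : ℝ => d ^ k) (𝓝[<] 1) (𝓝 (1 ^ k)) :=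
      ((continuous_pow k).tendsto 1).mono_left nhdsWithin_le_nhds
    rw [one_pow] at hc
    have e1 : ∀ᶠ d : ℝ in 𝓝[<] 1, 0 < d := (lt_mem_nhds one_pos).filter_mono nhdsWithin_le_nhds
    obtain ⟨d, ⟨h1, h2⟩, h3⟩ := (((hc.eventually (lt_mem_nhds (by norm_num : (1 / 2 : ℝ) < 1))).and
      e1).and self_mem_nhdsWithin).exists
    exact ⟨d, h2, h3, h1.le⟩
  obtain ⟨Y, hY, hF⟩ := h.exists_le_ratio (q := d / 2) (by linarith)
  obtain ⟨Z, hZ⟩ := eventually_atTop.1 (hm.eventually_ge_atTop (Y / ε))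
  refine ⟨2 ^ k, max Z 1, by positivity, lt_max_of_lt_right one_pos, fun τ y hτ hy0 hτy => ?_⟩
  -- Below `Y` the doubling bound is not available, but there `y F(y) ≤ Y`, which the diverging
  -- truncated mean absorbs.
  rcases le_total y Y with hyY | hyY
  · have h1 := hZ τ ((le_max_left _ _).trans hτ)
    rw [div_le_iff₀ hε] at h1
    nlinarith [h.le_one y, h.nonneg y]
  · have hy : 0 < y := hY.trans_le hyY
    have hpow : ∀ i : ℕ, (d / 2) ^ i * F y ≤ F (2 ^ i * y) := by
      intro i
      induction i with
      | zero => simp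
      | succ i ih =>
        have := hF (2 ^ i * y)
          (hyY.trans (by nlinarith [one_le_pow₀ (n := i) (one_le_two (α := ℝ))]))
        calc (d / 2) ^ (i + 1) * F y = d / 2 * ((d / 2) ^ i * F y) := by ring
          _ ≤ d / 2 * F (2 ^ i * y) := by gcongr
          _ ≤ F (2 * (2 ^ i * y)) := this
          _ = _ := by ring_nf
    -- The block `[2^i y, 2^(i+1) y]` has length `2^i y`, and `F` on it is at least `(d/2)^(i+1)
    -- F(y)`. The powers of two cancel up to `1/2`, and `d^(i+1) ≥ d^k ≥ 1/2`.
    have hsum : ∀ i : ℕ, i ≤ k → (i : ℝ) * (y * F y / 4) ≤ tmean F (2 ^ i * y) := by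
      intro i
      induction i with
      | zero => intro _; simpa using h.tmean_nonneg hy.le
      | succ i ih =>
        intro hi
        have h1 := ih (by omega)
        have h2 := h.le_integral (x := 2 ^ i * y) (y := 2 ^ (i + 1) * y)
          (by rw [pow_succ]; nlinarith [pow_pos (two_pos (α := ℝ)) i])
        rw [← h.tmean_sub] at h2
        have h3 := hpow (i + 1)
        have h4 : (1 / 2 : ℝ) ≤ d ^ (i + 1) :=
          hd.trans (pow_le_pow_of_le_one hd0.le hd1.le hi)
        have h5 : y * F y / 4 ≤ (2 ^ (i + 1) * y - 2 ^ i * y) * F (2 ^ (i + 1) * y) := by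
          calc y * F y / 4 = 1 / 2 * (y * F y / 2) := by ring
            _ ≤ d ^ (i + 1) * (y * F y / 2) := by
              have := h.nonneg y
              gcongr
            _ = 2 ^ i * y * ((d / 2) ^ (i + 1) * F y) := by
              rw [div_pow]; field_simp; ring
            _ ≤ 2 ^ i * y * F (2 ^ (i + 1) * y) := by gcongr
            _ = _ := by ring
        push_cast
        linarith
    have h1 := hsum k le_rfl
    have h2 := h.tmean_mono hτy
    rw [div_lt_iff₀ hε] at hk
    have h3 : 0 ≤ y * F y := mul_nonneg hy.le (h.nonneg y)
    have h4 : 2 * (y * F y) ≤ ε * (k * (y * F y / 4)) := by nlinarith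
    have h5 : ε * (k * (y * F y / 4)) ≤ ε * tmean F τ := by gcongr; linarith
    linarith

/-- With finite mean, `y F(y) ≤ 2 ∫_{y/2}^y F → 0`. Dividing at `y = B(n)` by `n F(B(n)) → c` leaves
`B(n) / n`. -/
theorem scale_div_tendsto_zero (h : RegTail F B c α) {M : ℝ} (hM : Tendsto (tmean F) atTop (𝓝 M)) :
    Tendsto (fun n => B n / n) atTop (𝓝 0) := by
  have h1 : Tendsto (fun y : ℝ => tmean F y - tmean F (y / 2)) atTop (𝓝 0) := by
    simpa using hM.sub (hM.comp (tendsto_id.atTop_div_const two_pos))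
  have h2 : Tendsto (fun y : ℝ => y * F y) atTop (𝓝 0) := by
    have h3 := h1.const_mul 2
    rw [mul_zero] at h3
    refine squeeze_zero' ?_ ?_ h3
    · filter_upwards [eventually_ge_atTop 0] with y hy using mul_nonneg hy (h.nonneg y)
    · filter_upwards [eventually_ge_atTop 0] with y hy
      rw [h.tmean_sub]
      have := h.le_integral (x := y / 2) (y := y) (by linarith)
      linarith
  have h4 := h.tail 1 one_pos
  simp only [one_mul, Real.one_rpow, mul_one] at h4
  have h5 := (h2.comp h.scale).div h4 h.c_pos.ne'
  rw [zero_div] at h5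
  refine h5.congr' ?_
  filter_upwards [eventually_gt_atTop 0] with n hn
  have := (h.pos (B n)).ne'
  change B n * F (B n) / (n * F (B n)) = B n / n
  field_simp

end RegTail
/-! ### Marginal tails of multivariate regularly varying distributions -/

section Marginal

variable {L : ℕ} {P ν : Measure (Cone L)} {α : ℝ} {b : ℝ≥0 → ℝ≥0}

/-- A continuous function interpolating between the indicators of `[y, ∞)` and `(x, ∞)` in the
coordinate `l`. -/
noncomputable def ramp (l : Fin L) (x y : ℝ≥0) : Cone L →ᵇ ℝ≥0 :=
  BoundedContinuousFunction.mkOfBound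
    ⟨fun w => min 1 ((w l - x) / (y - x)),
      continuous_const.min (((continuous_apply l).sub continuous_const).div_const _)⟩ 1
    (fun v w => by
      have h1 : ∀ v : Cone L, ((min 1 ((v l - x) / (y - x)) : ℝ≥0) : ℝ) ≤ 1 := fun v => by
        exact_mod_cast min_le_left _ _
      rw [NNReal.dist_eq, abs_le]
      have h2 := h1 v
      have h3 := h1 w
      have h4 := NNReal.coe_nonneg (min 1 ((v l - x) / (y - x)))
      have h5 := NNReal.coe_nonneg (min 1 ((w l - x) / (y - x)))
      constructor
      · change -1 ≤ ((min 1 ((v l - x) / (y - x)) : ℝ≥0) : ℝ) - (min 1 ((w l - x) / (y - x)) : ℝ≥0)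
        linarith
      · change ((min 1 ((v l - x) / (y - x)) : ℝ≥0) : ℝ) - (min 1 ((w l - x) / (y - x)) : ℝ≥0) ≤ 1
        linarith)

theorem measurableSet_lt_coord (l : Fin L) (x : ℝ≥0) : MeasurableSet {w : Cone L | x < w l} :=
  measurableSet_lt measurable_const (measurable_pi_apply l)

theorem measurableSet_le_coord (l : Fin L) (x : ℝ≥0) : MeasurableSet {w : Cone L | x ≤ w l} :=
  measurableSet_le measurable_const (measurable_pi_apply l)

theorem ramp_le (l : Fin L) (x y : ℝ≥0) (w : Cone L) :
    (ramp l x y w : ℝ≥0∞) ≤ {w : Cone L | x < w l}.indicator 1 w := by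
  by_cases h : x < w l
  · have : ramp l x y w ≤ 1 := min_le_left _ _
    simpa [Set.indicator, h] using this
  · have : ramp l x y w = 0 := by
      change min 1 ((w l - x) / (y - x)) = 0
      rw [tsub_eq_zero_of_le (not_lt.1 h)]
      simp
    simp [this]

theorem le_ramp (l : Fin L) {x y : ℝ≥0} (hxy : x < y) (w : Cone L) :
    {w : Cone L | y ≤ w l}.indicator (1 : Cone L → ℝ≥0∞) w ≤ ramp l x y w := by
  by_cases h : y ≤ w l
  · have : ramp l x y w = 1 := by
      change min 1 ((w l - x) / (y - x)) = 1
      rw [min_eq_left]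
      rw [one_le_div₀ (tsub_pos_of_lt hxy)]
      exact tsub_le_tsub_right h x
    rw [this]
    exact Set.indicator_le_self' (by simp) w
  · simp [Set.indicator, h]

theorem ramp_eq_zero (l : Fin L) {x y : ℝ≥0} {w : Cone L} (hw : dist w 0 < x) :
    ramp l x y w = 0 := by
  have h1 : dist (w l) 0 ≤ dist w 0 := dist_le_pi_dist w 0 l
  have h2 : w l ≤ x := by
    have : (w l : ℝ) ≤ x := by
      have := h1.trans hw.le
      rwa [NNReal.dist_eq, NNReal.coe_zero, sub_zero, NNReal.abs_eq] at this
    exact_mod_cast this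
  change min 1 ((w l - x) / (y - x)) = 0
  rw [tsub_eq_zero_of_le h2]
  simp

/-- The scaled tail `t P(W_l > x b(t))`. -/
noncomputable def scaledTail (P : Measure (Cone L)) (b : ℝ≥0 → ℝ≥0) (l : Fin L) (t x : ℝ≥0) : ℝ≥0∞ :=
  t * P {w | x * b t < w l}

theorem lintegral_scaled (l : Fin L) (t : ℝ≥0) (ht : 0 < b t) (x : ℝ≥0) :
    ∫⁻ w, {w : Cone L | x < w l}.indicator 1 w ∂(t • P.map (fun z => (b t)⁻¹ • z)) =
      scaledTail P b l t x := by
  rw [lintegral_indicator_one (measurableSet_lt_coord l x), Measure.smul_apply,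
    Measure.map_apply (by fun_prop) (measurableSet_lt_coord l x)]
  unfold scaledTail
  have : (fun z : Cone L => (b t)⁻¹ • z) ⁻¹' {w | x < w l} = {w | x * b t < w l} := by
    ext w
    simp only [Set.mem_preimage, Set.mem_ofPred_eq, Pi.smul_apply, smul_eq_mul]
    rw [inv_mul_eq_div, lt_div_iff₀ ht]
  rw [this]
  rfl

/-- Together with `MRV.eventually_lt_of_lt` this is the portmanteau bound for coordinate
half-spaces. The gap `x < y` leaves room for a continuous test function, so boundaries need not be
`ν`-null at this stage. -/
theorem MRV.eventually_le_of_lt (h : MRV P α b ν) (l : Fin L) {x y : ℝ≥0} (hx : 0 < x)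
    (hxy : x < y) {e : ℝ≥0∞} (he : ν {w | x ≤ w l} < e) :
    ∀ᶠ t in atTop, scaledTail P b l t y < e := by
  have h1 := h.tendsto (ramp l x y) ⟨x, by exact_mod_cast hx, fun w hw => ramp_eq_zero l hw⟩
  have h2 : ∫⁻ w, (ramp l x y w : ℝ≥0∞) ∂ν < e := by
    refine lt_of_le_of_lt ?_ he
    calc ∫⁻ w, (ramp l x y w : ℝ≥0∞) ∂ν ≤ ∫⁻ w, {w : Cone L | x < w l}.indicator 1 w ∂ν :=
          lintegral_mono fun w => ramp_le l x y w
      _ = ν {w | x < w l} := lintegral_indicator_one (measurableSet_lt_coord l x)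
      _ ≤ _ := measure_mono fun w (hw : x < w l) => hw.le
  filter_upwards [h1.eventually (gt_mem_nhds h2), h.scaling.eventually_pos] with t ht hb
  refine lt_of_le_of_lt ?_ ht
  rw [← lintegral_scaled l t hb]
  have hsub : {w : Cone L | y < w l} ⊆ {w | y ≤ w l} := fun w (hw : y < w l) => le_of_lt hw
  exact lintegral_mono fun w => le_trans
    (Set.indicator_le_indicator_of_subset hsub (fun _ => zero_le) w) (le_ramp l hxy w)

theorem MRV.eventually_lt_of_lt (h : MRV P α b ν) (l : Fin L) {x y : ℝ≥0} (hx : 0 < x)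
    (hxy : x < y) {e : ℝ≥0∞} (he : e < ν {w | y ≤ w l}) :
    ∀ᶠ t in atTop, e < scaledTail P b l t x := by
  have h1 := h.tendsto (ramp l x y) ⟨x, by exact_mod_cast hx, fun w hw => ramp_eq_zero l hw⟩
  have h2 : e < ∫⁻ w, (ramp l x y w : ℝ≥0∞) ∂ν := by
    refine lt_of_lt_of_le he ?_
    calc ν {w | y ≤ w l} = ∫⁻ w, {w : Cone L | y ≤ w l}.indicator 1 w ∂ν :=
          (lintegral_indicator_one (measurableSet_le_coord l y)).symm
      _ ≤ _ := lintegral_mono fun w => le_ramp l hxy w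
  filter_upwards [h1.eventually (lt_mem_nhds h2), h.scaling.eventually_pos] with t ht hb
  refine lt_of_lt_of_le ht ?_
  rw [← lintegral_scaled l t hb]
  exact lintegral_mono fun w => ramp_le l x y w

theorem IsMMeasure.coord_lt_top (h : IsMMeasure ν) (l : Fin L) {x : ℝ≥0} (hx : 0 < x) :
    ν {w | x ≤ w l} < ∞ := by
  refine lt_of_le_of_lt (measure_mono fun w hw => ?_) (h.finite_away x (by exact_mod_cast hx))
  have h1 : dist (w l) 0 ≤ dist w 0 := dist_le_pi_dist w 0 l
  rw [NNReal.dist_eq, NNReal.coe_zero, sub_zero, NNReal.abs_eq] at h1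
  exact le_trans (NNReal.coe_le_coe.2 hw) h1

/-- Half of the homogeneity of the marginal limit measure. -/
theorem MRV.le_mul (h : MRV P α b ν) (l : Fin L) {c x : ℝ≥0} (hc : 0 < c) (hx : 0 < x) :
    ν {w | x ≤ w l} ≤ c * ν {w | c ^ (1 / α) * x ≤ w l} := by
  set κ := c ^ (1 / α) with hκ
  have hκ0 : 0 < κ := NNReal.rpow_pos hc
  -- The tail at time `c t` is compared with the tail at time `t`: the prefactor changes by `c`, and
  -- `b (c t)` is about `κ b t`. The points `z < z1 < z2 < κ x` supply the gaps needed for the test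
  -- functions and for this approximation.
  have step : ∀ z, 0 < z → z < κ * x → ν {w | x ≤ w l} ≤ c * ν {w | z ≤ w l} := by
    intro z hz hzx
    by_contra! hcon
    obtain ⟨e, he1, he2⟩ := exists_between hcon
    have hcE : (c : ℝ≥0∞) ≠ 0 := by exact_mod_cast hc.ne'
    have he1' : ν {w | z ≤ w l} < e / c := by
      rw [ENNReal.lt_div_iff_mul_lt (Or.inl hcE) (Or.inl ENNReal.coe_ne_top), mul_comm]
      exact he1
    obtain ⟨z1, hz1, hz1x⟩ := exists_between hzx
    obtain ⟨z2, hz2, hz2x⟩ := exists_between hz1x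
    have hx' : z2 / κ < x := by rwa [div_lt_iff₀' hκ0]
    have A := h.eventually_lt_of_lt l (x := z2 / κ) (div_pos (hz.trans (hz1.trans hz2)) hκ0) hx' he2
    have hct : Tendsto (fun t : ℝ≥0 => c * t) atTop atTop := tendsto_id.const_mul_atTop hc
    have A' := hct.eventually A
    have Bv := h.eventually_le_of_lt l hz hz1 he1'
    have C := (h.scaling.tendsto_ratio c hc).eventually
      (lt_mem_nhds (show κ * (z1 / z2) < c ^ (1 / α) by
        rw [← hκ]
        have : z1 / z2 < 1 := (div_lt_one (hz.trans (hz1.trans hz2))).2 hz2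
        calc κ * (z1 / z2) < κ * 1 := by gcongr
          _ = κ := mul_one _))
    obtain ⟨t, ⟨⟨a1, a2⟩, a3⟩, a4⟩ := (((A'.and Bv).and C).and h.scaling.eventually_pos).exists
    have hz2p : 0 < z2 := hz.trans (hz1.trans hz2)
    have : z1 * b t ≤ z2 / κ * b (c * t) := by
      rw [lt_div_iff₀ a4] at a3
      calc z1 * b t = z2 / κ * (κ * (z1 / z2) * b t) := by field_simp
        _ ≤ _ := by gcongr
    have h5 : scaledTail P b l (c * t) (z2 / κ) ≤ c * scaledTail P b l t z1 := by
      unfold scaledTail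
      rw [← mul_assoc, ← ENNReal.coe_mul]
      gcongr with w
    have h6 : c * scaledTail P b l t z1 ≤ e := by
      calc c * scaledTail P b l t z1 ≤ c * (e / c) := by gcongr
        _ ≤ e := ENNReal.mul_div_le
    exact absurd (a1.trans_le (h5.trans h6)) (lt_irrefl _)
  -- continuity from above
  obtain ⟨u, hu, hu2, hu3⟩ := exists_seq_strictMono_tendsto' (mul_pos hκ0 hx)
  have hset : ⋂ k, {w : Cone L | u k ≤ w l} = {w | κ * x ≤ w l} := by
    ext w
    simp only [Set.mem_iInter, Set.mem_ofPred_eq]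
    exact ⟨fun hw => le_of_tendsto' hu3 hw, fun hw k => (hu2 k).2.le.trans hw⟩
  have hlim : Tendsto (fun k => ν {w : Cone L | u k ≤ w l}) atTop (𝓝 (ν {w | κ * x ≤ w l})) := by
    rw [← hset]
    refine tendsto_measure_iInter_atTop
      (fun k => (measurableSet_le_coord l (u k)).nullMeasurableSet) ?_
      ⟨0, (h.limit_mem.coord_lt_top l (hu2 0).1).ne⟩
    intro i j hij w hw
    exact (hu.monotone hij).trans hw
  exact ge_of_tendsto' (ENNReal.Tendsto.const_mul hlim (Or.inr ENNReal.coe_ne_top))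
    fun k => step (u k) (hu2 k).1 (hu2 k).2

/-- The marginal limit measures are homogeneous. -/
theorem MRV.coord_eq (h : MRV P α b ν) (l : Fin L) {x : ℝ≥0} (hx : 0 < x) :
    ν {w | x ≤ w l} = ν {w | 1 ≤ w l} * (x ^ (-α) : ℝ≥0) := by
  have hα := h.index_pos.ne'
  have e : ∀ x : ℝ≥0, (x ^ α) ^ (1 / α) = x := fun x => by
    rw [← NNReal.rpow_mul, mul_one_div_cancel hα, NNReal.rpow_one]
  -- The inequality is used from level `x` to level `1` and from level `1` to level `x`. Since the
  -- two factors are inverse to each other, equality follows.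
  have h1 := h.le_mul l (c := x ^ (-α)) (NNReal.rpow_pos hx) hx
  have h2 := h.le_mul l (c := x ^ α) (NNReal.rpow_pos hx) one_pos
  rw [e, mul_one] at h2
  rw [NNReal.rpow_neg, ← NNReal.inv_rpow, e, inv_mul_cancel₀ hx.ne'] at h1
  rw [NNReal.rpow_neg, ← NNReal.inv_rpow, mul_comm]
  refine le_antisymm h1 ?_
  calc _ ≤ ((x⁻¹ ^ α : ℝ≥0) : ℝ≥0∞) * ((x ^ α : ℝ≥0) * ν {w | x ≤ w l}) := by gcongr
    _ = _ := by
      rw [← mul_assoc, ← ENNReal.coe_mul, ← NNReal.mul_rpow, inv_mul_cancel₀ hx.ne',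
        NNReal.one_rpow, ENNReal.coe_one, one_mul]

theorem MRV.coord_pos (h : MRV P α b ν) (l : Fin L) (hl : ν {x | 0 < x l} ≠ 0) :
    0 < ν {w | 1 ≤ w l} := by
  rw [pos_iff_ne_zero]
  intro h0
  apply hl
  have hset : {x : Cone L | 0 < x l} ⊆ ⋃ k : ℕ, {w | (1 / (k + 1 : ℝ≥0)) ≤ w l} := by
    intro w hw
    obtain ⟨k, hk⟩ := exists_nat_one_div_lt (K := ℝ≥0) (hw : 0 < w l)
    exact Set.mem_iUnion.2 ⟨k, hk.le⟩
  refine measure_mono_null hset (measure_iUnion_null fun k => ?_)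
  rw [h.coord_eq l (by positivity), h0, zero_mul]

/-- Homogeneity makes `x ↦ ν {w | x ≤ w l}` continuous, which closes the gap in the two portmanteau
bounds. -/
theorem MRV.tendsto_scaledTail (h : MRV P α b ν) (l : Fin L) {x : ℝ≥0} (hx : 0 < x) :
    Tendsto (fun t => scaledTail P b l t x) atTop (𝓝 (ν {w | 1 ≤ w l} * (x ^ (-α) : ℝ≥0))) := by
  have hfin := (h.limit_mem.coord_lt_top l one_pos).ne
  have hc : Tendsto (fun z : ℝ≥0 => ν {w | 1 ≤ w l} * ((z ^ (-α) : ℝ≥0) : ℝ≥0∞)) (𝓝 x)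
      (𝓝 (ν {w | 1 ≤ w l} * (x ^ (-α) : ℝ≥0))) := by
    refine ENNReal.Tendsto.const_mul (ENNReal.tendsto_coe.2 ?_) (Or.inr hfin)
    exact (NNReal.continuousAt_rpow_const (Or.inl hx.ne')).tendsto
  have : (𝓝[<] x).NeBot := nhdsLT_neBot_of_exists_lt ⟨0, hx⟩
  rw [tendsto_order]
  constructor
  · intro e he
    obtain ⟨y, hy, hyx⟩ := (((hc.eventually (lt_mem_nhds he)).filter_mono
      (nhdsWithin_le_nhds (s := Set.Ioi x))).and self_mem_nhdsWithin).exists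
    have hyx : x < y := hyx
    rw [← h.coord_eq l (hx.trans hyx)] at hy
    exact h.eventually_lt_of_lt l hx hyx hy
  · intro e he
    obtain ⟨y, ⟨hy, hy0⟩, hyx⟩ := ((((hc.eventually (gt_mem_nhds he)).and
      (lt_mem_nhds hx)).filter_mono
      (nhdsWithin_le_nhds (s := Set.Iio x))).and self_mem_nhdsWithin).exists
    have hyx : y < x := hyx
    rw [← h.coord_eq l hy0] at hy
    exact h.eventually_le_of_lt l hy0 hyx hy

/-- If `b t < M`, then `t P(W_l > y)` is at most the scaled tail at `y / (M + 1)`, which stays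
bounded. For `y` with `P(W_l > y) > 0` this fails at large `t`. Such a `y` exists because otherwise
the positive limit of the scaled tails would be `0`. -/
theorem MRV.tendsto_scale (h : MRV P α b ν) [IsProbabilityMeasure P] (l : Fin L)
    (hl : ν {x | 0 < x l} ≠ 0) : Tendsto b atTop atTop := by
  have hfin := (h.limit_mem.coord_lt_top l one_pos).ne
  obtain ⟨y, hy, hPy⟩ : ∃ y : ℝ≥0, 0 < y ∧ P {w | y < w l} ≠ 0 := by
    by_contra! hcon
    have h0 : P {w | 0 < w l} = 0 := by
      have hset : {x : Cone L | 0 < x l} ⊆ ⋃ k : ℕ, {w | (1 / (k + 1 : ℝ≥0)) < w l} := by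
        intro w hw
        obtain ⟨k, hk⟩ := exists_nat_one_div_lt (K := ℝ≥0) (hw : 0 < w l)
        exact Set.mem_iUnion.2 ⟨k, hk⟩
      exact measure_mono_null hset (measure_iUnion_null fun k => hcon _ (by positivity))
    have h1 := h.tendsto_scaledTail l one_pos
    have h2 : (fun t => scaledTail P b l t 1) = fun _ => 0 := by
      funext t
      have : P {w | 1 * b t < w l} = 0 :=
        measure_mono_null (fun w (hw : 1 * b t < w l) => (zero_le.trans_lt hw : 0 < w l)) h0
      rw [scaledTail, this, mul_zero]
    rw [h2] at h1
    have h3 := tendsto_nhds_unique h1 tendsto_const_nhds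
    rw [NNReal.one_rpow, ENNReal.coe_one, mul_one] at h3
    exact (h.coord_pos l hl).ne' h3
  rw [tendsto_atTop]
  intro M
  have hM : 0 < M + 1 := by positivity
  have hx : 0 < y / (M + 1) := by positivity
  have hlt : ν {w | 1 ≤ w l} * ((y / (M + 1)) ^ (-α) : ℝ≥0) < ∞ :=
    ENNReal.mul_lt_top hfin.lt_top ENNReal.coe_lt_top
  obtain ⟨e, he1, he2⟩ := exists_between hlt
  have h1 := (h.tendsto_scaledTail l hx).eventually (gt_mem_nhds he1)
  have h2 : ∀ᶠ t : ℝ≥0 in atTop, e / P {w | y < w l} < t := by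
    have hd : e / P {w | y < w l} ≠ ∞ := ENNReal.div_ne_top he2.ne hPy
    lift e / P {w | y < w l} to ℝ≥0 using hd with d
    filter_upwards [eventually_gt_atTop d] with t ht
    exact_mod_cast ht
  filter_upwards [h1, h2] with t t1 t2
  by_contra! hcon
  rw [ENNReal.div_lt_iff (Or.inl hPy) (Or.inl (measure_ne_top _ _))] at t2
  have : scaledTail P b l t (y / (M + 1)) ≥ t * P {w | y < w l} := by
    unfold scaledTail
    have hle : y / (M + 1) * b t ≤ y := by
      calc y / (M + 1) * b t ≤ y / (M + 1) * (M + 1) := by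
            gcongr
            exact hcon.le.trans le_self_add
        _ = y := by field_simp
    gcongr with w
  exact absurd (t2.trans_le (this.trans t1.le)) (lt_irrefl _)

/-- The tail function of the `l`-th marginal. -/
noncomputable def mtail (P : Measure (Cone L)) (l : Fin L) (x : ℝ) : ℝ := P.real {w | x < (w l : ℝ)}

theorem MRV.regTail (h : MRV P α b ν) [IsProbabilityMeasure P] (l : Fin L)
    (hl : ν {x | 0 < x l} ≠ 0) :
    RegTail (mtail P l) (fun n => b n.toNNReal) (ν.real {w | 1 ≤ w l}) α where
  anti x y hxy := measureReal_mono fun w (hw : y < (w l : ℝ)) => hxy.trans_lt hw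
  nonneg x := measureReal_nonneg
  le_one x := measureReal_le_one
  c_pos := ENNReal.toReal_pos (h.coord_pos l hl).ne' (h.limit_mem.coord_lt_top l one_pos).ne
  index_pos := h.index_pos
  scale := NNReal.tendsto_coe_atTop.2 ((h.tendsto_scale l hl).comp Real.tendsto_toNNReal_atTop)
  tail x hx := by
    lift x to ℝ≥0 using hx.le
    have hx' : 0 < x := by exact_mod_cast hx
    have h1 := (h.tendsto_scaledTail l hx').comp Real.tendsto_toNNReal_atTop
    have hfin := (h.limit_mem.coord_lt_top l one_pos).ne
    have h2 := (ENNReal.tendsto_toReal (ENNReal.mul_ne_top hfin ENNReal.coe_ne_top)).comp h1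
    rw [ENNReal.toReal_mul, ENNReal.coe_toReal, NNReal.coe_rpow] at h2
    refine h2.congr' ?_
    filter_upwards [eventually_ge_atTop 0] with n hn
    simp only [Function.comp_apply, scaledTail, ENNReal.toReal_mul, ENNReal.coe_toReal,
      Real.coe_toNNReal n hn, mtail, Measure.real]
    norm_cast

end Marginal
/-! ### Quantiles and the upper tail dependence coefficient -/

section UTD

variable {L : ℕ} {P : Measure (Cone L)} {α : ℝ} {B : ℝ → ℝ} {ι : Type*} {l : Filter ι}

theorem measurable_coord (k : Fin L) : Measurable fun w : Cone L => (w k : ℝ) :=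
  measurable_coe_nnreal_real.comp (measurable_pi_apply k)

theorem measurableSet_lt_coord_real (k : Fin L) (x : ℝ) :
    MeasurableSet {w : Cone L | x < (w k : ℝ)} :=
  measurableSet_lt measurable_const (measurable_coord k)

theorem cdf_marginal [IsProbabilityMeasure P] (k : Fin L) (x : ℝ) :
    cdf (P.map fun w => (w k : ℝ)) x = 1 - mtail P k x := by
  have : IsProbabilityMeasure (P.map fun w : Cone L => (w k : ℝ)) :=
    Measure.isProbabilityMeasure_map (measurable_coord k).aemeasurable
  rw [cdf_eq_real, map_measureReal_apply (measurable_coord k) measurableSet_Iic, mtail,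
    ← probReal_compl_eq_one_sub (measurableSet_lt_coord_real k x)]
  congr 1
  ext w
  simp

/-- This is the form of the quantile required by `RegTail.ratio_of_inversion`. At the quantile
itself the bound uses right continuity of the distribution function. -/
theorem marginalQuantile_spec [IsProbabilityMeasure P] (k : Fin L) {q : ℝ} (h0 : 0 < q)
    (h1 : q < 1) :
    mtail P k (marginalQuantile P k q) ≤ 1 - q ∧
      ∀ z < marginalQuantile P k q, 1 - q ≤ mtail P k z := by
  have : IsProbabilityMeasure (P.map fun w : Cone L => (w k : ℝ)) :=
    Measure.isProbabilityMeasure_map (measurable_coord k).aemeasurable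
  set G := cdf (P.map fun w : Cone L => (w k : ℝ)) with hG
  have hbdd : BddBelow {x | q ≤ G x} := by
    refine ⟨0, fun x hx => ?_⟩
    by_contra! hx0
    have hx : q ≤ G x := hx
    have : G x = 0 := by
      rw [hG, cdf_marginal, mtail]
      have : {w : Cone L | x < (w k : ℝ)} = Set.univ := by
        ext w; simpa using hx0.trans_le (w k).coe_nonneg
      simp [this]
    linarith
  have hne : {x | q ≤ G x}.Nonempty := by
    obtain ⟨x, hx⟩ := ((tendsto_cdf_atTop (P.map fun w : Cone L => (w k : ℝ))).eventually
      (lt_mem_nhds h1)).exists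
    exact ⟨x, hx.le⟩
  constructor
  · have key : q ≤ G (sInf {x | q ≤ G x}) := by
      have hr : Tendsto G (𝓝[>] (sInf {x | q ≤ G x})) (𝓝 (G (sInf {x | q ≤ G x}))) :=
        ((G.right_continuous _).mono Set.Ioi_subset_Ici_self)
      refine ge_of_tendsto hr ?_
      filter_upwards [self_mem_nhdsWithin] with z hz
      obtain ⟨y, hy, hyz⟩ := exists_lt_of_csInf_lt hne hz
      exact le_trans hy (G.mono hyz.le)
    have e := cdf_marginal (P := P) k (sInf {x | q ≤ G x})
    unfold marginalQuantile genInv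
    linarith
  · intro z hz
    have : ¬ q ≤ G z := fun hq => absurd (csInf_le hbdd hq) (not_le.2 hz)
    have e := cdf_marginal (P := P) k z
    linarith

theorem real_between_le [IsProbabilityMeasure P] (k : Fin L) (z z' : ℝ) :
    P.real {w | z < (w k : ℝ) ∧ ¬ z' < (w k : ℝ)} ≤ |mtail P k z - mtail P k z'| := by
  rcases le_total z' z with h | h
  · have : {w : Cone L | z < (w k : ℝ) ∧ ¬ z' < (w k : ℝ)} = ∅ := by
      ext w
      simp only [Set.mem_ofPred_eq, Set.mem_empty_iff_false, iff_false, not_and, not_not]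
      exact fun hw => h.trans_lt hw
    rw [this, measureReal_empty]
    positivity
  · have e : {w : Cone L | z < (w k : ℝ) ∧ ¬ z' < (w k : ℝ)} =
        {w : Cone L | z < (w k : ℝ)} \ {w : Cone L | z' < (w k : ℝ)} := rfl
    have hsub : {w : Cone L | z' < (w k : ℝ)} ⊆ {w : Cone L | z < (w k : ℝ)} :=
      fun w (hw : z' < (w k : ℝ)) => h.trans_lt hw
    rw [e, measureReal_sdiff hsub (measurableSet_lt_coord_real k z')]
    exact le_abs_self _

/-- Changing the thresholds changes the joint tail by at most the change of the marginal tails. -/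
theorem joint_le [IsProbabilityMeasure P] (s m : Fin L) (x x' y y' : ℝ) :
    P.real {w | x < (w s : ℝ) ∧ y < (w m : ℝ)} ≤
      P.real {w | x' < (w s : ℝ) ∧ y' < (w m : ℝ)} +
        (|mtail P s x - mtail P s x'| + |mtail P m y - mtail P m y'|) := by
  have hsub : {w : Cone L | x < (w s : ℝ) ∧ y < (w m : ℝ)} ⊆
      {w | x' < (w s : ℝ) ∧ y' < (w m : ℝ)} ∪
        ({w | x < (w s : ℝ) ∧ ¬ x' < (w s : ℝ)} ∪ {w | y < (w m : ℝ) ∧ ¬ y' < (w m : ℝ)}) := by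
    rintro w ⟨h1, h2⟩
    by_cases h3 : x' < (w s : ℝ)
    · by_cases h4 : y' < (w m : ℝ)
      · exact Or.inl ⟨h3, h4⟩
      · exact Or.inr (Or.inr ⟨h2, h4⟩)
    · exact Or.inr (Or.inl ⟨h1, h3⟩)
  refine (measureReal_mono hsub).trans ((measureReal_union_le _ _).trans ?_)
  gcongr
  exact (measureReal_union_le _ _).trans (add_le_add (real_between_le s x x') (real_between_le m y y'))

/-- The coefficient `lam` is defined along exact quantiles, which are `~ θ B(n)` by inversion. Exact
and approximate thresholds have marginal tails `~ 1/n`, so interchanging them alters the joint tail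
by `o(1/n)`. -/
theorem tendsto_joint_tail [IsProbabilityMeasure P] {s m : Fin L} {cs cm lam : ℝ}
    (hs : RegTail (mtail P s) B cs α) (hm : RegTail (mtail P m) B cm α)
    (hlam : IsUTDCoefficient P s m lam) {n x y : ι → ℝ} (hn : Tendsto n l atTop)
    (hx : Tendsto (fun i => x i / B (n i)) l (𝓝 (RegTail.thr cs α)))
    (hy : Tendsto (fun i => y i / B (n i)) l (𝓝 (RegTail.thr cm α))) :
    Tendsto (fun i => n i * P.real {w | x i < (w s : ℝ) ∧ y i < (w m : ℝ)}) l (𝓝 lam) := by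
  set q : ι → ℝ := fun i => 1 - (n i)⁻¹ with hq
  have hinv : Tendsto (fun i => (n i)⁻¹) l (𝓝 0) := hn.inv_tendsto_atTop
  have hq1 : Tendsto q l (𝓝[<] 1) := by
    refine tendsto_nhdsWithin_of_tendsto_nhds_of_eventually_within _ ?_ ?_
    · simpa using hinv.const_sub 1
    · filter_upwards [hn.eventually_gt_atTop 0] with i hi
      have := inv_pos.2 hi
      change 1 - (n i)⁻¹ < 1
      linarith
  have hn1 := hn.eventually_gt_atTop 1
  have hquant : ∀ {k : Fin L} {c : ℝ} (hk : RegTail (mtail P k) B c α),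
      Tendsto (fun i => marginalQuantile P k (q i) / B (n i)) l (𝓝 (RegTail.thr c α)) := by
    intro k c hk
    have spec : ∀ᶠ i in l, mtail P k (marginalQuantile P k (q i)) ≤ (n i)⁻¹ ∧
        ∀ z < marginalQuantile P k (q i), (n i)⁻¹ ≤ mtail P k z := by
      filter_upwards [hn1] with i hi
      have h1 := inv_lt_one_of_one_lt₀ hi
      have h2 : 0 < (n i)⁻¹ := inv_pos.2 (by linarith)
      have := marginalQuantile_spec (P := P) k (q := q i) (by simp only [hq]; linarith)
        (by simp only [hq]; linarith)
      simpa only [hq, sub_sub_cancel] using this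
    refine hk.ratio_of_inversion hn ?_ ?_
    · filter_upwards [hn1, spec] with i hi h
      rw [← mul_inv_cancel₀ (show n i ≠ 0 by linarith)]
      exact mul_le_mul_of_nonneg_left h.1 (by linarith)
    · filter_upwards [hn1, spec] with i hi h z hz
      rw [← mul_inv_cancel₀ (show n i ≠ 0 by linarith)]
      exact mul_le_mul_of_nonneg_left (h.2 z hz) (by linarith)
  have lim_one : ∀ {k : Fin L} {c : ℝ} (_ : RegTail (mtail P k) B c α) {z : ι → ℝ},
      Tendsto (fun i => z i / B (n i)) l (𝓝 (RegTail.thr c α)) →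
      Tendsto (fun i => n i * mtail P k (z i)) l (𝓝 1) := by
    intro k c hk z hz
    have := hk.tendsto_of_ratio hn hk.thr_pos hz
    have e := hk.limit_mul_thr one_pos
    rw [one_mul, Real.one_rpow] at e
    rwa [e] at this
  set us := fun i => marginalQuantile P s (q i)
  set um := fun i => marginalQuantile P m (q i)
  have hus := lim_one hs (hquant hs)
  have hum := lim_one hm (hquant hm)
  have hxs := lim_one hs hx
  have hym := lim_one hm hy
  -- At exact quantiles the joint tail is the conditional probability times `P(W_s > u_s)`, and `n
  -- P(W_s > u_s) → 1`.
  have J : Tendsto (fun i => n i * P.real {w | us i < (w s : ℝ) ∧ um i < (w m : ℝ)}) l (𝓝 lam) := by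
    have h1 := (hlam.comp hq1).mul hus
    rw [mul_one] at h1
    refine h1.congr fun i => ?_
    have hp := hs.pos (us i)
    simp only [Function.comp_apply, utd]
    rw [Measure.real, cond_apply (measurableSet_lt_coord_real s _), ENNReal.toReal_mul,
      ENNReal.toReal_inv]
    change (mtail P s (us i))⁻¹ * P.real ({w | us i < (w s : ℝ)} ∩ {w | um i < (w m : ℝ)}) *
      (n i * mtail P s (us i)) = n i * P.real ({w | us i < (w s : ℝ)} ∩ {w | um i < (w m : ℝ)})
    field_simp
  have ds : Tendsto (fun i => |n i * mtail P s (x i) - n i * mtail P s (us i)|) l (𝓝 0) := by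
    simpa using (hxs.sub hus).abs
  have dm : Tendsto (fun i => |n i * mtail P m (y i) - n i * mtail P m (um i)|) l (𝓝 0) := by
    simpa using (hym.sub hum).abs
  have hd : Tendsto (fun i => |n i * P.real {w | x i < (w s : ℝ) ∧ y i < (w m : ℝ)} -
      n i * P.real {w | us i < (w s : ℝ) ∧ um i < (w m : ℝ)}|) l (𝓝 0) := by
    have h0 := ds.add dm
    rw [add_zero] at h0
    refine squeeze_zero' (Eventually.of_forall fun _ => abs_nonneg _) ?_ h0
    filter_upwards [hn1] with i hi
    have h1 := joint_le (P := P) s m (x i) (us i) (y i) (um i)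
    have h2 := joint_le (P := P) s m (us i) (x i) (um i) (y i)
    rw [abs_sub_comm (mtail P s _), abs_sub_comm (mtail P m _)] at h2
    rw [← mul_sub, ← mul_sub, ← mul_sub, abs_mul, abs_mul, abs_mul, ← mul_add]
    refine mul_le_mul_of_nonneg_left ?_ (abs_nonneg _)
    rw [abs_le]
    constructor <;> linarith
  have := ((tendsto_zero_iff_abs_tendsto_zero _).2 hd).add J
  simpa using this

end UTD
/-! ### Conditional exponential moments of the degrees -/

section Poisson

theorem lintegral_exp_poissonMeasure (r : ℝ≥0) (θ : ℝ) :
    ∫⁻ n, ENNReal.ofReal (Real.exp (θ * n)) ∂poissonMeasure r =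
      ENNReal.ofReal (Real.exp ((Real.exp θ - 1) * r)) := by
  rw [lintegral_countable']
  have h1 : HasSum (fun n : ℕ => Real.exp (θ * n) * (Real.exp (-r) * r ^ n / n.factorial))
      (Real.exp ((Real.exp θ - 1) * r)) := by
    have h2 := (NormedSpace.expSeries_div_hasSum_exp (r * Real.exp θ)).mul_left (Real.exp (-r))
    rw [← Real.exp_eq_exp_ℝ, ← Real.exp_add] at h2
    have e1 : -(r : ℝ) + r * Real.exp θ = (Real.exp θ - 1) * r := by ring
    rw [e1] at h2
    have e2 : ∀ n : ℕ, Real.exp (-r) * ((r * Real.exp θ) ^ n / n.factorial) =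
        Real.exp (θ * n) * (Real.exp (-r) * r ^ n / n.factorial) := fun n => by
      rw [mul_pow, ← Real.exp_nat_mul, mul_comm θ]
      ring
    simpa only [e2] using h2
  rw [← h1.tsum_eq, ENNReal.ofReal_tsum_of_nonneg (fun n => by positivity) h1.summable]
  refine tsum_congr fun n => ?_
  rw [poissonMeasure_singleton, ← ENNReal.ofReal_mul (by positivity)]

variable {Ω : Type*} [MeasurableSpace Ω] {μ : Measure Ω} {L : ℕ} {g : Fin L → ℝ≥0 → ℝ≥0}
  {W : ℕ → Ω → Cone L} {A : (N : ℕ) → Fin N → Fin N → Fin L → Ω → ℕ}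

/-- The unordered pairs of nodes in each layer, represented by `i ≤ j`. -/
abbrev EdgeSlot (N L : ℕ) : Type := {p : Fin N × Fin N × Fin L // p.1 ≤ p.2.1}

theorem prod_edgeSlot {N L : ℕ} (f : Fin N → Fin N → Fin L → ℝ≥0∞) :
    ∏ i, ∏ j ∈ Finset.Ici i, ∏ l, f i j l = ∏ e : EdgeSlot N L, f e.1.1 e.1.2.1 e.1.2.2 := by
  classical
  have h1 : ∏ e : EdgeSlot N L, f e.1.1 e.1.2.1 e.1.2.2 =
      ∏ p : Fin N × Fin N × Fin L, if p.1 ≤ p.2.1 then f p.1 p.2.1 p.2.2 else 1 := by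
    rw [← Finset.prod_filter]
    exact (Finset.prod_subtype (Finset.univ.filter fun p : Fin N × Fin N × Fin L => p.1 ≤ p.2.1)
      (by simp) (fun p => f p.1 p.2.1 p.2.2)).symm
  rw [h1, Fintype.prod_prod_type]
  refine Finset.prod_congr rfl fun i _ => ?_
  rw [Fintype.prod_prod_type]
  have h2 : (Finset.Ici i) = Finset.univ.filter fun j => i ≤ j := by ext; simp
  rw [h2, Finset.prod_filter]
  refine Finset.prod_congr rfl fun j _ => ?_
  by_cases h : i ≤ j <;> simp [h]

theorem IsMIRG.measurable_edgeRate (hG : IsMIRG μ g W A) (N : ℕ) (i j : Fin N) (l : Fin L) :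
    Measurable (edgeRate g W N i j l) := by
  have hc : ∀ k : ℕ, Measurable fun ω => W k ω l :=
    fun k => (measurable_pi_apply l).comp (hG.measurable_weight k)
  unfold edgeRate totalWeight
  exact (hG.measurable_connection l).comp
    (((hc i).mul (hc j)).div (Finset.measurable_sum _ fun k _ => hc k))

theorem measurable_poissonMeasure_singleton (n : ℕ) :
    Measurable fun r : ℝ≥0 => poissonMeasure r {n} := by
  simp only [poissonMeasure_singleton]
  fun_prop

/-- The product of point masses is the product measure of `{κ}`, so the sum is an integral of a
product of functions of independent coordinates. -/
theorem lintegral_pi_prod {E : Type*} [Fintype E] (r : E → ℝ≥0) (φ : E → ℕ → ℝ≥0∞) :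
    ∑' κ : E → ℕ, (∏ e, φ e (κ e)) * ∏ e, poissonMeasure (r e) {κ e} =
      ∏ e, ∫⁻ n, φ e n ∂poissonMeasure (r e) := by
  have h1 : ∀ κ : E → ℕ, ∏ e, poissonMeasure (r e) {κ e} =
      Measure.pi (fun e => poissonMeasure (r e)) {κ} := fun κ =>
    (Measure.pi_singleton _ _).symm
  simp only [h1]
  rw [← lintegral_countable']
  have hm : ∀ e, Measurable (φ e) := fun e => measurable_of_countable _
  rw [lintegral_prod_eq_prod_lintegral_of_indepFun Finset.univ (fun e (κ : E → ℕ) => φ e (κ e))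
    (iIndepFun_pi fun e => (hm e).aemeasurable) fun e => (hm e).comp (measurable_pi_apply e)]
  refine Finset.prod_congr rfl fun e _ => ?_
  exact (measurePreserving_eval (fun e => poissonMeasure (r e)) e).lintegral_comp (hm e)

/-- Conditional expectations of products of functions of the edge counts. -/
theorem IsMIRG.lintegral_prod (hG : IsMIRG μ g W A) (N : ℕ) {S : Set (Fin N → Cone L)}
    (hS : MeasurableSet S) (φ : EdgeSlot N L → ℕ → ℝ≥0∞) :
    ∫⁻ ω in {ω | (fun i : Fin N => W i ω) ∈ S}, ∏ e, φ e (A N e.1.1 e.1.2.1 e.1.2.2 ω) ∂μ =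
      ∫⁻ ω in {ω | (fun i : Fin N => W i ω) ∈ S},
        ∏ e : EdgeSlot N L, ∫⁻ n, φ e n ∂poissonMeasure (edgeRate g W N e.1.1 e.1.2.1 e.1.2.2 ω) ∂μ := by
  set T := {ω | (fun i : Fin N => W i ω) ∈ S} with hT
  set X : Ω → EdgeSlot N L → ℕ := fun ω e => A N e.1.1 e.1.2.1 e.1.2.2 ω with hX
  have hXm : Measurable X := measurable_pi_lambda _ fun e => hG.measurable_adj N _ _ _
  have hΦ : Measurable fun κ : EdgeSlot N L → ℕ => ∏ e, φ e (κ e) := measurable_of_countable _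
  have h1 : ∫⁻ ω in T, ∏ e, φ e (X ω e) ∂μ =
      ∫⁻ κ, ∏ e, φ e (κ e) ∂((μ.restrict T).map X) := (lintegral_map hΦ hXm).symm
  have h2 : ∀ κ : EdgeSlot N L → ℕ, (μ.restrict T).map X {κ} =
      ∫⁻ ω in T, ∏ e : EdgeSlot N L,
        poissonMeasure (edgeRate g W N e.1.1 e.1.2.1 e.1.2.2 ω) {κ e} ∂μ := by
    intro κ
    rw [Measure.map_apply hXm (measurableSet_singleton κ),
      Measure.restrict_apply (hXm (measurableSet_singleton κ))]
    -- The conditional law ignores entries with `j < i`, so the value `0` there is arbitrary.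
    set k : Fin N → Fin N → Fin L → ℕ := fun i j l => if h : i ≤ j then κ ⟨(i, j, l), h⟩ else 0
      with hk
    have hke : ∀ e : EdgeSlot N L, k e.1.1 e.1.2.1 e.1.2.2 = κ e := fun e => by
      simp only [hk]
      rw [dif_pos e.2]
    have h3 := hG.cond_law N k S hS
    simp only [prod_edgeSlot] at h3
    simp only [hke] at h3
    rw [← h3, Set.inter_comm]
    congr 2
    ext ω
    simp only [Set.mem_preimage, Set.mem_singleton_iff, Set.mem_ofPred_eq, hX, funext_iff]
    constructor
    · intro h i j l hij
      have h4 := h ⟨(i, j, l), hij⟩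
      rwa [← hke] at h4
    · intro h e
      rw [← hke]
      exact h _ _ _ e.2
  have hmeas : ∀ κ : EdgeSlot N L → ℕ, Measurable fun ω => ∏ e : EdgeSlot N L,
      poissonMeasure (edgeRate g W N e.1.1 e.1.2.1 e.1.2.2 ω) {κ e} := fun κ =>
    Finset.measurable_prod _ fun e _ =>
      (measurable_poissonMeasure_singleton _).comp (hG.measurable_edgeRate N _ _ _)
  change ∫⁻ ω in T, ∏ e, φ e (X ω e) ∂μ = _
  rw [h1, lintegral_countable']
  simp only [h2]
  simp only [← lintegral_const_mul _ (hmeas _)]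
  rw [← lintegral_tsum fun κ => ((hmeas κ).const_mul _).aemeasurable]
  exact lintegral_congr fun ω => lintegral_pi_prod _ φ

/-- The conditional mean `Λ_{il}` of the degree of a node given the weights. -/
noncomputable def meanDegree (g : Fin L → ℝ≥0 → ℝ≥0) (W : ℕ → Ω → Cone L) (N : ℕ) (i : Fin N)
    (l : Fin L) (ω : Ω) : ℝ≥0 := ∑ j, edgeRate g W N i j l ω

/-- The slot of the unordered pair `{i, j}` in layer `l`. -/
def slot {N : ℕ} (i : Fin N) (l : Fin L) (j : Fin N) : EdgeSlot N L :=
  ⟨(min i j, max i j, l), min_le_max⟩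

theorem slot_injective {N : ℕ} (i : Fin N) (l : Fin L) : Function.Injective (slot i l) := by
  intro j j' h
  have h1 : min i j = min i j' := congrArg (fun e => e.1.1) h
  have h2 : max i j = max i j' := congrArg (fun e => e.1.2.1) h
  clear h
  grind

theorem edgeRate_slot {Ω : Type*} {W : ℕ → Ω → Cone L} {N : ℕ} (i j : Fin N) (l : Fin L) (ω : Ω) :
    edgeRate g W N (min i j) (max i j) l ω = edgeRate g W N i j l ω := by
  rcases le_total i j with h | h
  · simp [h]
  · simp [h, edgeRate, mul_comm]

theorem IsMIRG.adj_slot (hG : IsMIRG μ g W A) {N : ℕ} (i j : Fin N) (l : Fin L) (ω : Ω) :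
    A N (min i j) (max i j) l ω = A N i j l ω := by
  rcases le_total i j with h | h
  · simp [h]
  · rw [min_eq_right h, max_eq_left h, hG.symm]

/-- Given the weights, degrees have the exponential moments of a Poisson variable. -/
theorem IsMIRG.lintegral_exp_degree (hG : IsMIRG μ g W A) {N : ℕ} (i : Fin N) (l : Fin L)
    {S : Set (Fin N → Cone L)} (hS : MeasurableSet S) (θ : ℝ) :
    ∫⁻ ω in {ω | (fun i : Fin N => W i ω) ∈ S}, ENNReal.ofReal (Real.exp (θ * degree A N i l ω)) ∂μ =
      ∫⁻ ω in {ω | (fun i : Fin N => W i ω) ∈ S},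
        ENNReal.ofReal (Real.exp ((Real.exp θ - 1) * meanDegree g W N i l ω)) ∂μ := by
  classical
  -- The slots `{i, j}`, with `j` ranging over all nodes and `j = i` included, are distinct. Hence
  -- the degree is a sum of conditionally independent edge counts, although `A` is symmetric.
  have prod_slot : ∀ f : EdgeSlot N L → ℝ≥0∞,
      ∏ e, (if e ∈ Finset.univ.image (slot i l) then f e else 1) = ∏ j, f (slot i l j) := by
    intro f
    rw [Finset.prod_ite_mem, Finset.univ_inter, Finset.prod_image]
    exact fun j _ j' _ h => slot_injective i l h
  have key := hG.lintegral_prod N hS (fun e n =>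
    if e ∈ Finset.univ.image (slot i l) then ENNReal.ofReal (Real.exp (θ * n)) else 1)
  have e1 : ∀ ω, ENNReal.ofReal (Real.exp (θ * degree A N i l ω)) =
      ∏ e : EdgeSlot N L, if e ∈ Finset.univ.image (slot i l) then
        ENNReal.ofReal (Real.exp (θ * A N e.1.1 e.1.2.1 e.1.2.2 ω)) else 1 := by
    intro ω
    rw [prod_slot (fun e => ENNReal.ofReal (Real.exp (θ * A N e.1.1 e.1.2.1 e.1.2.2 ω))),
      ← ENNReal.ofReal_prod_of_nonneg (fun _ _ => (Real.exp_pos _).le), ← Real.exp_sum,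
      ← Finset.mul_sum, degree]
    simp only [slot, hG.adj_slot, Nat.cast_sum]
  have e2 : ∀ ω, ENNReal.ofReal (Real.exp ((Real.exp θ - 1) * meanDegree g W N i l ω)) =
      ∏ e : EdgeSlot N L, ∫⁻ n, (if e ∈ Finset.univ.image (slot i l) then
        ENNReal.ofReal (Real.exp (θ * n)) else 1)
          ∂poissonMeasure (edgeRate g W N e.1.1 e.1.2.1 e.1.2.2 ω) := by
    intro ω
    have : ∀ e : EdgeSlot N L, ∫⁻ n, (if e ∈ Finset.univ.image (slot i l) then
        ENNReal.ofReal (Real.exp (θ * n)) else 1)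
          ∂poissonMeasure (edgeRate g W N e.1.1 e.1.2.1 e.1.2.2 ω) =
        if e ∈ Finset.univ.image (slot i l) then ENNReal.ofReal
          (Real.exp ((Real.exp θ - 1) * edgeRate g W N e.1.1 e.1.2.1 e.1.2.2 ω)) else 1 := by
      intro e
      split_ifs with h
      · exact lintegral_exp_poissonMeasure _ _
      · simp
    simp only [this]
    rw [prod_slot (fun e => ENNReal.ofReal
          (Real.exp ((Real.exp θ - 1) * edgeRate g W N e.1.1 e.1.2.1 e.1.2.2 ω))),
      ← ENNReal.ofReal_prod_of_nonneg (fun _ _ => (Real.exp_pos _).le), ← Real.exp_sum,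
      ← Finset.mul_sum, meanDegree]
    simp only [slot, edgeRate_slot, NNReal.coe_sum]
  simp only [e1, e2]
  exact key

/-- The conditional mean degree as a function of the weights. -/
theorem meanDegree_preimage {Ω : Type*} {W : ℕ → Ω → Cone L} {N : ℕ} (hgm : ∀ l, Measurable (g l)) (i : Fin N) (l : Fin L)
    {I : Set ℝ} (hI : MeasurableSet I) :
    ∃ S : Set (Fin N → Cone L), MeasurableSet S ∧ ∀ ω : Ω,
      (fun i : Fin N => W i ω) ∈ S ↔ (meanDegree g W N i l ω : ℝ) ∈ I := by
  set f : (Fin N → Cone L) → ℝ := fun w => ((∑ j, g l (w i l * w j l / ∑ k, w k l) : ℝ≥0) : ℝ)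
  have hc : ∀ k : Fin N, Measurable fun w : Fin N → Cone L => w k l :=
    fun k => (measurable_pi_apply l).comp (measurable_pi_apply k)
  have hf : Measurable f := measurable_coe_nnreal_real.comp <|
    Finset.measurable_sum _ fun j _ => (hgm l).comp
      (((hc i).mul (hc j)).div (Finset.measurable_sum _ fun k _ => hc k))
  exact ⟨f ⁻¹' I, hf hI, fun ω => Iff.rfl⟩

/-- Chernoff bound for the degrees given the weights. -/
theorem IsMIRG.chernoff [IsProbabilityMeasure μ] (hG : IsMIRG μ g W A) {N : ℕ} (i : Fin N)
    (l : Fin L) {ρ y : ℝ} (hρ : 0 < ρ) {I : Set ℝ} (hI : MeasurableSet I) {J : Set ℝ}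
    (hIρ : ∀ x ∈ I, (ρ⁻¹ - 1) * x ≤ (1 - ρ) * y)
    (hJ : ∀ d ∈ J, Real.log ρ * d ≤ Real.log ρ * y) :
    μ {ω | (meanDegree g W N i l ω : ℝ) ∈ I ∧ (degree A N i l ω : ℝ) ∈ J} ≤
      ENNReal.ofReal (Real.exp (-(ρ - 1 - Real.log ρ) * y)) := by
  obtain ⟨S, hS, hSI⟩ := meanDegree_preimage (W := W) hG.measurable_connection i l hI
  -- The parameter `θ = -log ρ` gives `exp θ - 1 = ρ⁻¹ - 1`. At `Λ = ρ y` this is the optimal choice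
  -- for the threshold `y`, with rate `ρ - 1 - log ρ`. Taking `ρ < 1` gives the upper tail and `ρ >
  -- 1` the lower one, so one statement covers both.
  have key := hG.lintegral_exp_degree i l hS (-Real.log ρ)
  set T := {ω | (fun i : Fin N => W i ω) ∈ S} with hT
  have hTm : MeasurableSet T := hS.preimage (measurable_pi_lambda _ fun k => hG.measurable_weight k)
  have hDm : Measurable (degree A N i l) := Finset.measurable_sum _ fun j _ => hG.measurable_adj N i j l
  rw [Real.exp_neg, Real.exp_log hρ] at key
  set E := {ω | (meanDegree g W N i l ω : ℝ) ∈ I ∧ (degree A N i l ω : ℝ) ∈ J} with hE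
  have hup : ∫⁻ ω in T, ENNReal.ofReal (Real.exp ((ρ⁻¹ - 1) * meanDegree g W N i l ω)) ∂μ ≤
      ENNReal.ofReal (Real.exp ((1 - ρ) * y)) := by
    calc _ ≤ ∫⁻ ω in T, ENNReal.ofReal (Real.exp ((1 - ρ) * y)) ∂μ :=
          setLIntegral_mono measurable_const fun ω hω =>
            ENNReal.ofReal_le_ofReal (Real.exp_le_exp.2 (hIρ _ ((hSI ω).1 hω)))
      _ = ENNReal.ofReal (Real.exp ((1 - ρ) * y)) * μ T := by simp
      _ ≤ _ := mul_le_of_le_one_right zero_le prob_le_one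
  set c : ℝ≥0∞ := ENNReal.ofReal (Real.exp (-Real.log ρ * y)) with hc
  have hlow : c * μ E ≤ ∫⁻ ω in T, ENNReal.ofReal (Real.exp (-Real.log ρ * degree A N i l ω)) ∂μ := by
    refine le_trans (mul_le_mul_right ?_ c) (mul_meas_ge_le_lintegral₀ (μ := μ.restrict T) ?_ c)
    · refine le_trans ?_ (Measure.le_restrict_apply _ _)
      refine measure_mono fun ω hω => ⟨?_, (hSI ω).2 hω.1⟩
      refine ENNReal.ofReal_le_ofReal (Real.exp_le_exp.2 ?_)
      have := hJ _ hω.2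
      linarith
    · refine Measurable.aemeasurable ?_
      exact ENNReal.measurable_ofReal.comp (Real.measurable_exp.comp
        (measurable_const.mul ((measurable_of_countable (fun n : ℕ => (n : ℝ))).comp hDm)))
  have h1 : c * μ E ≤ ENNReal.ofReal (Real.exp ((1 - ρ) * y)) := (hlow.trans key.le).trans hup
  have hc0 : c ≠ 0 := by simp [hc, Real.exp_pos]
  have e : (1 - ρ) * y = -Real.log ρ * y + -(ρ - 1 - Real.log ρ) * y := by ring
  rw [e, Real.exp_add, ENNReal.ofReal_mul (Real.exp_pos _).le] at h1
  exact (ENNReal.mul_le_mul_iff_right hc0 ENNReal.ofReal_ne_top).1 h1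

end Poisson
/-! ### Events holding with high probability -/

section Whp

variable {Ω : Type*} [MeasurableSpace Ω]

/-- The events `{ω | p N ω}` have probability tending to one. -/
def Whp (μ : Measure Ω) (p : ℕ → Ω → Prop) : Prop :=
  Tendsto (fun N => μ.real {ω | ¬ p N ω}) atTop (𝓝 0)

variable {μ : Measure Ω} {p q : ℕ → Ω → Prop}

/-- Convenient when auxiliary constants, such as those in a tightness bound, must be chosen
depending on `η`. -/
theorem whp_of_forall_le (h : ∀ η : ℝ, 0 < η → ∀ᶠ N in atTop, μ.real {ω | ¬ p N ω} ≤ η) :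
    Whp μ p := by
  refine tendsto_order.2 ⟨fun e he => Eventually.of_forall fun N => he.trans_le measureReal_nonneg,
    fun e he => ?_⟩
  filter_upwards [h (e / 2) (half_pos he)] with N hN
  linarith

theorem Whp.and_mono [IsProbabilityMeasure μ] {r : ℕ → Ω → Prop} (hp : Whp μ p) (hq : Whp μ q)
    (h : ∀ᶠ N in atTop, ∀ ω, p N ω → q N ω → r N ω) : Whp μ r := by
  have h1 := Tendsto.add hp hq
  rw [add_zero] at h1
  refine squeeze_zero' (Eventually.of_forall fun N => measureReal_nonneg) ?_ h1
  filter_upwards [h] with N hN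
  refine le_trans (measureReal_mono fun ω hω => ?_) (measureReal_union_le _ _)
  by_contra hcon
  simp only [Set.mem_union, Set.mem_ofPred_eq, not_or, not_not] at hcon hω
  exact hω (hN ω hcon.1 hcon.2)

theorem Whp.mono [IsProbabilityMeasure μ] (hp : Whp μ p) (h : ∀ᶠ N in atTop, ∀ ω, p N ω → q N ω) : Whp μ q :=
  hp.and_mono hp (h.mono fun _ hN ω h1 _ => hN ω h1)

theorem Whp.and [IsProbabilityMeasure μ] (hp : Whp μ p) (hq : Whp μ q) : Whp μ fun N ω => p N ω ∧ q N ω :=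
  hp.and_mono hq (Eventually.of_forall fun _ _ h1 h2 => ⟨h1, h2⟩)

theorem whp_of_le {u : ℕ → ℝ} (hu : Tendsto u atTop (𝓝 0))
    (h : ∀ᶠ N in atTop, μ.real {ω | ¬ p N ω} ≤ u N) : Whp μ p :=
  squeeze_zero' (Eventually.of_forall fun _ => measureReal_nonneg) h hu

end Whp

/-! ### Moment inequalities for sums over i.i.d. weights -/

section IID

variable {Ω : Type*} [MeasurableSpace Ω] {μ : Measure Ω} {L : ℕ}
  {g : Fin L → ℝ≥0 → ℝ≥0} {W : ℕ → Ω → Cone L} {A : (N : ℕ) → Fin N → Fin N → Fin L → Ω → ℕ}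

theorem IsMIRG.isProbabilityMeasure_map [IsProbabilityMeasure μ] (hG : IsMIRG μ g W A) :
    IsProbabilityMeasure (μ.map (W 0)) :=
  Measure.isProbabilityMeasure_map (hG.measurable_weight 0).aemeasurable

theorem IsMIRG.integral_weight (hG : IsMIRG μ g W A) {f : Cone L → ℝ} (hf : Measurable f) (i : ℕ) :
    ∫ ω, f (W i ω) ∂μ = ∫ w, f w ∂(μ.map (W 0)) := by
  have h1 := ((hG.identDistrib i).comp hf).integral_eq
  rw [integral_map (hG.measurable_weight 0).aemeasurable hf.aestronglyMeasurable]
  exact h1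

theorem IsMIRG.integrable_weight (hG : IsMIRG μ g W A) {f : Cone L → ℝ} (hf : Measurable f)
    (hi : Integrable f (μ.map (W 0))) (i : ℕ) : Integrable (fun ω => f (W i ω)) μ := by
  have h1 := ((hG.identDistrib i).comp hf).integrable_iff
  refine h1.2 ?_
  exact (integrable_map_measure hf.aestronglyMeasurable (hG.measurable_weight 0).aemeasurable).1 hi

theorem IsMIRG.markov [IsProbabilityMeasure μ] (hG : IsMIRG μ g W A) {f : Cone L → ℝ} (hf : Measurable f)
    (hi : Integrable f (μ.map (W 0))) (h0 : ∀ w, 0 ≤ f w) (N : ℕ) {δ : ℝ} (hδ : 0 < δ) :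
    μ.real {ω | δ ≤ ∑ i : Fin N, f (W i ω)} ≤ N * (∫ w, f w ∂(μ.map (W 0))) / δ := by
  have h1 := mul_meas_ge_le_integral_of_nonneg (μ := μ) (f := fun ω => ∑ i : Fin N, f (W i ω))
    (Eventually.of_forall fun ω => Finset.sum_nonneg fun i _ => h0 _)
    (integrable_finsetSum _ fun i _ => hG.integrable_weight hf hi i) δ
  rw [integral_finsetSum _ fun (i : Fin N) _ => hG.integrable_weight hf hi i] at h1
  simp only [hG.integral_weight hf, Finset.sum_const, Finset.card_univ, Fintype.card_fin,
    nsmul_eq_mul] at h1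
  rw [le_div_iff₀ hδ, mul_comm]
  exact h1

theorem integrable_of_bounded {P : Measure (Cone L)} [IsProbabilityMeasure P] {f : Cone L → ℝ}
    (hf : Measurable f) {M : ℝ} (h0 : ∀ w, 0 ≤ f w) (hM : ∀ w, f w ≤ M) : Integrable f P :=
  Integrable.of_bound hf.aestronglyMeasurable M
    (Eventually.of_forall fun w => by rw [Real.norm_eq_abs, abs_of_nonneg (h0 w)]; exact hM w)

/-- Since `0 ≤ f ≤ M`, one has `Var f ≤ E f² ≤ M E f`. This first moment bound is what makes the
estimate sharp enough for rare sets and for truncated weights. -/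
theorem IsMIRG.chebyshev [IsProbabilityMeasure μ] (hG : IsMIRG μ g W A) {f : Cone L → ℝ} (hf : Measurable f) {M : ℝ}
    (h0 : ∀ w, 0 ≤ f w) (hM : ∀ w, f w ≤ M) (N : ℕ) {δ : ℝ} (hδ : 0 < δ) :
    μ.real {ω | δ ≤ |∑ i : Fin N, f (W i ω) - N * ∫ w, f w ∂(μ.map (W 0))|} ≤
      N * M * (∫ w, f w ∂(μ.map (W 0))) / δ ^ 2 := by
  have := hG.isProbabilityMeasure_map
  have hi := integrable_of_bounded (P := μ.map (W 0)) hf h0 hM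
  set e := ∫ w, f w ∂(μ.map (W 0)) with he
  have hmem : ∀ i : Fin N, MemLp (fun ω => f (W i ω)) 2 μ := fun i =>
    MemLp.of_bound (hf.comp (hG.measurable_weight i)).aestronglyMeasurable M
      (Eventually.of_forall fun ω => by rw [Real.norm_eq_abs, abs_of_nonneg (h0 _)]; exact hM _)
  have hvar : ∀ i : Fin N, variance (fun ω => f (W i ω)) μ ≤ M * e := by
    intro i
    refine (variance_le_expectation_sq (hf.comp (hG.measurable_weight i)).aestronglyMeasurable).trans ?_
    rw [he, ← hG.integral_weight hf i, ← integral_const_mul]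
    refine integral_mono ((hmem i).integrable_sq) ((hG.integrable_weight hf hi i).const_mul M)
      fun ω => ?_
    simp only [Pi.pow_apply, sq]
    exact mul_le_mul_of_nonneg_right (hM _) (h0 _)
  have hsum := IndepFun.variance_sum (μ := μ) (X := fun (i : Fin N) ω => f (W i ω))
    (s := Finset.univ) (fun i _ => hmem i) (fun i _ j _ hij =>
      (hG.indep.indepFun (fun h => hij (Fin.ext h))).comp hf hf)
  have hmemS : MemLp (∑ i : Fin N, fun ω => f (W i ω)) 2 μ := memLp_finsetSum' _ fun i _ => hmem i
  have h1 := meas_ge_le_variance_div_sq hmemS hδ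
  have hE : μ[∑ i : Fin N, fun ω => f (W i ω)] = N * e := by
    simp only [Finset.sum_apply]
    rw [integral_finsetSum _ fun (i : Fin N) _ => hG.integrable_weight hf hi i]
    simp [hG.integral_weight hf, he]
  rw [hE] at h1
  simp only [Finset.sum_apply] at h1
  have h2 : variance (∑ i : Fin N, fun ω => f (W i ω)) μ ≤ N * M * e := by
    rw [hsum]
    refine (Finset.sum_le_sum fun i _ => hvar i).trans ?_
    simp [mul_assoc]
  refine (ENNReal.toReal_mono ENNReal.ofReal_ne_top h1).trans ?_
  rw [ENNReal.toReal_ofReal (div_nonneg (variance_nonneg _ _) (by positivity))]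
  gcongr

/-- Weak law for the number of weight vectors in a sequence of rare sets. -/
theorem IsMIRG.whp_count [IsProbabilityMeasure μ] (hG : IsMIRG μ g W A) {t : ℕ → ℕ} (ht : IsIntermediate t)
    {S : ℕ → Set (Cone L)} (hS : ∀ N, MeasurableSet (S N)) {v : ℝ}
    (hv : Tendsto (fun N : ℕ => (N : ℝ) / t N * (μ.map (W 0)).real (S N)) atTop (𝓝 v)) {ε : ℝ}
    (hε : 0 < ε) :
    Whp μ fun N ω => |∑ i : Fin N, (S N).indicator (1 : Cone L → ℝ) (W i ω) - v * t N| ≤ ε * t N := by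
  have := hG.isProbabilityMeasure_map
  have ht' : Tendsto (fun N => (t N : ℝ)) atTop atTop :=
    tendsto_natCast_atTop_atTop.comp ht.tendsto_atTop
  have h0 : ∀ N w, 0 ≤ (S N).indicator (1 : Cone L → ℝ) w := fun N w =>
    Set.indicator_nonneg (fun _ _ => zero_le_one) w
  have h1 : ∀ N w, (S N).indicator (1 : Cone L → ℝ) w ≤ 1 := fun N w =>
    Set.indicator_le' (fun _ _ => le_rfl) (fun _ _ => zero_le_one) w
  have hm : ∀ N, Measurable ((S N).indicator (1 : Cone L → ℝ)) := fun N =>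
    measurable_one.indicator (hS N)
  have hu : Tendsto (fun N : ℕ => (N : ℝ) / t N * (μ.map (W 0)).real (S N) / (ε / 2) ^ 2 / t N) atTop
      (𝓝 0) := (hv.div_const _).div_atTop ht'
  refine whp_of_le hu ?_
  filter_upwards [ht'.eventually_gt_atTop 0, hv.eventually (Metric.ball_mem_nhds v (half_pos hε))]
    with N hN hNv
  have hc := hG.chebyshev (hm N) (h0 N) (h1 N) N (mul_pos (half_pos hε) hN)
  rw [integral_indicator_one (hS N)] at hc
  set p := (μ.map (W 0)).real (S N)
  have e1 : (N : ℝ) * 1 * p / (ε / 2 * t N) ^ 2 = (N : ℝ) / t N * p / (ε / 2) ^ 2 / t N := by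
    field_simp
  rw [e1] at hc
  refine le_trans (measureReal_mono fun ω hω => ?_) hc
  have hω : ¬ _ := hω
  rw [not_le] at hω
  rw [Real.dist_eq] at hNv
  have h5 : |N * p - v * t N| ≤ ε / 2 * t N := by
    have e2 : N * p - v * t N = (N / t N * p - v) * t N := by field_simp
    rw [e2, abs_mul, abs_of_pos hN]
    gcongr
  have h6 := abs_sub_le (∑ i : Fin N, (S N).indicator (1 : Cone L → ℝ) (W i ω)) (N * p) (v * t N)
  change ε / 2 * t N ≤ |_|
  linarith

/-! ### The total weight -/

variable {l : Fin L} {B : ℝ → ℝ} {c α : ℝ}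

theorem integral_min_coord {P : Measure (Cone L)} [IsProbabilityMeasure P] {y : ℝ} (hy : 0 ≤ y) :
    ∫ w, min (w l : ℝ) y ∂P = RegTail.tmean (mtail P l) y := by
  have hm : Measurable fun w : Cone L => min (w l : ℝ) y := (measurable_coord l).min measurable_const
  have h0 : ∀ w : Cone L, 0 ≤ min (w l : ℝ) y := fun w => le_min (w l).coe_nonneg hy
  rw [(integrable_of_bounded hm h0 fun w => min_le_right _ _).integral_eq_integral_meas_lt
    (Eventually.of_forall h0)]
  have e : ∀ u : ℝ, P.real {w | u < min (w l : ℝ) y} = (Set.Iio y).indicator (mtail P l) u := by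
    intro u
    by_cases hu : u < y
    · rw [Set.indicator_of_mem (show u ∈ Set.Iio y from hu), mtail]
      congr 1
      ext w
      simp [hu]
    · rw [Set.indicator_of_notMem (show u ∉ Set.Iio y from hu)]
      have : {w : Cone L | u < min (w l : ℝ) y} = ∅ := by
        ext w
        simp [hu]
      rw [this, measureReal_empty]
  simp only [e]
  rw [setIntegral_indicator measurableSet_Iio, Set.Ioi_inter_Iio, ← integral_Ioc_eq_integral_Ioo,
    RegTail.tmean, intervalIntegral.integral_of_le hy]

/-- The scale `τ_N` of the total weight, the solution of `N E[W ∧ τ] = τ`. -/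
theorem RegTail.exists_tau {F : ℝ → ℝ} (h : RegTail F B c α) :
    ∃ τ : ℕ → ℝ, ∀ᶠ N : ℕ in atTop, 1 ≤ τ N ∧ N * tmean F (τ N) = τ N := by
  have hex : ∀ᶠ N : ℕ in atTop, ∃ τ : ℝ, 1 ≤ τ ∧ N * tmean F τ = τ := by
    have hm := h.tmean_pos one_pos
    have h1 : ∀ᶠ N : ℕ in atTop, 1 / tmean F 1 < (N : ℝ) :=
      tendsto_natCast_atTop_atTop.eventually_gt_atTop _
    filter_upwards [h1, eventually_gt_atTop 0] with N hN hN0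
    have hN0' : (0 : ℝ) < N := by exact_mod_cast hN0
    rw [div_lt_iff₀ hm] at hN
    obtain ⟨y, hy, hy1⟩ := ((h.tmean_div_tendsto_zero.eventually
      (gt_mem_nhds (one_div_pos.2 hN0'))).and (eventually_ge_atTop 1)).exists
    have hy0 : 0 < y := by linarith
    rw [div_lt_div_iff₀ hy0 hN0'] at hy
    -- The difference `N E[W ∧ x] - x` is positive at `x = 1` for large `N`, and negative at some
    -- large `x` because the truncated mean is sublinear.
    have hcont : ContinuousOn (fun x => N * tmean F x - x) (Set.Icc 1 y) :=
      ((h.tmean_continuous.const_mul _).sub continuous_id).continuousOn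
    obtain ⟨τ, hτ, hτ0⟩ := intermediate_value_Icc' hy1 hcont
      (show (0 : ℝ) ∈ Set.Icc (N * tmean F y - y) (N * tmean F 1 - 1) from
        ⟨by linarith, by linarith⟩)
    exact ⟨τ, hτ.1, by simpa [sub_eq_zero] using hτ0⟩
  classical
  refine ⟨fun N => if h : ∃ τ : ℝ, 1 ≤ τ ∧ N * tmean F τ = τ then h.choose else 0, ?_⟩
  filter_upwards [hex] with N hN
  rw [dif_pos hN]
  exact hN.choose_spec

theorem RegTail.tau_ge {F : ℝ → ℝ} (h : RegTail F B c α) {τ : ℕ → ℝ}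
    (hτ : ∀ᶠ N : ℕ in atTop, 1 ≤ τ N ∧ N * tmean F (τ N) = τ N) :
    ∀ᶠ N : ℕ in atTop, N * tmean F 1 ≤ τ N := by
  filter_upwards [hτ] with N hN
  calc N * tmean F 1 ≤ N * tmean F (τ N) := by gcongr; exact h.tmean_mono hN.1
    _ = τ N := hN.2

theorem RegTail.tau_tendsto {F : ℝ → ℝ} (h : RegTail F B c α) {τ : ℕ → ℝ}
    (hτ : ∀ᶠ N : ℕ in atTop, 1 ≤ τ N ∧ N * tmean F (τ N) = τ N) : Tendsto τ atTop atTop :=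
  tendsto_atTop_mono' _ (h.tau_ge hτ)
    (tendsto_natCast_atTop_atTop.atTop_mul_const (h.tmean_pos one_pos))

/-- The total weight is tight on the scale `τ_N`, from above and from below. -/
theorem IsMIRG.totalWeight_tight [IsProbabilityMeasure μ] (hG : IsMIRG μ g W A) (h : RegTail (mtail (μ.map (W 0)) l) B c α)
    {τ : ℕ → ℝ}
    (hτ : ∀ᶠ N : ℕ in atTop, 1 ≤ τ N ∧ N * RegTail.tmean (mtail (μ.map (W 0)) l) (τ N) = τ N)
    {η : ℝ} (hη : 0 < η) :
    ∃ K : ℝ, 0 < K ∧ ∀ᶠ N in atTop,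
      μ.real {ω | ¬ (τ N ≤ K * totalWeight W N l ω ∧ totalWeight W N l ω ≤ K * τ N)} ≤ η := by
  have := hG.isProbabilityMeasure_map
  set F := mtail (μ.map (W 0)) l with hF
  obtain ⟨r, Y, hr1, hr2, hY, hd⟩ := h.tmean_doubling
  have hr0 : 0 < r := by linarith
  -- The upper tail costs `(r/2)^k` and the lower tail `4 (r/2)^k`. Both are small only because `r <
  -- 2`.
  have hlim : Tendsto (fun k : ℕ => 5 * (r / 2) ^ k) atTop (𝓝 (5 * 0)) :=
    (tendsto_pow_atTop_nhds_zero_of_lt_one (by positivity) (by linarith)).const_mul 5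
  rw [mul_zero] at hlim
  obtain ⟨k, hk⟩ := (hlim.eventually (gt_mem_nhds hη)).exists
  have h2k : (0 : ℝ) < 2 ^ k := by positivity
  refine ⟨2 * 2 ^ k, by positivity, ?_⟩
  filter_upwards [hτ, (h.tau_tendsto hτ).eventually_ge_atTop (2 ^ k * Y)] with N hN hNY
  set T := τ N with hT
  have hT0 : 0 < T := by linarith [hN.1]
  have hN0 : (0 : ℝ) < N := by
    rcases (Nat.cast_nonneg N : (0 : ℝ) ≤ N).eq_or_lt with h0 | h0
    · rw [← h0, zero_mul] at hN
      linarith [hN.2]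
    · exact h0
  have hmeas : ∀ y : ℝ, Measurable fun w : Cone L => min (w l : ℝ) y := fun y =>
    (measurable_coord l).min measurable_const
  have hnn : ∀ y : ℝ, 0 ≤ y → ∀ w : Cone L, 0 ≤ min (w l : ℝ) y := fun y hy w =>
    le_min (w l).coe_nonneg hy
  have hTW : ∀ ω, (totalWeight W N l ω : ℝ) = ∑ i : Fin N, (W i ω l : ℝ) := fun ω => by
    simp [totalWeight]
  have hVT : ∀ y ω, ∑ i : Fin N, min (W i ω l : ℝ) y ≤ totalWeight W N l ω := fun y ω => by
    rw [hTW]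
    exact Finset.sum_le_sum fun i _ => min_le_left _ _
  -- upper bound
  have hup : μ.real {ω | 2 ^ k * T ≤ totalWeight W N l ω} ≤ (r / 2) ^ k := by
    have h1 := hG.markov (hmeas (2 ^ k * T)) (integrable_of_bounded (hmeas _)
      (hnn _ (by positivity)) fun w => min_le_right _ _) (hnn _ (by positivity)) N
      (δ := 2 ^ k * T) (by positivity)
    rw [integral_min_coord (by positivity)] at h1
    refine (measureReal_mono fun ω hω => ?_).trans (h1.trans ?_)
    · have hω : 2 ^ k * T ≤ (totalWeight W N l ω : ℝ) := hω
      change 2 ^ k * T ≤ ∑ i : Fin N, min (W i ω l : ℝ) (2 ^ k * T)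
      -- If the total reaches the truncation level, so does the truncated sum: either one summand is
      -- already at that level, or truncation changes nothing.
      by_cases hex : ∃ i : Fin N, 2 ^ k * T ≤ (W i ω l : ℝ)
      · obtain ⟨i, hi⟩ := hex
        calc 2 ^ k * T = min (W i ω l : ℝ) (2 ^ k * T) := (min_eq_right hi).symm
          _ ≤ _ := Finset.single_le_sum (f := fun i : Fin N => min (W i ω l : ℝ) (2 ^ k * T))
            (fun j _ => hnn _ (by positivity) (W j ω)) (Finset.mem_univ i)
      · push Not at hex
        rw [hTW] at hω
        refine hω.trans (le_of_eq (Finset.sum_congr rfl fun i _ => ?_))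
        exact (min_eq_left (hex i).le).symm
    · rw [div_le_iff₀ (by positivity)]
      have h3 := RegTail.tmean_pow_doubling hr0.le hY hd k (y := T)
        (le_trans (by nlinarith [one_le_pow₀ (n := k) (one_le_two (α := ℝ))]) hNY)
      calc N * RegTail.tmean F (2 ^ k * T) ≤ N * (r ^ k * RegTail.tmean F T) := by gcongr
        _ = r ^ k * (N * RegTail.tmean F T) := by ring
        _ = r ^ k * T := by rw [hN.2]
        _ = (r / 2) ^ k * (2 ^ k * T) := by rw [div_pow]; field_simp
  -- lower bound
  set z := T / 2 ^ k with hz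
  have hz0 : 0 < z := by positivity
  have hzY : Y ≤ z := by rw [hz, le_div_iff₀ h2k]; linarith
  set e := N * RegTail.tmean F z with he
  have he1 : T ≤ r ^ k * e := by
    have h3 := RegTail.tmean_pow_doubling hr0.le hY hd k hzY
    have h4 : 2 ^ k * z = T := by rw [hz]; field_simp
    rw [h4] at h3
    calc T = N * RegTail.tmean F T := hN.2.symm
      _ ≤ N * (r ^ k * RegTail.tmean F z) := by gcongr
      _ = _ := by rw [he]; ring
  have he0 : 0 < e := pos_of_mul_pos_right (hT0.trans_le he1) (by positivity)
  -- Truncation at `z = T / 2^k` keeps the mean `e ≥ T / r^k` and reduces the variance to at most `z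
  -- e`. Chebyshev at distance `e / 2` therefore costs `4 z / e ≤ 4 (r/2)^k`.
  have hlow : μ.real {ω | e / 2 ≤ |∑ i : Fin N, min (W i ω l : ℝ) z - e|} ≤ 4 * (r / 2) ^ k := by
    have h1 := hG.chebyshev (hmeas z) (hnn z hz0.le) (fun w => min_le_right _ _) N (half_pos he0)
    rw [integral_min_coord hz0.le] at h1
    refine h1.trans ?_
    rw [div_le_iff₀ (by positivity)]
    calc N * z * RegTail.tmean F z = z * e := by rw [he]; ring
      _ = T / 2 ^ k * e := by rw [hz]
      _ ≤ (r ^ k * e) / 2 ^ k * e := by gcongr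
      _ = _ := by rw [div_pow]; ring
  have hsub : {ω | ¬ (τ N ≤ 2 * 2 ^ k * totalWeight W N l ω ∧
      totalWeight W N l ω ≤ 2 * 2 ^ k * τ N)} ⊆
      {ω | 2 ^ k * T ≤ totalWeight W N l ω} ∪
        {ω | e / 2 ≤ |∑ i : Fin N, min (W i ω l : ℝ) z - e|} := by
    intro ω hω
    by_contra hcon
    simp only [Set.mem_union, Set.mem_ofPred_eq, not_or, not_le] at hcon
    refine hω ⟨?_, ?_⟩
    · have h1 := (abs_lt.1 hcon.2).1
      have h2 := hVT z ω
      have h3 : r ^ k ≤ 2 ^ k := by gcongr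
      calc τ N ≤ r ^ k * e := he1
        _ ≤ 2 ^ k * e := by gcongr
        _ ≤ 2 ^ k * (2 * totalWeight W N l ω) := by gcongr; linarith
        _ = _ := by ring
    · nlinarith [hcon.1]
  calc _ ≤ (r / 2) ^ k + 4 * (r / 2) ^ k :=
        (measureReal_mono hsub).trans ((measureReal_union_le _ _).trans (add_le_add hup hlow))
    _ ≤ η := by linarith

end IID
/-! ### Conditional mean degrees -/

theorem abs_sub_le_of_ratio {g : ℝ≥0 → ℝ≥0} {z : ℝ≥0} {δ : ℝ} (hz : 0 < z)
    (h : dist (g z / z) 1 < δ) : |(g z : ℝ) - z| ≤ δ * z := by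
  have hz' : (0 : ℝ) < z := by exact_mod_cast hz
  rw [NNReal.dist_eq, NNReal.coe_div, NNReal.coe_one] at h
  have e : (g z : ℝ) - z = (g z / z - 1) * z := by field_simp
  rw [e, abs_mul, abs_of_pos hz']
  gcongr

theorem IsConnectionFunction.map_zero {g : ℝ≥0 → ℝ≥0} (hg : IsConnectionFunction g) : g 0 = 0 := by
  obtain ⟨C, hC⟩ := hg.linear_bound
  simpa using hC 0

theorem IsConnectionFunction.exists_near_zero {g : ℝ≥0 → ℝ≥0} (hg : IsConnectionFunction g) {δ : ℝ}
    (hδ : 0 < δ) : ∃ η : ℝ, 0 < η ∧ ∀ z : ℝ≥0, (z : ℝ) ≤ η → |(g z : ℝ) - z| ≤ δ * z := by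
  have h1 := hg.tendsto_zero.eventually (Metric.ball_mem_nhds 1 hδ)
  rw [eventually_nhdsWithin_iff, Metric.eventually_nhds_iff] at h1
  obtain ⟨η, hη, h⟩ := h1
  refine ⟨η / 2, half_pos hη, fun z hz => ?_⟩
  rcases eq_or_ne z 0 with rfl | hz0
  · simp [hg.map_zero]
  · have hzp : 0 < z := pos_iff_ne_zero.2 hz0
    refine abs_sub_le_of_ratio hzp (h ?_ hzp)
    rw [NNReal.dist_eq, NNReal.coe_zero, sub_zero, NNReal.abs_eq]
    linarith

theorem exists_near_top {g : ℝ≥0 → ℝ≥0} (hg : Tendsto (fun x => g x / x) atTop (𝓝 1)) {δ : ℝ}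
    (hδ : 0 < δ) : ∃ M : ℝ, 0 < M ∧ ∀ z : ℝ≥0, M ≤ z → |(g z : ℝ) - z| ≤ δ * z := by
  obtain ⟨M, hM⟩ := eventually_atTop.1 (hg.eventually (Metric.ball_mem_nhds 1 hδ))
  refine ⟨M + 1, by positivity, fun z hz => ?_⟩
  have hz' : M + 1 ≤ z := by exact_mod_cast hz
  exact abs_sub_le_of_ratio (lt_of_lt_of_le (by positivity) hz') (hM z (le_self_add.trans hz'))

theorem IsIntermediate.tendsto_div {t : ℕ → ℕ} (ht : IsIntermediate t) :
    Tendsto (fun N : ℕ => (N : ℝ) / t N) atTop atTop := by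
  have h1 : Tendsto (fun N : ℕ => (t N : ℝ) / N) atTop (𝓝[>] 0) := by
    refine tendsto_nhdsWithin_of_tendsto_nhds_of_eventually_within _ ht.tendsto_ratio ?_
    filter_upwards [ht.tendsto_atTop.eventually_gt_atTop 0, eventually_gt_atTop 0] with N h1 h2
    have h1' : (0 : ℝ) < t N := by exact_mod_cast h1
    have h2' : (0 : ℝ) < N := by exact_mod_cast h2
    exact div_pos h1' h2'
  refine (tendsto_inv_nhdsGT_zero.comp h1).congr fun N => ?_
  simp

/-! ### Weights at which the connection function is not close to the identity -/

section Window

variable {L : ℕ} {P : Measure (Cone L)} {l : Fin L} {B : ℝ → ℝ} {c α : ℝ}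
  {τ : ℕ → ℝ} {t : ℕ → ℕ} {g : ℝ≥0 → ℝ≥0}

/-- Weights in the window `S N` carry a negligible part of the total weight, and all other weights
`x` lie in the range where `g` is close to the identity at `w x / T`, for all weights `w` on the
scale `a N` and total weights `T` on the scale `τ N`. -/
structure IsWindow (P : Measure (Cone L)) (l : Fin L) (g : ℝ≥0 → ℝ≥0) (a τ : ℕ → ℝ)
    (δ ε K₁ K : ℝ) (S : ℕ → Set ℝ) : Prop where
  measurable : ∀ N, MeasurableSet (S N)
  integrable : ∀ N, Integrable (fun w => (S N).indicator id (w l : ℝ)) P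
  mass : Tendsto (fun N => (∫ w, (S N).indicator id (w l : ℝ) ∂P) / RegTail.tmean (mtail P l) (τ N))
    atTop (𝓝 0)
  good : ∀ᶠ N in atTop, ∀ w x T : ℝ≥0, ε * a N ≤ w → w ≤ K₁ * a N → τ N ≤ K * T → T ≤ K * τ N →
    (x : ℝ) ∉ S N → |(g (w * x / T) : ℝ) - (w * x / T : ℝ≥0)| ≤ δ * (w * x / T : ℝ≥0)

/-- The weights with `w x / T` neither small nor large form an interval at the scale `τ / a`. Its
mass is at most a constant times `y F(y)` with `y` of order `τ / a`, and `RegTail.mul_tail_le`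
applies because `a → ∞` makes `y` much smaller than `τ`. -/
theorem exists_window_of_infinite_mean [IsProbabilityMeasure P] (h : RegTail (mtail P l) B c α)
    (hτ : ∀ᶠ N : ℕ in atTop, 1 ≤ τ N ∧ N * RegTail.tmean (mtail P l) (τ N) = τ N)
    (hm : Tendsto (RegTail.tmean (mtail P l)) atTop atTop) (hg : IsConnectionFunction g)
    (hg' : Tendsto (fun x => g x / x) atTop (𝓝 1)) {a : ℕ → ℝ} (ha : Tendsto a atTop atTop)
    {δ ε K₁ K : ℝ} (hδ : 0 < δ) (hε : 0 < ε) (hK₁ : 0 < K₁) (hK : 0 < K) :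
    ∃ S, IsWindow P l g a τ δ ε K₁ K S := by
  obtain ⟨η, hη, hgη⟩ := hg.exists_near_zero hδ
  obtain ⟨M, hM, hgM⟩ := exists_near_top hg' hδ
  -- The extreme values of `w` and `T` dictate the endpoints: `x ≤ ρ₁ τ / a` forces `w x / T ≤ η`,
  -- and `x ≥ ρ₂ τ / a` forces `w x / T ≥ M`.
  set ρ₁ := η / (K₁ * K) with hρ₁
  set ρ₂ := M * K / ε with hρ₂
  have hρ₁0 : 0 < ρ₁ := by positivity
  have hρ₂0 : 0 < ρ₂ := by positivity
  set S : ℕ → Set ℝ := fun N => Set.Icc (ρ₁ * (τ N / a N)) (ρ₂ * (τ N / a N)) with hS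
  have hSm : ∀ N, MeasurableSet (S N) := fun N => measurableSet_Icc
  have hfm : ∀ N, Measurable fun w : Cone L => (S N).indicator id (w l : ℝ) := fun N =>
    (measurable_id.indicator (hSm N)).comp (measurable_coord l)
  have hf0 : ∀ N (w : Cone L), 0 ≤ (S N).indicator id (w l : ℝ) := fun N w => by
    by_cases hw : (w l : ℝ) ∈ S N
    · rw [Set.indicator_of_mem hw]; exact (w l).coe_nonneg
    · rw [Set.indicator_of_notMem hw]
  have hSint : ∀ N, Integrable (fun w : Cone L => (S N).indicator id (w l : ℝ)) P := fun N =>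
    integrable_of_bounded (M := max (ρ₂ * (τ N / a N)) 0) (hfm N) (hf0 N) fun w => by
      by_cases hw : (w l : ℝ) ∈ S N
      · rw [Set.indicator_of_mem hw]; exact hw.2.trans (le_max_left _ _)
      · rw [Set.indicator_of_notMem hw]; exact le_max_right _ _
  have hτt := h.tau_tendsto hτ
  refine ⟨S, hSm, hSint, ?_, ?_⟩
  · rw [tendsto_order]
    have hpos : ∀ᶠ N in atTop, 0 < τ N ∧ 0 < a N :=
      (hτt.eventually_gt_atTop 0).and (ha.eventually_gt_atTop 0)
    refine ⟨fun e he => ?_, fun e he => ?_⟩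
    · filter_upwards [hpos] with N hN
      exact he.trans_le (div_nonneg (integral_nonneg (hf0 N)) (h.tmean_nonneg hN.1.le))
    · obtain ⟨k, Y, hk, hY, hkY⟩ := h.mul_tail_le hm (ε := e / 2 * (ρ₁ / (2 * ρ₂))) (by positivity)
      filter_upwards [hpos, hτt.eventually_ge_atTop Y, ha.eventually_ge_atTop (k * ρ₁ / 2)]
        with N ⟨hτ0, ha0⟩ hN1 hN2
      -- Half of the left endpoint, so that the strict tail `{y < W_l}` contains the closed window.
      set y := ρ₁ / 2 * (τ N / a N) with hy
      have hy0 : 0 < y := by positivity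
      have h1 := hkY (τ N) y hN1 hy0.le (by
        rw [hy]
        calc k * (ρ₁ / 2 * (τ N / a N)) = k * ρ₁ / 2 * (τ N / a N) := by ring
          _ ≤ a N * (τ N / a N) := by gcongr
          _ = τ N := by field_simp)
      have h2 : ∫ w, (S N).indicator id (w l : ℝ) ∂P ≤ ρ₂ * (τ N / a N) * mtail P l y := by
        have e1 : ρ₂ * (τ N / a N) * mtail P l y =
            ∫ w, {w : Cone L | y < (w l : ℝ)}.indicator (fun _ => ρ₂ * (τ N / a N)) w ∂P := by
          rw [integral_indicator_const _ (measurableSet_lt_coord_real l y), smul_eq_mul, mul_comm,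
            mtail]
        rw [e1]
        refine integral_mono (hSint N)
          ((integrable_const _).indicator (measurableSet_lt_coord_real l y)) fun w => ?_
        by_cases hw : (w l : ℝ) ∈ S N
        · have hyw : y < (w l : ℝ) := by
            refine lt_of_lt_of_le ?_ hw.1
            have : 0 < τ N / a N := by positivity
            rw [hy]; nlinarith
          have hmem : w ∈ {w : Cone L | y < (w l : ℝ)} := hyw
          simp only [Set.indicator_of_mem hw, Set.indicator_of_mem hmem]
          exact hw.2
        · simp only [Set.indicator_of_notMem hw]
          exact Set.indicator_nonneg (fun _ _ => by positivity) w
      have hmp := h.tmean_pos hτ0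
      rw [div_lt_iff₀ hmp]
      calc _ ≤ ρ₂ * (τ N / a N) * mtail P l y := h2
        _ = 2 * ρ₂ / ρ₁ * (y * mtail P l y) := by rw [hy]; field_simp
        _ ≤ 2 * ρ₂ / ρ₁ * (e / 2 * (ρ₁ / (2 * ρ₂)) * RegTail.tmean (mtail P l) (τ N)) := by gcongr
        _ = e / 2 * RegTail.tmean (mtail P l) (τ N) := by field_simp
        _ < _ := by nlinarith
  · filter_upwards [hτt.eventually_gt_atTop 0, ha.eventually_gt_atTop 0]
      with N hτ0 ha0 w x T hw1 hw2 hT1 hT2 hx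
    have hT0 : (0 : ℝ) < T := pos_of_mul_pos_right (hτ0.trans_le hT1) hK.le
    have hx0 : (0 : ℝ) ≤ x := x.coe_nonneg
    have hz : ((w * x / T : ℝ≥0) : ℝ) = w * x / T := by push_cast; rfl
    by_cases hx1 : ρ₁ * (τ N / a N) ≤ x
    · have hx2 : ρ₂ * (τ N / a N) < x := by
        by_contra hcon
        exact hx ⟨hx1, not_lt.1 hcon⟩
      refine hgM _ ?_
      rw [hz, le_div_iff₀ hT0]
      calc M * T ≤ M * (K * τ N) := by gcongr
        _ = ε * a N * (ρ₂ * (τ N / a N)) := by rw [hρ₂]; field_simp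
        _ ≤ w * x := by gcongr
    · refine hgη _ ?_
      rw [hz, div_le_iff₀ hT0]
      push Not at hx1
      calc (w : ℝ) * x ≤ K₁ * a N * (ρ₁ * (τ N / a N)) := by gcongr
        _ = η / K * τ N := by rw [hρ₁]; field_simp
        _ ≤ η / K * (K * T) := by gcongr
        _ = η * T := by field_simp

/-- Here all weights above `ρ₁ τ / a` are discarded, so nothing is asked of `g` at infinity. As `τ /
a → ∞`, their mean tends to `0` by dominated convergence, while the truncated mean stays bounded
below. -/
theorem exists_window_of_finite_mean (h : RegTail (mtail P l) B c α)
    (hτ : ∀ᶠ N : ℕ in atTop, 1 ≤ τ N ∧ N * RegTail.tmean (mtail P l) (τ N) = τ N)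
    (hi : Integrable (fun w : Cone L => (w l : ℝ)) P) (hg : IsConnectionFunction g)
    {a : ℕ → ℝ} (ha : Tendsto a atTop atTop) (haτ : Tendsto (fun N => τ N / a N) atTop atTop)
    {δ ε K₁ K : ℝ} (hδ : 0 < δ) (hK₁ : 0 < K₁) (hK : 0 < K) :
    ∃ S, IsWindow P l g a τ δ ε K₁ K S := by
  obtain ⟨η, hη, hgη⟩ := hg.exists_near_zero hδ
  set ρ₁ := η / (K₁ * K) with hρ₁
  have hρ₁0 : 0 < ρ₁ := by positivity
  set S : ℕ → Set ℝ := fun N => Set.Ici (ρ₁ * (τ N / a N)) with hS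
  have hSm : ∀ N, MeasurableSet (S N) := fun N => measurableSet_Ici
  have hfm : ∀ N, Measurable fun w : Cone L => (S N).indicator id (w l : ℝ) := fun N =>
    (measurable_id.indicator (hSm N)).comp (measurable_coord l)
  have hbd : ∀ N (w : Cone L), ‖(S N).indicator id (w l : ℝ)‖ ≤ (w l : ℝ) := fun N w => by
    by_cases hw : (w l : ℝ) ∈ S N
    · rw [Set.indicator_of_mem hw]; simp
    · rw [Set.indicator_of_notMem hw]; simp
  have hSint : ∀ N, Integrable (fun w : Cone L => (S N).indicator id (w l : ℝ)) P := fun N =>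
    hi.mono' (hfm N).aestronglyMeasurable (Eventually.of_forall (hbd N))
  have hτt := h.tau_tendsto hτ
  refine ⟨S, hSm, hSint, ?_, ?_⟩
  · have h1 : Tendsto (fun N => ∫ w, (S N).indicator id (w l : ℝ) ∂P) atTop (𝓝 0) := by
      have h2 := tendsto_integral_of_dominated_convergence (μ := P)
        (F := fun N (w : Cone L) => (S N).indicator id (w l : ℝ)) (f := fun _ => (0 : ℝ))
        (fun w => (w l : ℝ)) (fun N => (hfm N).aestronglyMeasurable) hi
        (fun N => Eventually.of_forall (hbd N)) (Eventually.of_forall fun w => ?_)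
      · simpa using h2
      · refine tendsto_const_nhds.congr' ?_
        filter_upwards [(haτ.const_mul_atTop hρ₁0).eventually_gt_atTop (w l : ℝ)] with N hN
        exact (Set.indicator_of_notMem (fun hw => absurd hN (not_lt.2 hw)) _).symm
    have hm1 := h.tmean_pos one_pos
    have h3 := h1.div_const (RegTail.tmean (mtail P l) 1)
    rw [zero_div] at h3
    have hnn : ∀ N, 0 ≤ ∫ w, (S N).indicator id (w l : ℝ) ∂P := fun N =>
      integral_nonneg fun w => by
        by_cases hw : (w l : ℝ) ∈ S N
        · simp only [Set.indicator_of_mem hw]; exact (w l).coe_nonneg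
        · simp only [Set.indicator_of_notMem hw]; exact le_rfl
    refine squeeze_zero' ?_ ?_ h3
    · filter_upwards [hτ] with N hN
      exact div_nonneg (hnn N) (h.tmean_nonneg (by linarith [hN.1]))
    · filter_upwards [hτ] with N hN
      exact div_le_div_of_nonneg_left (hnn N) hm1 (h.tmean_mono hN.1)
  · filter_upwards [hτt.eventually_gt_atTop 0, ha.eventually_gt_atTop 0]
      with N hτ0 ha0 w x T hw1 hw2 hT1 hT2 hx
    have hT0 : (0 : ℝ) < T := pos_of_mul_pos_right (hτ0.trans_le hT1) hK.le
    have hx0 : (0 : ℝ) ≤ x := x.coe_nonneg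
    have hz : ((w * x / T : ℝ≥0) : ℝ) = w * x / T := by push_cast; rfl
    have hx1 : (x : ℝ) < ρ₁ * (τ N / a N) := not_le.1 hx
    refine hgη _ ?_
    rw [hz, div_le_iff₀ hT0]
    calc (w : ℝ) * x ≤ K₁ * a N * (ρ₁ * (τ N / a N)) := by gcongr
      _ = η / K * τ N := by rw [hρ₁]; field_simp
      _ ≤ η / K * (K * T) := by gcongr
      _ = η * T := by field_simp

theorem tmean_le_integral [IsProbabilityMeasure P] (hi : Integrable (fun w : Cone L => (w l : ℝ)) P) {y : ℝ} (hy : 0 ≤ y) :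
    RegTail.tmean (mtail P l) y ≤ ∫ w, (w l : ℝ) ∂P := by
  rw [← integral_min_coord hy]
  exact integral_mono (integrable_of_bounded ((measurable_coord l).min measurable_const)
    (fun w => le_min (w l).coe_nonneg hy) fun w => min_le_right _ _) hi fun w => min_le_left _ _

theorem integrable_of_tmean_tendsto [IsProbabilityMeasure P] (h : RegTail (mtail P l) B c α) {M : ℝ}
    (hM : Tendsto (RegTail.tmean (mtail P l)) atTop (𝓝 M)) :
    Integrable (fun w : Cone L => (w l : ℝ)) P := by
  have hmeas : ∀ k : ℕ, Measurable fun w : Cone L => min (w l : ℝ) k := fun k =>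
    (measurable_coord l).min measurable_const
  have h1 := lintegral_tendsto_of_tendsto_of_monotone (μ := P)
    (f := fun (k : ℕ) w => ENNReal.ofReal (min (w l : ℝ) k)) (F := fun w => ENNReal.ofReal (w l : ℝ))
    (fun k => (hmeas k).ennreal_ofReal.aemeasurable)
    (Eventually.of_forall fun w j k hjk => ENNReal.ofReal_le_ofReal
      (min_le_min_left _ (by exact_mod_cast hjk)))
    (Eventually.of_forall fun w => by
      refine tendsto_const_nhds.congr' ?_
      filter_upwards [tendsto_natCast_atTop_atTop.eventually_ge_atTop (w l : ℝ)] with k hk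
      rw [min_eq_left hk])
  have h2 : ∀ k : ℕ, ∫⁻ w, ENNReal.ofReal (min (w l : ℝ) k) ∂P ≤ ENNReal.ofReal M := by
    intro k
    have hk : (0 : ℝ) ≤ k := Nat.cast_nonneg k
    have h0 : ∀ w : Cone L, 0 ≤ min (w l : ℝ) k := fun w => le_min (w l).coe_nonneg hk
    rw [← ofReal_integral_eq_lintegral_ofReal (integrable_of_bounded (hmeas k) h0
      fun w => min_le_right _ _) (Eventually.of_forall h0), integral_min_coord hk]
    exact ENNReal.ofReal_le_ofReal (h.tmean_mono.ge_of_tendsto hM k)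
  have h3 := le_of_tendsto' h1 h2
  exact (lintegral_ofReal_ne_top_iff_integrable (measurable_coord l).aestronglyMeasurable
    (Eventually.of_forall fun w => (w l).coe_nonneg)).1 (h3.trans_lt ENNReal.ofReal_lt_top).ne

/-- The case split is on the limit of the truncated mean. For finite mean, `τ / a → ∞` because `τ`
is at least of order `N ≥ N / t_N` while `B(n) = o(n)`. -/
theorem exists_window [IsProbabilityMeasure P] (h : RegTail (mtail P l) B c α)
    (hτ : ∀ᶠ N : ℕ in atTop, 1 ≤ τ N ∧ N * RegTail.tmean (mtail P l) (τ N) = τ N)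
    (hg : IsConnectionFunction g)
    (hmean : Integrable (fun w : Cone L => (w l : ℝ)) P ∨ Tendsto (fun x => g x / x) atTop (𝓝 1))
    (ht : IsIntermediate t)
    {δ ε K₁ K : ℝ} (hδ : 0 < δ) (hε : 0 < ε) (hK₁ : 0 < K₁) (hK : 0 < K) :
    ∃ S, IsWindow P l g (fun N : ℕ => B (N / t N)) τ δ ε K₁ K S := by
  have ha : Tendsto (fun N : ℕ => B (N / t N)) atTop atTop := h.scale.comp ht.tendsto_div
  rcases h.tmean_tendsto_atTop_or with hm | ⟨M, hM0, hM⟩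
  · have hg' : Tendsto (fun x => g x / x) atTop (𝓝 1) := by
      rcases hmean with hi | hg'
      · obtain ⟨y, hy, hy0⟩ := ((hm.eventually_gt_atTop (∫ w, (w l : ℝ) ∂P)).and
          (eventually_ge_atTop 0)).exists
        exact absurd (tmean_le_integral hi hy0) (not_le.2 hy)
      · exact hg'
    exact exists_window_of_infinite_mean h hτ hm hg hg' ha hδ hε hK₁ hK
  · refine exists_window_of_finite_mean h hτ (integrable_of_tmean_tendsto h hM) hg ha ?_ hδ hK₁ hK
    have hm1 := h.tmean_pos one_pos
    have h1 : Tendsto (fun N : ℕ => B (N / t N) / (N / t N)) atTop (𝓝[>] 0) := by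
      refine tendsto_nhdsWithin_of_tendsto_nhds_of_eventually_within _
        ((h.scale_div_tendsto_zero hM).comp ht.tendsto_div) ?_
      filter_upwards [ha.eventually_gt_atTop 0, ht.tendsto_div.eventually_gt_atTop 0] with N h1 h2
      exact div_pos h1 h2
    have h2 := (tendsto_inv_nhdsGT_zero.comp h1).const_mul_atTop hm1
    refine tendsto_atTop_mono' _ ?_ h2
    filter_upwards [ha.eventually_gt_atTop 0, ht.tendsto_atTop.eventually_ge_atTop 1,
      h.tau_ge hτ] with N ha0 ht1 hτN
    have ht1' : (1 : ℝ) ≤ t N := by exact_mod_cast ht1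
    simp only [Function.comp_apply, inv_div]
    rw [mul_div_assoc']
    gcongr
    calc RegTail.tmean (mtail P l) 1 * (N / t N) ≤ RegTail.tmean (mtail P l) 1 * N := by
          gcongr
          exact div_le_self (Nat.cast_nonneg N) ht1'
      _ ≤ τ N := by linarith

end Window

/-! ### Concentration of the conditional mean degrees around the weights -/

section MeanDegree

variable {Ω : Type*} [MeasurableSpace Ω] {μ : Measure Ω} [IsProbabilityMeasure μ] {L : ℕ}
  {g : Fin L → ℝ≥0 → ℝ≥0} {W : ℕ → Ω → Cone L} {A : (N : ℕ) → Fin N → Fin N → Fin L → Ω → ℕ}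
  {l : Fin L} {B : ℝ → ℝ} {c α : ℝ} {t : ℕ → ℕ}

/-- Since `∑_j W_i W_j / T = W_i`, the error is a sum of differences `g(z) - z`. These are at most
`δ z` outside the window and at most `(C + 1) z` inside, and the inside terms add up to `W_i` times
the window's share of the total weight. -/
theorem abs_meanDegree_sub_le {Ω : Type*} {W : ℕ → Ω → Cone L} {N : ℕ} {ω : Ω} {S : Set ℝ}
    {δ C : ℝ} (hδ : 0 ≤ δ) (hC : ∀ z, (g l z : ℝ) ≤ C * z) (i : Fin N)
    (hT : 0 < totalWeight W N l ω)
    (hgood : ∀ j : Fin N, (W j ω l : ℝ) ∉ S →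
      |(edgeRate g W N i j l ω : ℝ) - (W i ω l * W j ω l / totalWeight W N l ω : ℝ≥0)| ≤
        δ * (W i ω l * W j ω l / totalWeight W N l ω : ℝ≥0)) :
    |(meanDegree g W N i l ω : ℝ) - W i ω l| ≤ W i ω l *
      (δ + (C + 1) * ((∑ j : Fin N, S.indicator id (W j ω l : ℝ)) / totalWeight W N l ω)) := by
  set T := totalWeight W N l ω with hTdef
  have hT' : (0 : ℝ) < T := by exact_mod_cast hT
  have hTs : (T : ℝ) = ∑ j : Fin N, (W j ω l : ℝ) := by simp [hTdef, totalWeight]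
  have e1 : (W i ω l : ℝ) = ∑ j : Fin N, ((W i ω l * W j ω l / T : ℝ≥0) : ℝ) := by
    push_cast
    rw [← Finset.sum_div, ← Finset.mul_sum, ← hTs]
    field_simp
  have e2 : (meanDegree g W N i l ω : ℝ) - W i ω l =
      ∑ j : Fin N, ((edgeRate g W N i j l ω : ℝ) - (W i ω l * W j ω l / T : ℝ≥0)) := by
    rw [Finset.sum_sub_distrib, ← e1]
    simp [meanDegree]
  rw [e2]
  refine (Finset.abs_sum_le_sum_abs _ _).trans ?_
  have hterm : ∀ j : Fin N, |(edgeRate g W N i j l ω : ℝ) - (W i ω l * W j ω l / T : ℝ≥0)| ≤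
      δ * (W i ω l * W j ω l / T) +
        (C + 1) * (W i ω l * S.indicator id (W j ω l : ℝ) / T) := by
    intro j
    have hz : ((W i ω l * W j ω l / T : ℝ≥0) : ℝ) = W i ω l * W j ω l / T := by push_cast; rfl
    have hz0 : (0 : ℝ) ≤ W i ω l * W j ω l / T := by positivity
    by_cases hj : (W j ω l : ℝ) ∈ S
    · rw [Set.indicator_of_mem hj, id, hz]
      have h1 := hC (W i ω l * W j ω l / T)
      rw [hz] at h1
      have h2 : (0 : ℝ) ≤ edgeRate g W N i j l ω := NNReal.coe_nonneg _
      have h3 : (edgeRate g W N i j l ω : ℝ) ≤ C * (W i ω l * W j ω l / T) := h1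
      rw [abs_le]
      constructor <;> nlinarith [mul_nonneg hδ hz0]
    · rw [Set.indicator_of_notMem hj]
      have := hgood j hj
      rw [hz] at this ⊢
      simpa using this
  refine (Finset.sum_le_sum fun j _ => hterm j).trans (le_of_eq ?_)
  rw [Finset.sum_add_distrib, ← Finset.mul_sum, ← Finset.mul_sum, ← Finset.sum_div,
    ← Finset.sum_div, ← Finset.mul_sum, ← Finset.mul_sum, ← hTs]
  field_simp

/-- With high probability the conditional mean degrees of all nodes with weight on the scale
`B(N / t_N)` are close to their weights. -/
theorem IsMIRG.whp_meanDegree (hG : IsMIRG μ g W A) (h : RegTail (mtail (μ.map (W 0)) l) B c α)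
    (hg : IsConnectionFunction (g l))
    (hmean : ∫⁻ ω, (W 0 ω l : ℝ≥0∞) ∂μ < ∞ ∨ Tendsto (fun x => g l x / x) atTop (𝓝 1))
    (ht : IsIntermediate t) {δ ε K₁ : ℝ} (hδ : 0 < δ) (hε : 0 < ε) (hK₁ : 0 < K₁) :
    Whp μ fun N ω => ∀ i : Fin N, ε * B (N / t N) ≤ W i ω l → W i ω l ≤ K₁ * B (N / t N) →
      |(meanDegree g W N i l ω : ℝ) - W i ω l| ≤ δ * W i ω l := by
  have := hG.isProbabilityMeasure_map
  obtain ⟨τ, hτ⟩ := h.exists_tau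
  have hτt := h.tau_tendsto hτ
  obtain ⟨C, hC⟩ := hg.linear_bound
  have hmean' : Integrable (fun w : Cone L => (w l : ℝ)) (μ.map (W 0)) ∨
      Tendsto (fun x => g l x / x) atTop (𝓝 1) := by
    refine hmean.imp_left fun hfin => ?_
    refine (lintegral_ofReal_ne_top_iff_integrable (measurable_coord l).aestronglyMeasurable
      (Eventually.of_forall fun w => (w l).coe_nonneg)).1 ?_
    simp only [ENNReal.ofReal_coe_nnreal]
    have hm : Measurable fun w : Cone L => (w l : ℝ≥0∞) :=
      measurable_coe_nnreal_ennreal.comp (measurable_pi_apply l)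
    rw [lintegral_map hm (hG.measurable_weight 0)]
    exact hfin.ne
  refine whp_of_forall_le fun η hη => ?_
  obtain ⟨K, hK, htight⟩ := hG.totalWeight_tight h hτ (half_pos hη)
  obtain ⟨S, hS⟩ := exists_window (g := g l) h hτ hg hmean' ht (half_pos hδ) hε hK₁ hK
  -- A window mass below `δ' τ` is a share of at most `δ' K` of the total weight, and `(C + 1) δ' K
  -- = δ / 2`. The event involves no particular node, so the bound is uniform in `i`.
  set δ' : ℝ := δ / 2 / ((C + 1) * K) with hδ'
  have hδ'0 : 0 < δ' := by positivity
  have hmass : ∀ᶠ N in atTop, (∫ w, (S N).indicator id (w l : ℝ) ∂(μ.map (W 0))) /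
      RegTail.tmean (mtail (μ.map (W 0)) l) (τ N) < δ' * (η / 2) :=
    hS.mass.eventually (gt_mem_nhds (by positivity))
  filter_upwards [htight, hmass, hS.good, hτ] with N h1 h2 h3 h4
  have hτ0 : 0 < τ N := by linarith [h4.1]
  have hm0 := h.tmean_pos hτ0
  have hmark := hG.markov (f := fun w => (S N).indicator id (w l : ℝ))
    ((measurable_id.indicator (hS.measurable N)).comp (measurable_coord l)) (hS.integrable N)
    (fun w => by
      by_cases hw : (w l : ℝ) ∈ S N
      · rw [Set.indicator_of_mem hw]; exact (w l).coe_nonneg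
      · rw [Set.indicator_of_notMem hw]) N (mul_pos hδ'0 hτ0)
  have hmark' : μ.real {ω | δ' * τ N ≤ ∑ i : Fin N, (S N).indicator id (W i ω l : ℝ)} ≤ η / 2 := by
    refine hmark.trans ?_
    rw [div_lt_iff₀ hm0] at h2
    rw [div_le_iff₀ (by positivity)]
    calc _ ≤ N * (δ' * (η / 2) * RegTail.tmean (mtail (μ.map (W 0)) l) (τ N)) := by gcongr
      _ = δ' * (η / 2) * (N * RegTail.tmean (mtail (μ.map (W 0)) l) (τ N)) := by ring
      _ = δ' * (η / 2) * τ N := by rw [h4.2]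
      _ = _ := by ring
  have hsub : {ω | ¬ ∀ i : Fin N, ε * B (N / t N) ≤ W i ω l → W i ω l ≤ K₁ * B (N / t N) →
      |(meanDegree g W N i l ω : ℝ) - W i ω l| ≤ δ * W i ω l} ⊆
      {ω | ¬ (τ N ≤ K * totalWeight W N l ω ∧ totalWeight W N l ω ≤ K * τ N)} ∪
        {ω | δ' * τ N ≤ ∑ i : Fin N, (S N).indicator id (W i ω l : ℝ)} := by
    intro ω hω
    by_contra hcon
    simp only [Set.mem_union, Set.mem_ofPred_eq, not_or, not_not, not_le] at hcon
    obtain ⟨⟨hT1, hT2⟩, hbad⟩ := hcon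
    refine hω fun i hi1 hi2 => ?_
    have hT0 : (0 : ℝ) < totalWeight W N l ω := pos_of_mul_pos_right (hτ0.trans_le hT1) hK.le
    have key := abs_meanDegree_sub_le (g := g) (W := W) (l := l) (S := S N) (ω := ω) (C := C)
      (half_pos hδ).le (fun z => by exact_mod_cast hC z) i (by exact_mod_cast hT0)
      fun j hj => h3 (W i ω l) (W j ω l) (totalWeight W N l ω) hi1 hi2 hT1 hT2 hj
    refine key.trans ?_
    rw [mul_comm]
    gcongr
    have h5 : (∑ j : Fin N, (S N).indicator id (W j ω l : ℝ)) / totalWeight W N l ω ≤ δ' * K := by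
      rw [div_le_iff₀ hT0]
      calc _ ≤ δ' * τ N := hbad.le
        _ ≤ δ' * (K * totalWeight W N l ω) := by gcongr
        _ = _ := by ring
    calc δ / 2 + (C + 1) * _ ≤ δ / 2 + (C + 1) * (δ' * K) := by gcongr
      _ = δ := by rw [hδ']; field_simp; ring
  calc _ ≤ η / 2 + η / 2 :=
        (measureReal_mono hsub).trans ((measureReal_union_le _ _).trans (add_le_add h1 hmark'))
    _ = η := by ring

end MeanDegree
/-! ### Counting nodes -/

section Count

variable {N : ℕ} {p q r : Fin N → Prop}

/-- The number of nodes with a given property, as a real number. -/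
noncomputable def count (p : Fin N → Prop) : ℝ := ({i | p i}.ncard : ℝ)

theorem count_eq_card [DecidablePred p] : count p = ((Finset.univ.filter p).card : ℝ) := by
  rw [count, Set.ncard_eq_toFinset_card']
  congr 2
  ext i
  simp

theorem count_mono (h : ∀ i, p i → q i) : count p ≤ count q := by
  unfold count
  exact_mod_cast Set.ncard_le_ncard (fun i (hi : p i) => (h i hi : q i)) (Set.toFinite _)

theorem count_le_add (h : ∀ i, p i → q i ∨ r i) : count p ≤ count q + count r := by
  have h1 : {i | p i} ⊆ {i | q i} ∪ {i | r i} := fun i hi => h i hi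
  have h2 := (Set.ncard_le_ncard h1 (Set.toFinite _)).trans (Set.ncard_union_le _ _)
  unfold count
  exact_mod_cast h2

theorem count_and_not (h : ∀ i, q i → p i) : count (fun i => p i ∧ ¬ q i) = count p - count q := by
  have h1 : {i | q i} ⊆ {i | p i} := fun i hi => h i hi
  have h2 := Set.ncard_sdiff_add_ncard_of_subset h1 (Set.toFinite _)
  have h3 : {i | p i ∧ ¬ q i} = {i | p i} \ {i | q i} := rfl
  unfold count
  rw [h3, eq_sub_iff_add_eq]
  exact_mod_cast h2

theorem abs_count_sub_le : |count p - count q| ≤ count fun i => ¬ (p i ↔ q i) := by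
  rw [abs_le]
  have h1 : count p ≤ count q + count fun i => ¬ (p i ↔ q i) := count_le_add fun i hi => by tauto
  have h2 : count q ≤ count p + count fun i => ¬ (p i ↔ q i) := count_le_add fun i hi => by tauto
  constructor <;> linarith

theorem count_eq_sum {β : Type*} (w : Fin N → β) (S : Set β) :
    count (fun i => w i ∈ S) = ∑ i, S.indicator (1 : β → ℝ) (w i) := by
  classical
  rw [count_eq_card, Finset.card_filter]
  push_cast
  exact Finset.sum_congr rfl fun i _ => by simp [Set.indicator_apply]

theorem count_true : count (fun _ : Fin N => True) = N := by
  rw [count_eq_card]; simp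

end Count

/-! ### Comparison of degree and weight exceedances -/

section Compare

variable {Ω : Type*} [MeasurableSpace Ω] {μ : Measure Ω} [IsProbabilityMeasure μ] {L : ℕ}
  {g : Fin L → ℝ≥0 → ℝ≥0} {W : ℕ → Ω → Cone L} {A : (N : ℕ) → Fin N → Fin N → Fin L → Ω → ℕ}
  {l : Fin L} {B : ℝ → ℝ} {c α : ℝ} {t : ℕ → ℕ}

theorem whp_count_le {E : (N : ℕ) → Fin N → Set Ω} (hE : ∀ N i, MeasurableSet (E N i))
    (ht : IsIntermediate t) (hsum : Tendsto (fun N => (∑ i, μ.real (E N i)) / t N) atTop (𝓝 0))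
    {ε : ℝ} (hε : 0 < ε) : Whp μ fun N ω => count (fun i => ω ∈ E N i) ≤ ε * t N := by
  have h1 := hsum.div_const ε
  rw [zero_div] at h1
  refine whp_of_le h1 ?_
  filter_upwards [ht.tendsto_atTop.eventually_gt_atTop 0] with N hN
  have hN' : (0 : ℝ) < t N := by exact_mod_cast hN
  have hi : ∀ i, Integrable ((E N i).indicator (1 : Ω → ℝ)) μ := fun i =>
    (integrable_const (1 : ℝ)).indicator (hE N i)
  have h2 := mul_meas_ge_le_integral_of_nonneg (μ := μ)
    (f := fun ω => ∑ i, (E N i).indicator (1 : Ω → ℝ) ω)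
    (Eventually.of_forall fun ω => Finset.sum_nonneg fun i _ =>
      Set.indicator_nonneg (fun _ _ => zero_le_one) ω)
    (integrable_finsetSum _ fun i _ => hi i) (ε * t N)
  rw [integral_finsetSum _ fun i _ => hi i] at h2
  simp only [integral_indicator_one (hE N _)] at h2
  rw [div_div, mul_comm (t N : ℝ) ε, le_div_iff₀ (by positivity), mul_comm]
  refine le_trans (mul_le_mul_of_nonneg_left (measureReal_mono fun ω hω => ?_)
    (by positivity)) h2
  have hω : ¬ count (fun i => ω ∈ E N i) ≤ ε * t N := hω
  have e : count (fun i => ω ∈ E N i) = ∑ i, (E N i).indicator (1 : Ω → ℝ) ω := by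
    classical
    rw [count_eq_card, Finset.card_filter]
    push_cast
    exact Finset.sum_congr rfl fun i _ => by simp [Set.indicator_apply]
  change ε * t N ≤ ∑ i, (E N i).indicator (1 : Ω → ℝ) ω
  rw [← e]
  exact (not_le.1 hω).le

theorem IsMIRG.measurable_degree {μ : Measure Ω} (hG : IsMIRG μ g W A) (N : ℕ) (i : Fin N)
    (l : Fin L) : Measurable fun ω => (degree A N i l ω : ℝ) :=
  (measurable_of_countable (fun n : ℕ => (n : ℝ))).comp
    (Finset.measurable_sum _ fun j _ => hG.measurable_adj N i j l)

theorem IsMIRG.measurable_meanDegree {μ : Measure Ω} (hG : IsMIRG μ g W A) (N : ℕ) (i : Fin N)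
    (l : Fin L) : Measurable fun ω => (meanDegree g W N i l ω : ℝ) :=
  measurable_coe_nnreal_real.comp
    (Finset.measurable_sum _ fun j _ => hG.measurable_edgeRate N i j l)

/-- Few nodes have a degree far from its conditional mean. -/
theorem IsMIRG.whp_chernoff (hG : IsMIRG μ g W A) (h : RegTail (mtail (μ.map (W 0)) l) B c α)
    (ht : IsIntermediate t) {x ρ : ℝ} (hx : 0 < x) (hρ : 0 < ρ) (hρ1 : ρ ≠ 1)
    {I J : ℕ → Set ℝ} (hI : ∀ N, MeasurableSet (I N)) (hJ : ∀ N, MeasurableSet (J N))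
    (hIρ : ∀ N : ℕ, ∀ z ∈ I N, (ρ⁻¹ - 1) * z ≤ (1 - ρ) * (x * B (N / t N)))
    (hJρ : ∀ N : ℕ, ∀ d ∈ J N, Real.log ρ * d ≤ Real.log ρ * (x * B (N / t N)))
    {ε : ℝ} (hε : 0 < ε) :
    Whp μ fun N ω => count (fun i : Fin N =>
      (meanDegree g W N i l ω : ℝ) ∈ I N ∧ (degree A N i l ω : ℝ) ∈ J N) ≤ ε * t N := by
  -- The union over `N` nodes, divided by `t_N`, is `n exp(-κ B(n))` with `n = N / t_N`. Strict
  -- convexity of `-log` makes `κ` positive for `ρ ≠ 1`.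
  have hκ : 0 < (ρ - 1 - Real.log ρ) * x := by
    have := Real.log_lt_sub_one_of_pos hρ hρ1
    exact mul_pos (by linarith) hx
  have hlim := (h.tendsto_mul_exp hκ).comp ht.tendsto_div
  refine whp_count_le (E := fun N i => {ω | (meanDegree g W N i l ω : ℝ) ∈ I N ∧
    (degree A N i l ω : ℝ) ∈ J N}) (fun N i => ?_) ht ?_ hε
  · exact (hG.measurable_meanDegree N i l (hI N)).inter (hG.measurable_degree N i l (hJ N))
  · refine squeeze_zero (fun N => ?_) (fun N => ?_) hlim
    · exact div_nonneg (Finset.sum_nonneg fun i _ => measureReal_nonneg) (Nat.cast_nonneg _)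
    · have hb : ∀ i : Fin N, μ.real {ω | (meanDegree g W N i l ω : ℝ) ∈ I N ∧
          (degree A N i l ω : ℝ) ∈ J N} ≤
          Real.exp (-((ρ - 1 - Real.log ρ) * x) * B (N / t N)) := by
        intro i
        have h1 := hG.chernoff i l hρ (hI N) (hIρ N) (hJρ N)
        have h2 := ENNReal.toReal_mono ENNReal.ofReal_ne_top h1
        rw [ENNReal.toReal_ofReal (Real.exp_pos _).le] at h2
        refine h2.trans (le_of_eq ?_)
        congr 1
        ring
      have h3 := Finset.sum_le_sum fun i (_ : i ∈ Finset.univ) => hb i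
      simp only [Finset.sum_const, Finset.card_univ, Fintype.card_fin, nsmul_eq_mul] at h3
      change _ ≤ (N : ℝ) / t N * Real.exp (-((ρ - 1 - Real.log ρ) * x) * B (N / t N))
      rw [div_mul_eq_mul_div]
      gcongr

theorem meanDegree_le {Ω : Type*} {W : ℕ → Ω → Cone L} {C : ℝ≥0} (hC : ∀ z, g l z ≤ C * z) (N : ℕ)
    (i : Fin N) (ω : Ω) : meanDegree g W N i l ω ≤ C * W i ω l := by
  calc meanDegree g W N i l ω ≤ ∑ j : Fin N, C * (W i ω l * W j ω l / totalWeight W N l ω) :=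
        Finset.sum_le_sum fun j _ => hC _
    _ = C * (W i ω l * (totalWeight W N l ω / totalWeight W N l ω)) := by
      rw [← Finset.mul_sum, ← Finset.sum_div, ← Finset.mul_sum, mul_div_assoc]
      rfl
    _ ≤ C * (W i ω l * 1) := by gcongr; exact div_self_le_one _
    _ = _ := by rw [mul_one]

theorem IsMIRG.whp_count_weight (hG : IsMIRG μ g W A) (h : RegTail (mtail (μ.map (W 0)) l) B c α)
    (ht : IsIntermediate t) {x ε : ℝ} (hx : 0 < x) (hε : 0 < ε) :
    Whp μ fun N ω => |count (fun i : Fin N => x * B (N / t N) < W i ω l) - c * x ^ (-α) * t N| ≤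
      ε * t N := by
  have h1 := hG.whp_count ht (S := fun N : ℕ => {w | x * B (N / t N) < (w l : ℝ)})
    (fun N => measurableSet_lt_coord_real l _) ((h.tail x hx).comp ht.tendsto_div) hε
  refine h1.mono (Eventually.of_forall fun N ω hω => ?_)
  rwa [← count_eq_sum] at hω

theorem exists_small_gap {α v ε : ℝ} (hε : 0 < ε) :
    ∃ δ : ℝ, 0 < δ ∧ δ < 1 ∧ v * (1 - δ) ^ (-α) - v * (1 + δ) ^ (-α) < ε := by
  have h1 : Tendsto (fun δ : ℝ => v * (1 - δ) ^ (-α) - v * (1 + δ) ^ (-α)) (𝓝 0)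
      (𝓝 (v * (1 - 0) ^ (-α) - v * (1 + 0) ^ (-α))) := by
    have e1 : ContinuousAt (fun δ : ℝ => (1 - δ) ^ (-α)) 0 :=
      (continuousAt_const.sub continuousAt_id).rpow_const (Or.inl (by norm_num))
    have e2 : ContinuousAt (fun δ : ℝ => (1 + δ) ^ (-α)) 0 :=
      (continuousAt_const.add continuousAt_id).rpow_const (Or.inl (by norm_num))
    exact (e1.const_mul v).sub (e2.const_mul v)
  simp only [sub_zero, add_zero, sub_self] at h1
  have h2 := ((h1.eventually (gt_mem_nhds hε)).and (gt_mem_nhds one_pos)).filter_mono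
    (nhdsWithin_le_nhds (s := Set.Ioi 0))
  obtain ⟨δ, ⟨h3, h4⟩, h5⟩ := (h2.and self_mem_nhdsWithin).exists
  exact ⟨δ, h5, h4, h3⟩

/-- Degrees and weights exceed thresholds on the scale `B(N / t_N)` at the same nodes, up to
`o(t_N)` exceptions. -/
theorem IsMIRG.whp_mismatch (hG : IsMIRG μ g W A) (h : RegTail (mtail (μ.map (W 0)) l) B c α)
    (hg : IsConnectionFunction (g l))
    (hmean : ∫⁻ ω, (W 0 ω l : ℝ≥0∞) ∂μ < ∞ ∨ Tendsto (fun x => g l x / x) atTop (𝓝 1))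
    (ht : IsIntermediate t) {x ε : ℝ} (hx : 0 < x) (hε : 0 < ε) :
    Whp μ fun N ω => count (fun i : Fin N =>
      ¬ (x * B (N / t N) < degree A N i l ω ↔ x * B (N / t N) < W i ω l)) ≤ ε * t N := by
  have hα := h.index_pos
  obtain ⟨C, hC⟩ := hg.linear_bound
  -- Exceptions are of four kinds: weights within a factor `1 ± δ` of the threshold, weights above
  -- `K a` where the mean degree is not controlled, and large deviations of the degree in either
  -- direction. They cost `3ε/8`, `2ε/8`, `ε/8` and `ε/8` times `t_N`.
  obtain ⟨δ, hδ0, hδ1, hδ⟩ := exists_small_gap (α := α) (v := c * x ^ (-α)) (ε := ε / 8) (by positivity)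
  obtain ⟨K, hK0, hK⟩ : ∃ K : ℝ, 0 < K ∧ c * K ^ (-α) < ε / 8 := by
    have h1 : Tendsto (fun K : ℝ => c * K ^ (-α)) atTop (𝓝 (c * 0)) :=
      (tendsto_rpow_neg_atTop hα).const_mul c
    rw [mul_zero] at h1
    obtain ⟨K, hK, hK0⟩ := ((h1.eventually (gt_mem_nhds (show 0 < ε / 8 by positivity))).and
      (eventually_gt_atTop 0)).exists
    exact ⟨K, hK0, hK⟩
  have hlo : 0 < 1 - δ := by linarith
  have e1 : ∀ d : ℝ, 0 < d → c * (d * x) ^ (-α) = c * x ^ (-α) * d ^ (-α) := fun d hd => by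
    rw [Real.mul_rpow hd.le hx.le]; ring
  have w1 := hG.whp_count_weight h ht (x := (1 - δ) * x) (by positivity)
    (show 0 < ε / 8 by positivity)
  have w2 := hG.whp_count_weight h ht (x := (1 + δ) * x) (by positivity)
    (show 0 < ε / 8 by positivity)
  have w3 := hG.whp_count_weight h ht hK0 (show 0 < ε / 8 by positivity)
  rw [e1 _ hlo] at w1
  rw [e1 _ (by positivity)] at w2
  -- Below `ε₀ a` the approximation of the mean degree by the weight is unavailable, but `Λ ≤ C W`
  -- already keeps `Λ` under `(1 - δ/2) x a`. The `+ 1` keeps the denominator positive.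
  set ε₀ : ℝ := (1 - δ / 2) * x / (C + 1) with hε₀
  have hε₀0 : 0 < ε₀ := by
    have : 0 < 1 - δ / 2 := by linarith
    positivity
  -- Relative precision `δ / 4` is enough because `(1 + δ)(1 - δ/4) ≥ 1 + δ/2` and `(1 - δ)(1 + δ/4)
  -- ≤ 1 - δ/2` for `0 < δ < 1`.
  have m1 := hG.whp_meanDegree h hg hmean ht (δ := δ / 4) (ε := ε₀) (K₁ := max K x) (by positivity)
    hε₀0 (lt_max_of_lt_left hK0)
  have hρ : 0 < 1 - δ / 2 := by linarith
  have c1 := hG.whp_chernoff h ht (x := x) (ρ := 1 - δ / 2) hx hρ (by linarith)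
    (I := fun N : ℕ => Set.Iic ((1 - δ / 2) * (x * B (N / t N))))
    (J := fun N : ℕ => Set.Ioi (x * B (N / t N)))
    (fun N => measurableSet_Iic) (fun N => measurableSet_Ioi)
    (fun N z hz => by
      have hz : z ≤ (1 - δ / 2) * (x * B (N / t N)) := hz
      have h1 : 0 ≤ (1 - δ / 2)⁻¹ - 1 := by
        rw [sub_nonneg]; exact (one_le_inv₀ hρ).2 (by linarith)
      refine (mul_le_mul_of_nonneg_left hz h1).trans (le_of_eq ?_)
      rw [← mul_assoc, sub_mul, inv_mul_cancel₀ hρ.ne', one_mul])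
    (fun N d hd => mul_le_mul_of_nonpos_left (le_of_lt hd)
      (Real.log_nonpos hρ.le (by linarith)))
    (show 0 < ε / 8 by positivity)
  have hρ' : 0 < 1 + δ / 2 := by linarith
  have c2 := hG.whp_chernoff h ht (x := x) (ρ := 1 + δ / 2) hx hρ' (by linarith)
    (I := fun N : ℕ => Set.Ici ((1 + δ / 2) * (x * B (N / t N))))
    (J := fun N : ℕ => Set.Iic (x * B (N / t N)))
    (fun N => measurableSet_Ici) (fun N => measurableSet_Iic)
    (fun N z hz => by
      have hz : (1 + δ / 2) * (x * B (N / t N)) ≤ z := hz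
      have h1 : (1 + δ / 2)⁻¹ - 1 ≤ 0 := by
        rw [sub_nonpos]; exact inv_le_one_of_one_le₀ (by linarith)
      refine (mul_le_mul_of_nonpos_left hz h1).trans (le_of_eq ?_)
      rw [← mul_assoc, sub_mul, inv_mul_cancel₀ hρ'.ne', one_mul])
    (fun N d hd => mul_le_mul_of_nonneg_left hd (Real.log_nonneg (by linarith)))
    (show 0 < ε / 8 by positivity)
  have haa : ∀ᶠ N : ℕ in atTop, 0 < B (N / t N) :=
    (h.scale.comp ht.tendsto_div).eventually_gt_atTop 0
  refine ((w1.and w2).and (w3.and m1)).and_mono (c1.and c2) ?_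
  filter_upwards [haa] with N ha ω ⟨⟨v1, v2⟩, v3, v4⟩ ⟨v5, v6⟩
  set a := B (N / t N) with hadef
  have hsplit : ∀ i : Fin N, ¬ (x * a < degree A N i l ω ↔ x * a < W i ω l) →
      (((1 - δ) * x * a < W i ω l ∧ ¬ (1 + δ) * x * a < W i ω l) ∨ K * a < W i ω l) ∨
      (((meanDegree g W N i l ω : ℝ) ∈ Set.Iic ((1 - δ / 2) * (x * a)) ∧
          (degree A N i l ω : ℝ) ∈ Set.Ioi (x * a)) ∨
        ((meanDegree g W N i l ω : ℝ) ∈ Set.Ici ((1 + δ / 2) * (x * a)) ∧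
          (degree A N i l ω : ℝ) ∈ Set.Iic (x * a))) := by
    intro i hi
    have hxa : 0 < x * a := mul_pos hx ha
    by_cases q1 : (1 - δ) * x * a < W i ω l
    · by_cases q2 : (1 + δ) * x * a < W i ω l
      · by_cases q3 : K * a < W i ω l
        · exact Or.inl (Or.inr q3)
        · -- a large weight with a small degree
          have q4 : x * a < W i ω l := by nlinarith
          have q5 : ¬ x * a < degree A N i l ω := fun hd => hi ⟨fun _ => q4, fun _ => hd⟩
          refine Or.inr (Or.inr ⟨?_, not_lt.1 q5⟩)
          have hεx : ε₀ ≤ x := by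
            rw [hε₀, div_le_iff₀ (by positivity)]
            have : (0 : ℝ) ≤ C := C.coe_nonneg
            nlinarith
          have q6 := v4 i ((mul_le_mul_of_nonneg_right hεx ha.le).trans q4.le)
            ((not_lt.1 q3).trans (mul_le_mul_of_nonneg_right (le_max_left _ _) ha.le))
          have q7 := (abs_le.1 q6).1
          change (1 + δ / 2) * (x * a) ≤ meanDegree g W N i l ω
          nlinarith
      · exact Or.inl (Or.inl ⟨q1, q2⟩)
    · -- a small weight with a large degree
      have q4 : ¬ x * a < W i ω l := by
        intro hc
        exact q1 (by nlinarith)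
      have q5 : x * a < degree A N i l ω := by
        by_contra hd
        exact hi ⟨fun hd' => absurd hd' hd, fun hw => absurd hw q4⟩
      refine Or.inr (Or.inl ⟨?_, q5⟩)
      change (meanDegree g W N i l ω : ℝ) ≤ (1 - δ / 2) * (x * a)
      by_cases q6 : ε₀ * a ≤ W i ω l
      · have q7 := v4 i q6
          ((not_lt.1 q4).trans (mul_le_mul_of_nonneg_right (le_max_right _ _) ha.le))
        have q8 := (abs_le.1 q7).2
        push Not at q1
        nlinarith
      · have q7 : (meanDegree g W N i l ω : ℝ) ≤ C * W i ω l := by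
          exact_mod_cast meanDegree_le hC N i ω
        push Not at q6
        calc (meanDegree g W N i l ω : ℝ) ≤ C * W i ω l := q7
          _ ≤ (C + 1) * (ε₀ * a) := by
            have : (0 : ℝ) ≤ W i ω l := NNReal.coe_nonneg _
            have : (0 : ℝ) ≤ C := C.coe_nonneg
            nlinarith
          _ = (1 - δ / 2) * (x * a) := by rw [hε₀]; field_simp
  have k1 := count_le_add hsplit
  have k2 := count_le_add (N := N)
    (p := fun i : Fin N => ((1 - δ) * x * a < W i ω l ∧ ¬ (1 + δ) * x * a < W i ω l) ∨
      K * a < W i ω l) (fun i hi => hi)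
  have k3 := count_le_add (N := N)
    (p := fun i : Fin N => ((meanDegree g W N i l ω : ℝ) ∈ Set.Iic ((1 - δ / 2) * (x * a)) ∧
          (degree A N i l ω : ℝ) ∈ Set.Ioi (x * a)) ∨
        ((meanDegree g W N i l ω : ℝ) ∈ Set.Ici ((1 + δ / 2) * (x * a)) ∧
          (degree A N i l ω : ℝ) ∈ Set.Iic (x * a))) (fun i hi => hi)
  have k4 := count_and_not (N := N) (p := fun i : Fin N => (1 - δ) * x * a < W i ω l)
    (q := fun i : Fin N => (1 + δ) * x * a < W i ω l) (fun i hi => by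
      have : 0 < x * a := mul_pos hx ha
      nlinarith)
  have tN : (0 : ℝ) ≤ t N := Nat.cast_nonneg _
  have u1 := (abs_le.1 v1).2
  have u2 := (abs_le.1 v2).1
  have u3 := (abs_le.1 v3).2
  have u4 := mul_le_mul_of_nonneg_right hδ.le tN
  have u5 := mul_le_mul_of_nonneg_right hK.le tN
  rw [sub_mul] at u4
  have u6 := mul_nonneg hε.le tN
  linarith

theorem IsMIRG.whp_count_degree (hG : IsMIRG μ g W A) (h : RegTail (mtail (μ.map (W 0)) l) B c α)
    (hg : IsConnectionFunction (g l))
    (hmean : ∫⁻ ω, (W 0 ω l : ℝ≥0∞) ∂μ < ∞ ∨ Tendsto (fun x => g l x / x) atTop (𝓝 1))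
    (ht : IsIntermediate t) {x ε : ℝ} (hx : 0 < x) (hε : 0 < ε) :
    Whp μ fun N ω => |count (fun i : Fin N => x * B (N / t N) < degree A N i l ω) -
      c * x ^ (-α) * t N| ≤ ε * t N := by
  refine (hG.whp_count_weight h ht hx (half_pos hε)).and_mono
    (hG.whp_mismatch h hg hmean ht hx (half_pos hε)) (Eventually.of_forall fun N ω h1 h2 => ?_)
  have h3 := abs_count_sub_le (N := N) (p := fun i => x * B (N / t N) < degree A N i l ω)
    (q := fun i => x * B (N / t N) < W i ω l)
  refine (abs_sub_le _ (count fun i : Fin N => x * B (N / t N) < W i ω l) _).trans ?_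
  linarith

end Compare
/-! ### Empirical quantiles and the estimator -/

section Estimator

variable {Ω : Type*} {L : ℕ} {A : (N : ℕ) → Fin N → Fin N → Fin L → Ω → ℕ} {t : ℕ → ℕ} {N : ℕ}
  {l : Fin L} {ω : Ω}

theorem empiricalCDF_eq (hN : 0 < N) (x : ℝ) :
    empiricalCDF A N l ω x = 1 - count (fun i : Fin N => x < degree A N i l ω) / N := by
  have hN' : (0 : ℝ) < N := by exact_mod_cast hN
  have h1 := count_and_not (N := N) (p := fun _ => True) (q := fun i => x < degree A N i l ω)
    (fun _ _ => trivial)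
  rw [count_true] at h1
  simp only [true_and, not_lt] at h1
  rw [empiricalCDF, ← count_eq_card, h1]
  field_simp

theorem le_empiricalCDF_iff (hN : 0 < N) (x : ℝ) :
    1 - (t N : ℝ) / N ≤ empiricalCDF A N l ω x ↔
      count (fun i : Fin N => x < degree A N i l ω) ≤ t N := by
  have hN' : (0 : ℝ) < N := by exact_mod_cast hN
  rw [empiricalCDF_eq hN, sub_le_sub_iff_left, div_le_div_iff_of_pos_right hN']

theorem empiricalQuantile_le (htN : t N < N) {z : ℝ}
    (hz : count (fun i : Fin N => z < degree A N i l ω) ≤ t N) :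
    empiricalQuantile A t N l ω ≤ z := by
  have hN : 0 < N := by omega
  -- The level set is bounded below by `0`: under a negative threshold all `N` degrees are
  -- exceedances, which contradicts `t_N < N`.
  refine csInf_le ⟨0, fun x hx => ?_⟩ ((le_empiricalCDF_iff hN z).2 hz)
  by_contra! hx0
  have h1 := (le_empiricalCDF_iff hN x).1 hx
  have h2 : count (fun i : Fin N => x < degree A N i l ω) = N := by
    rw [← count_true]
    exact le_antisymm (count_mono fun _ _ => trivial)
      (count_mono fun i _ => hx0.trans_le (Nat.cast_nonneg _))
  rw [h2] at h1
  have : N ≤ t N := by exact_mod_cast h1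
  omega

theorem le_empiricalQuantile (hN : 0 < N) {z : ℝ}
    (hz : t N < count (fun i : Fin N => z < degree A N i l ω)) :
    z ≤ empiricalQuantile A t N l ω := by
  -- No degree exceeds the sum of all degrees, so the level set is nonempty and its infimum is not a
  -- default value.
  refine le_csInf ⟨∑ i : Fin N, (degree A N i l ω : ℝ), ?_⟩ fun x hx => ?_
  · refine (le_empiricalCDF_iff hN _).2 ?_
    have h1 : count (fun i : Fin N => ∑ i : Fin N, (degree A N i l ω : ℝ) < degree A N i l ω) ≤
        count (fun _ : Fin N => False) := count_mono fun i hi =>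
      absurd hi (not_lt.2 (Finset.single_le_sum (f := fun i : Fin N => (degree A N i l ω : ℝ))
        (fun _ _ => Nat.cast_nonneg _) (Finset.mem_univ i)))
    refine h1.trans ?_
    rw [count_eq_card]
    simp
  · by_contra! hxz
    have h1 := (le_empiricalCDF_iff hN x).1 hx
    have h2 : count (fun i : Fin N => z < degree A N i l ω) ≤
        count (fun i : Fin N => x < degree A N i l ω) := count_mono fun i hi => hxz.trans hi
    linarith

theorem utdEstimator_eq (s m : Fin L) :
    utdEstimator A t s m N ω =
      count (fun i : Fin N => empiricalQuantile A t N s ω < degree A N i s ω ∧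
        empiricalQuantile A t N m ω < degree A N i m ω) /
      count (fun i : Fin N => empiricalQuantile A t N s ω < degree A N i s ω) := by
  rw [count_eq_card, count_eq_card]
  rfl

end Estimator

/-! ### Empirical quantiles replaced by deterministic thresholds -/

section Final

variable {Ω : Type*} [MeasurableSpace Ω] {μ : Measure Ω} [IsProbabilityMeasure μ] {L : ℕ}
  {g : Fin L → ℝ≥0 → ℝ≥0} {W : ℕ → Ω → Cone L} {A : (N : ℕ) → Fin N → Fin N → Fin L → Ω → ℕ}
  {l : Fin L} {B : ℝ → ℝ} {c α : ℝ} {t : ℕ → ℕ}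

theorem IsIntermediate.eventually_lt (ht : IsIntermediate t) : ∀ᶠ N in atTop, t N < N := by
  filter_upwards [ht.tendsto_ratio.eventually (gt_mem_nhds one_pos), eventually_gt_atTop 0]
    with N h1 h2
  have h2' : (0 : ℝ) < N := by exact_mod_cast h2
  rw [div_lt_one h2'] at h1
  exact_mod_cast h1

/-- Degrees exceed their empirical quantile at the same nodes at which weights exceed the
theoretical threshold, up to `o(t_N)` exceptions. -/
theorem IsMIRG.whp_quantile_mismatch (hG : IsMIRG μ g W A)
    (h : RegTail (mtail (μ.map (W 0)) l) B c α) (hg : IsConnectionFunction (g l))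
    (hmean : ∫⁻ ω, (W 0 ω l : ℝ≥0∞) ∂μ < ∞ ∨ Tendsto (fun x => g l x / x) atTop (𝓝 1))
    (ht : IsIntermediate t) {ε : ℝ} (hε : 0 < ε) :
    Whp μ fun N ω => count (fun i : Fin N =>
      ¬ (empiricalQuantile A t N l ω < degree A N i l ω ↔
        RegTail.thr c α * B (N / t N) < W i ω l)) ≤ ε * t N := by
  set θ := RegTail.thr c α with hθdef
  have hθ : 0 < θ := h.thr_pos
  have hα := h.index_pos
  obtain ⟨δ, hδ0, hδ1, hδ⟩ := exists_small_gap (α := α) (v := 1) (ε := ε / 8) (by positivity)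
  rw [one_mul, one_mul] at hδ
  have hlo : 0 < 1 - δ := by linarith
  have hhi : 0 < 1 + δ := by linarith
  have g1 : 1 < (1 - δ) ^ (-α) :=
    Real.one_lt_rpow_of_pos_of_lt_one_of_neg hlo (by linarith) (by linarith)
  have g2 : (1 + δ) ^ (-α) < 1 := Real.rpow_lt_one_of_one_lt_of_neg (by linarith) (by linarith)
  -- About `(1 ∓ δ)^(-α) t_N` degrees exceed `(1 ∓ δ) θ a`. An error `e` below both distances to `1`
  -- keeps these counts on opposite sides of `t_N`, which traps the empirical quantile in between.
  -- The bound `ε / 8` is for the final count.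
  obtain ⟨e, he0, he1, he2, he3⟩ : ∃ e : ℝ, 0 < e ∧ e ≤ ε / 8 ∧ e < (1 - δ) ^ (-α) - 1 ∧
      e ≤ 1 - (1 + δ) ^ (-α) := by
    obtain ⟨e, he0, he⟩ := exists_between (lt_min (lt_min (show 0 < ε / 8 by positivity)
      (sub_pos.2 g1)) (sub_pos.2 g2))
    rw [lt_min_iff, lt_min_iff] at he
    exact ⟨e, he0, he.1.1.le, he.1.2, he.2.le⟩
  have d1 := hG.whp_count_degree h hg hmean ht (x := (1 - δ) * θ) (by positivity) he0
  have d2 := hG.whp_count_degree h hg hmean ht (x := (1 + δ) * θ) (by positivity) he0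
  rw [h.limit_mul_thr hlo] at d1
  rw [h.limit_mul_thr hhi] at d2
  have d3 := hG.whp_mismatch h hg hmean ht hθ (half_pos hε)
  have haa : ∀ᶠ N : ℕ in atTop, 0 < B (N / t N) :=
    (h.scale.comp ht.tendsto_div).eventually_gt_atTop 0
  refine (d1.and d2).and_mono d3 ?_
  filter_upwards [haa, ht.eventually_lt, ht.tendsto_atTop.eventually_gt_atTop 0]
    with N ha htN ht0 ω ⟨v1, v2⟩ v3
  have ht0' : (0 : ℝ) < t N := by exact_mod_cast ht0
  set a := B (N / t N) with hadef
  have hθa : 0 < θ * a := mul_pos hθ ha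
  have u1 := abs_le.1 v1
  have u2 := abs_le.1 v2
  have q1 : (1 - δ) * θ * a ≤ empiricalQuantile A t N l ω := by
    refine le_empiricalQuantile (by omega) ?_
    have := mul_lt_mul_of_pos_right he2 ht0'
    rw [sub_mul, one_mul] at this
    linarith
  have q2 : empiricalQuantile A t N l ω ≤ (1 + δ) * θ * a := by
    refine empiricalQuantile_le htN ?_
    have := mul_le_mul_of_nonneg_right he3 ht0'.le
    rw [sub_mul, one_mul] at this
    linarith
  -- With the quantile trapped, replacing it by `θ a` affects only nodes whose degree lies in the
  -- band between `(1 - δ) θ a` and `(1 + δ) θ a`. The other mismatches are those between degree and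
  -- weight at `θ a`.
  have k1 : count (fun i : Fin N => ¬ (empiricalQuantile A t N l ω < degree A N i l ω ↔
        θ * a < W i ω l)) ≤
      count (fun i : Fin N => (1 - δ) * θ * a < degree A N i l ω ∧
        ¬ (1 + δ) * θ * a < degree A N i l ω) +
      count (fun i : Fin N => ¬ (θ * a < degree A N i l ω ↔ θ * a < W i ω l)) := by
    refine count_le_add fun i hi => ?_
    by_cases hm : (θ * a < degree A N i l ω ↔ θ * a < W i ω l)
    · left
      rw [← hm] at hi
      by_cases hq : empiricalQuantile A t N l ω < degree A N i l ω
      · have h1 : ¬ θ * a < degree A N i l ω := fun h1 => hi ⟨fun _ => h1, fun _ => hq⟩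
        refine ⟨q1.trans_lt hq, fun h2 => h1 ?_⟩
        nlinarith
      · have h1 : θ * a < degree A N i l ω := by
          by_contra h1
          exact hi ⟨fun h2 => absurd h2 hq, fun h2 => absurd h2 h1⟩
        refine ⟨by nlinarith, fun h2 => hq (q2.trans_lt h2)⟩
    · exact Or.inr hm
  have k2 := count_and_not (N := N) (p := fun i : Fin N => (1 - δ) * θ * a < degree A N i l ω)
    (q := fun i : Fin N => (1 + δ) * θ * a < degree A N i l ω) (fun i hi => by nlinarith)
  rw [k2] at k1
  have u3 := mul_le_mul_of_nonneg_right hδ.le ht0'.le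
  have u4 := mul_le_mul_of_nonneg_right he1 ht0'.le
  rw [sub_mul] at u3
  have u5 := mul_pos hε ht0'
  linarith [u1.2, u2.1]

theorem abs_div_sub_le {u v T lam e : ℝ} (hT : 0 < T) (he : 0 ≤ e) (he2 : e ≤ 1 / 2)
    (hu : |u - lam * T| ≤ e * T) (hv : |v - T| ≤ e * T) :
    |u / v - lam| ≤ 2 * e * (1 + |lam|) := by
  have hv0 : T / 2 ≤ v := by nlinarith [(abs_le.1 hv).1]
  have hvp : 0 < v := by linarith
  have e1 : u / v - lam = (u - lam * T - lam * (v - T)) / v := by field_simp; ring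
  rw [e1, abs_div, abs_of_pos hvp, div_le_iff₀ hvp]
  have h1 : |u - lam * T - lam * (v - T)| ≤ e * T + |lam| * (e * T) := by
    refine (abs_sub _ _).trans (add_le_add hu ?_)
    rw [abs_mul]
    gcongr
  have h2 : 0 ≤ e * (1 + |lam|) := by positivity
  nlinarith

end Final
end MIRG

/-! ### Consistency of the estimator -/

theorem theorem3p1 {Ω : Type*} [MeasurableSpace Ω] (μ : Measure Ω) [IsProbabilityMeasure μ]
    {L : ℕ} (g : Fin L → ℝ≥0 → ℝ≥0) (W : ℕ → Ω → MIRG.Cone L)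
    (A : (N : ℕ) → Fin N → Fin N → Fin L → Ω → ℕ) (hG : MIRG.IsMIRG μ g W A)
    (α : ℝ) (hα : 0 < α) (b : ℝ≥0 → ℝ≥0) (ν : Measure (MIRG.Cone L))
    (hW : MIRG.MRV (μ.map (W 0)) α b ν)
    (s m : Fin L)
    (hν : ∀ l, l = s ∨ l = m → ν {x | 0 < x l} ≠ 0)
    (hg : ∀ l, l = s ∨ l = m → MIRG.IsConnectionFunction (g l))
    (hmean : ∀ l, l = s ∨ l = m →
      (∫⁻ ω, (W 0 ω l : ℝ≥0∞) ∂μ < ∞ ∨ Tendsto (fun x => g l x / x) atTop (𝓝 1)))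
    (t : ℕ → ℕ) (ht : MIRG.IsIntermediate t)
    (lam : ℝ) (hlam : MIRG.IsUTDCoefficient (μ.map (W 0)) s m lam) :
    TendstoInMeasure μ (fun N => MIRG.utdEstimator A t s m N) atTop (fun _ => lam) := by
  have hP := hG.isProbabilityMeasure_map
  have hs := hW.regTail s (hν s (Or.inl rfl))
  have hm := hW.regTail m (hν m (Or.inr rfl))
  set B : ℝ → ℝ := fun n => b n.toNNReal with hB
  set cs := ν.real {w | 1 ≤ w s}
  set cm := ν.real {w | 1 ≤ w m}
  have hn := ht.tendsto_div
  have ha := (hs.scale.comp hn).eventually_gt_atTop 0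
  have hratio : ∀ θ : ℝ, Tendsto (fun N : ℕ => θ * B (N / t N) / B (N / t N)) atTop (𝓝 θ) := by
    intro θ
    refine tendsto_const_nhds.congr' ?_
    filter_upwards [ha] with N hN
    exact (mul_div_cancel_right₀ θ (ne_of_gt hN)).symm
  have hjoint := MIRG.tendsto_joint_tail hs hm hlam hn (hratio (MIRG.RegTail.thr cs α))
    (hratio (MIRG.RegTail.thr cm α))
  rw [tendstoInMeasure_iff_measureReal_dist]
  intro ε hε
  obtain ⟨e, he0, he⟩ : ∃ e : ℝ, 0 < e ∧ e ≤ 1 / 2 ∧ 2 * e * (1 + |lam|) < ε := by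
    refine ⟨min (1 / 2) (ε / (4 * (1 + |lam|))), by positivity, min_le_left _ _, ?_⟩
    have h1 : 0 < 1 + |lam| := by positivity
    calc 2 * min (1 / 2) (ε / (4 * (1 + |lam|))) * (1 + |lam|)
        ≤ 2 * (ε / (4 * (1 + |lam|))) * (1 + |lam|) := by gcongr; exact min_le_right _ _
      _ = ε / 2 := by field_simp; norm_num
      _ < ε := half_lt_self hε
  have he3 : 0 < e / 3 := by positivity
  have w1 := hG.whp_quantile_mismatch hs (hg s (Or.inl rfl)) (hmean s (Or.inl rfl)) ht he3
  have w2 := hG.whp_quantile_mismatch hm (hg m (Or.inr rfl)) (hmean m (Or.inr rfl)) ht he3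
  -- The joint exceedances of the weights number about `lam t_N`. The case `lam = 0` is covered
  -- because the error is measured relative to `t_N`, not to the mean count.
  have w3 := hG.whp_count ht (S := fun N : ℕ => {w | MIRG.RegTail.thr cs α * B (N / t N) < (w s : ℝ) ∧
    MIRG.RegTail.thr cm α * B (N / t N) < (w m : ℝ)}) (fun N =>
      (MIRG.measurableSet_lt_coord_real s _).inter (MIRG.measurableSet_lt_coord_real m _)) hjoint he3
  have w4 := hG.whp_count_weight hs ht hs.thr_pos he3
  have one : cs * MIRG.RegTail.thr cs α ^ (-α) = 1 := by
    have := hs.limit_mul_thr one_pos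
    rwa [one_mul, Real.one_rpow] at this
  rw [one] at w4
  have final : MIRG.Whp μ fun N ω => dist (MIRG.utdEstimator A t s m N ω) lam < ε := by
    refine (w1.and w2).and_mono (w3.and w4) ?_
    filter_upwards [ht.tendsto_atTop.eventually_gt_atTop 0] with N ht0 ω ⟨v1, v2⟩ ⟨v3, v4⟩
    have ht0' : (0 : ℝ) < t N := by exact_mod_cast ht0
    rw [Real.dist_eq, MIRG.utdEstimator_eq]
    refine lt_of_le_of_lt (MIRG.abs_div_sub_le ht0' he0.le he.1 ?_ ?_) he.2
    · rw [← MIRG.count_eq_sum] at v3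
      have k1 := MIRG.abs_count_sub_le (N := N)
        (p := fun i => MIRG.empiricalQuantile A t N s ω < MIRG.degree A N i s ω ∧
          MIRG.empiricalQuantile A t N m ω < MIRG.degree A N i m ω)
        (q := fun i => MIRG.RegTail.thr cs α * B (N / t N) < W i ω s ∧
          MIRG.RegTail.thr cm α * B (N / t N) < W i ω m)
      -- A node on which the joint exceedances of degrees and weights disagree is a mismatch in
      -- layer `s` or in layer `m`. The numerator thus has three errors of `e / 3`: one per layer,
      -- and one from the weight count.
      have k2 := k1.trans (MIRG.count_le_add
        (q := fun i => ¬ (MIRG.empiricalQuantile A t N s ω < MIRG.degree A N i s ω ↔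
          MIRG.RegTail.thr cs α * B (N / t N) < W i ω s))
        (r := fun i => ¬ (MIRG.empiricalQuantile A t N m ω < MIRG.degree A N i m ω ↔
          MIRG.RegTail.thr cm α * B (N / t N) < W i ω m)) fun i hi => by tauto)
      refine (abs_sub_le _ (MIRG.count fun i : Fin N => MIRG.RegTail.thr cs α * B (N / t N) < W i ω s ∧
          MIRG.RegTail.thr cm α * B (N / t N) < W i ω m) _).trans ?_
      have v3' : |(MIRG.count fun i : Fin N => MIRG.RegTail.thr cs α * B (N / t N) < W i ω s ∧
          MIRG.RegTail.thr cm α * B (N / t N) < W i ω m) - lam * t N| ≤ e / 3 * t N := v3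
      linarith
    · rw [one_mul] at v4
      have k1 := MIRG.abs_count_sub_le (N := N)
        (p := fun i => MIRG.empiricalQuantile A t N s ω < MIRG.degree A N i s ω)
        (q := fun i => MIRG.RegTail.thr cs α * B (N / t N) < W i ω s)
      refine (abs_sub_le _ (MIRG.count fun i : Fin N =>
        MIRG.RegTail.thr cs α * B (N / t N) < W i ω s) _).trans ?_
      have := mul_pos he0 ht0'
      linarith
  simpa only [MIRG.Whp, not_lt] using final
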